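/- Let $a\in\mathbb C$, $a\neq 0$, and let $\varphi:\mathbb P^1\times\mathbb P^1\dashrightarrow\mathbb P^1\times\mathbb P^1$ be the birational map (Hietarinta--Viallet map) $$\varphi(x,y)=\left(y,\,-x+y+\frac{a}{y^2}\right),\qquad \varphi^{-1}(x,y)=\left(-y+x+\frac{a}{x^2},\,x\right).$$ Use on $\mathbb P^1\times\mathbb P^1$ the coordinates $(x,y),(x,1/y),(1/x,y),(1/x,1/y)$. Blowing up the point $(u,v)=(u_0,v_0)$ of a surface with local coordinates $(u,v)$ replaces it by an exceptional curve covered by the two charts $\left(u-u_0,\frac{v-v_0}{u-u_0}\right)$ and $\left(\frac{u-u_0}{v-v_0},v-v_0\right)$. Let $\pi:X\to\mathbb P^1\times\mathbb P^1$ be the smooth rational surface obtained from $\mathbb P^1\times\mathbb P^1$ by the following fourteen successive blow-ups (the centre of each is given in the coordinates named in front of it). Over $(x,y)=(0,\infty)$: $E_5$: $\left(x,\frac1y\right)=(0,0)$; $E_6$: $\left(x,\frac1{xy}\right)=(0,0)$; $E_7$: $\left(x^2y,\frac1{xy}\right)=(a,0)$; $E_8$: $\left(xy(x^2y-a),\frac1{xy}\right)=(0,0)$.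 Over $(x,y)=(\infty,\infty)$: $E_9$: $\left(\frac1x,\frac1y\right)=(0,0)$; $E_{10}$: $\left(\frac1x,\frac xy\right)=(0,1)$; $E_{11}$: $\left(\frac1x,x\left(\frac xy-1\right)\right)=(0,0)$; $E_{12}$: $\left(\frac1{x^2(x/y-1)},x\left(\frac xy-1\right)\right)=(0,0)$; $E_{13}$: $\left(\frac1{x^2(x/y-1)},x^3\left(\frac xy-1\right)^2\right)=(0,a)$; $E_{14}$: $\left(\frac1{x^2(x/y-1)},x^2\left(\frac xy-1\right)\left(x^3\left(\frac xy-1\right)^2-a\right)\right)=(0,0)$. Over $(x,y)=(\infty,0)$: $E_1$: $\left(\frac1x,y\right)=(0,0)$; $E_2$: $\left(\frac1{xy},y\right)=(0,0)$; $E_3$: $\left(\frac1{xy},xy^2\right)=(0,a)$; $E_4$: $\left(\frac1{xy},xy(xy^2-a)\right)=(0,0)$. Then $\varphi$ lifts to a biregular automorphism of $X$: there is a bijection $F:X\to X$ such that $F$ and $F^{-1}$ are regular, $\pi(F(q))=\varphi(\pi(q))$ for all $q\in X$ with $\pi(q)=(x,y)\in\mathbb C^2$, $y\neq0$, and $\pi(F^{-1}(q))=\varphi^{-1}(\pi(q))$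 for all $q\in X$ with $\pi(q)=(x,y)\in\mathbb C^2$, $x\neq0$. -/

import Mathlib

open scoped Classical in
/-- The point of `ℙ¹ = ℂ ∪ {∞}` whose inverse coordinate `1/x` is `u`; so `u = 0` gives `∞`. -/
noncomputable def invPt (u : ℂ) : OnePoint ℂ :=
  if u = 0 then OnePoint.infty else ((u⁻¹ : ℂ) : OnePoint ℂ)

/-! ### Regular functions and maps on the affine plane `ℂ²` -/

/-- The value of a polynomial in two variables at a point of `ℂ²`. -/
noncomputable def ev (P : MvPolynomial (Fin 2) ℂ) (w : ℂ × ℂ) : ℂ :=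
  MvPolynomial.eval ![w.1, w.2] P

/-- The filter of Zariski neighbourhoods of a point `z` of the affine plane `ℂ²`: the sets that
contain a principal open set `{Q ≠ 0}` containing `z`. -/
def zariskiNhds (z : ℂ × ℂ) : Filter (ℂ × ℂ) where
  sets := {s | ∃ Q, ev Q z ≠ 0 ∧ ∀ w, ev Q w ≠ 0 → w ∈ s}
  univ_sets := ⟨1, by simp [ev], by simp⟩
  sets_of_superset := by
    rintro s t ⟨Q, hz, hQ⟩ hst
    exact ⟨Q, hz, fun w hw => hst (hQ w hw)⟩
  inter_sets := by
    rintro s t ⟨Q, hz, hQ⟩ ⟨R, hz', hR⟩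
    refine ⟨Q * R, ?_, fun w hw => ?_⟩
    · simp only [ev, map_mul] at *
      exact mul_ne_zero hz hz'
    · simp only [ev, map_mul] at hw
      exact ⟨hQ w (left_ne_zero_of_mul hw), hR w (right_ne_zero_of_mul hw)⟩

/-- Zariski open subsets of `ℂ²`. -/
def IsZariskiOpen (U : Set (ℂ × ℂ)) : Prop := ∀ z ∈ U, U ∈ zariskiNhds z

/-- A function is regular at `z` if on a Zariski neighbourhood of `z` it is a quotient of two
polynomials, with denominator not vanishing at `z`. -/
def RegFunAt (f : ℂ × ℂ → ℂ) (z : ℂ × ℂ) : Prop :=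
  ∃ P Q, ev Q z ≠ 0 ∧ ∀ᶠ w in zariskiNhds z, f w = ev P w / ev Q w

/-- A map `ℂ² → ℂ²` is regular at `z` if both of its components are. -/
def RegMapAt (g : ℂ × ℂ → ℂ × ℂ) (z : ℂ × ℂ) : Prop :=
  RegFunAt (fun w => (g w).1) z ∧ RegFunAt (fun w => (g w).2) z

/-- Let `p : d → A` and `p' : d' → B` be parametrizations by subsets `d`, `d'` of `ℂ²`.
The map `f : A → B` is regular at the point `p z`, as seen in these two charts. -/
def RegInCharts {A B : Type} (d : Set (ℂ × ℂ)) (p : ℂ × ℂ → A) (d' : Set (ℂ × ℂ))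
    (p' : ℂ × ℂ → B) (f : A → B) (z : ℂ × ℂ) : Prop :=
  ∃ g : ℂ × ℂ → ℂ × ℂ, RegMapAt g z ∧
    ∀ᶠ w in zariskiNhds z, w ∈ d → g w ∈ d' ∧ f (p w) = p' (g w)

theorem zariski_self_mem {z : ℂ × ℂ} {s : Set (ℂ × ℂ)} (h : s ∈ zariskiNhds z) : z ∈ s := by
  obtain ⟨Q, hz, hQ⟩ := h
  exact hQ z hz

theorem zariski_ne {P : MvPolynomial (Fin 2) ℂ} {z : ℂ × ℂ} (h : ev P z ≠ 0) :
    ∀ᶠ w in zariskiNhds z, ev P w ≠ 0 := ⟨P, h, fun _ hw => hw⟩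

theorem regFunAt_const (c : ℂ) (z : ℂ × ℂ) : RegFunAt (fun _ => c) z := by
  exact ⟨MvPolynomial.C c, 1, by simp [ev], .of_forall fun w => by simp [ev]⟩

theorem regFunAt_fst (z : ℂ × ℂ) : RegFunAt (fun w => w.1) z := by
  exact ⟨MvPolynomial.X 0, 1, by simp [ev], .of_forall fun w => by simp [ev]⟩

theorem regFunAt_snd (z : ℂ × ℂ) : RegFunAt (fun w => w.2) z := by
  exact ⟨MvPolynomial.X 1, 1, by simp [ev], .of_forall fun w => by simp [ev]⟩

theorem RegFunAt.add {f g : ℂ × ℂ → ℂ} {z : ℂ × ℂ} (hf : RegFunAt f z) (hg : RegFunAt g z) :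
    RegFunAt (fun w => f w + g w) z := by
  obtain ⟨P, Q, hz, h⟩ := hf
  obtain ⟨P', Q', hz', h'⟩ := hg
  refine ⟨P * Q' + Q * P', Q * Q', by simpa [ev] using And.intro hz hz', ?_⟩
  filter_upwards [h, h', zariski_ne hz, zariski_ne hz'] with w h1 h2 h3 h4
  rw [h1, h2, div_add_div _ _ h3 h4]
  simp [ev]

theorem RegFunAt.mul {f g : ℂ × ℂ → ℂ} {z : ℂ × ℂ} (hf : RegFunAt f z) (hg : RegFunAt g z) :
    RegFunAt (fun w => f w * g w) z := by
  obtain ⟨P, Q, hz, h⟩ := hf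
  obtain ⟨P', Q', hz', h'⟩ := hg
  refine ⟨P * P', Q * Q', by simpa [ev] using And.intro hz hz', ?_⟩
  filter_upwards [h, h'] with w h1 h2
  rw [h1, h2, div_mul_div_comm]
  simp [ev]

theorem RegFunAt.inv {f : ℂ × ℂ → ℂ} {z : ℂ × ℂ} (hf : RegFunAt f z) (h0 : f z ≠ 0) :
    RegFunAt (fun w => (f w)⁻¹) z := by
  obtain ⟨P, Q, hz, h⟩ := hf
  have h1 : f z = ev P z / ev Q z := zariski_self_mem h
  refine ⟨Q, P, fun hP => h0 (by rw [h1, hP, zero_div]), ?_⟩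
  filter_upwards [h] with w h2
  rw [h2, inv_div]

theorem RegFunAt.sub_const {f : ℂ × ℂ → ℂ} {z : ℂ × ℂ} (hf : RegFunAt f z) (c : ℂ) :
    RegFunAt (fun w => f w - c) z := by
  simpa [sub_eq_add_neg] using hf.add (regFunAt_const (-c) z)

theorem RegFunAt.eventually_ne {f : ℂ × ℂ → ℂ} {z : ℂ × ℂ} (hf : RegFunAt f z) (h0 : f z ≠ 0) :
    ∀ᶠ w in zariskiNhds z, f w ≠ 0 := by
  obtain ⟨P, Q, hz, h⟩ := hf
  have h1 : f z = ev P z / ev Q z := zariski_self_mem h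
  have hP : ev P z ≠ 0 := fun hP => h0 (by rw [h1, hP, zero_div])
  filter_upwards [h, zariski_ne hz, zariski_ne hP] with w h2 h3 h4
  rw [h2]
  exact div_ne_zero h4 h3

theorem RegMapAt.ev_comp {g : ℂ × ℂ → ℂ × ℂ} {z : ℂ × ℂ} (hg : RegMapAt g z)
    (P : MvPolynomial (Fin 2) ℂ) : RegFunAt (fun w => ev P (g w)) z := by
  induction P using MvPolynomial.induction_on with
  | C c => simpa [ev] using regFunAt_const c z
  | add p q hp hq => simpa [ev] using hp.add hq
  | mul_X p i hp =>
    have hi : RegFunAt (fun w => (![(g w).1, (g w).2] : Fin 2 → ℂ) i) z := by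
      fin_cases i
      · simpa using hg.1
      · simpa using hg.2
    simpa [ev] using hp.mul hi

theorem RegMapAt.tendsto {g : ℂ × ℂ → ℂ × ℂ} {z : ℂ × ℂ} (hg : RegMapAt g z) :
    Filter.Tendsto g (zariskiNhds z) (zariskiNhds (g z)) := by
  rintro s ⟨Q, hz, hQ⟩
  exact ((hg.ev_comp Q).eventually_ne hz).mono fun w hw => hQ _ hw

theorem RegFunAt.comp {f : ℂ × ℂ → ℂ} {g : ℂ × ℂ → ℂ × ℂ} {z : ℂ × ℂ} (hf : RegFunAt f (g z))
    (hg : RegMapAt g z) : RegFunAt (fun w => f (g w)) z := by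
  obtain ⟨P, Q, hz, h⟩ := hf
  obtain ⟨A, B, hB, hAB⟩ := (hg.ev_comp P).mul ((hg.ev_comp Q).inv hz)
  refine ⟨A, B, hB, ?_⟩
  filter_upwards [hAB, hg.tendsto.eventually h] with w h1 h2
  rw [h2, ← h1, div_eq_mul_inv]

theorem RegMapAt.comp {f g : ℂ × ℂ → ℂ × ℂ} {z : ℂ × ℂ} (hf : RegMapAt f (g z))
    (hg : RegMapAt g z) : RegMapAt (fun w => f (g w)) z :=
  ⟨hf.1.comp hg, hf.2.comp hg⟩

theorem regMapAt_id (z : ℂ × ℂ) : RegMapAt (fun w => w) z := ⟨regFunAt_fst z, regFunAt_snd z⟩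

/-! ### Algebraic surfaces given by charts -/

/-- A smooth complex algebraic surface (with its set `Pt` of closed points), given by a finite
atlas: each chart is a bijection `par i` of a Zariski open set `dom i ⊆ ℂ²` with a subset of the
surface, the charts cover, and all changes of charts are regular (between open sets). -/
structure AlgSurface where
  /-- the points -/
  Pt : Type
  /-- the index set of the atlas -/
  Idx : Type
  /-- the domains of the charts -/
  dom : Idx → Set (ℂ × ℂ)
  /-- the charts, as parametrizations; the values outside `dom i` are irrelevant -/
  par : Idx → ℂ × ℂ → Pt
  finite_idx : Finite Idx
  isOpen_dom : ∀ i, IsZariskiOpen (dom i)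
  injOn_par : ∀ i, Set.InjOn (par i) (dom i)
  cover : ∀ q, ∃ i, ∃ z ∈ dom i, par i z = q
  compat : ∀ i j, ∀ z ∈ dom i, ∀ w ∈ dom j, par i z = par j w →
    RegInCharts (dom i) (par i) (dom j) (par j) (fun q => q) z

/-- Regular maps (morphisms) between surfaces: regular at each point, in all charts. -/
def IsRegularMap {X Y : AlgSurface} (f : X.Pt → Y.Pt) : Prop :=
  ∀ i j, ∀ z ∈ X.dom i, ∀ w ∈ Y.dom j, f (X.par i z) = Y.par j w →
    RegInCharts (X.dom i) (X.par i) (Y.dom j) (Y.par j) f z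

/-- Biregular automorphisms: bijections that are regular in both directions. -/
def IsAutomorphism {X : AlgSurface} (F : X.Pt ≃ X.Pt) : Prop :=
  IsRegularMap (X := X) (Y := X) F ∧ IsRegularMap (X := X) (Y := X) F.symm

/-! ### `ℙ¹ × ℙ¹` -/

/-- The two affine charts of `ℙ¹`: the coordinate `x` (index `0`) and `1/x` (index `1`). -/
noncomputable def chartP1 (i : Fin 2) (u : ℂ) : OnePoint ℂ :=
  if i = 0 then (u : OnePoint ℂ) else invPt u

theorem invPt_zero : invPt 0 = OnePoint.infty := by simp [invPt]

theorem invPt_of_ne {u : ℂ} (h : u ≠ 0) : invPt u = ((u⁻¹ : ℂ) : OnePoint ℂ) := by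
  simp [invPt, h]

theorem invPt_eq_coe {u m : ℂ} : invPt u = (m : OnePoint ℂ) ↔ u ≠ 0 ∧ m = u⁻¹ := by
  by_cases h : u = 0
  · simp [h, invPt_zero]
  · simp [invPt_of_ne h, h, eq_comm]

theorem invPt_injective : Function.Injective invPt := by
  intro u v h
  by_cases hv : v = 0
  · subst hv
    by_contra hu
    simp [invPt_of_ne hu, invPt_zero] at h
  · rw [invPt_of_ne hv, invPt_eq_coe] at h
    exact (inv_injective h.2).symm

theorem chartP1_injective (i : Fin 2) : Function.Injective (chartP1 i) := by
  fin_cases i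
  · intro u v h
    simpa [chartP1] using h
  · intro u v h
    exact invPt_injective (by simpa [chartP1] using h)

/-- Change of charts on `ℙ¹`. -/
theorem chartP1_change {i j : Fin 2} {u v : ℂ} (h : chartP1 i u = chartP1 j v) :
    (i = j) ∨ (u ≠ 0 ∧ ∀ t : ℂ, t ≠ 0 → chartP1 i t = chartP1 j t⁻¹) := by
  fin_cases i <;> fin_cases j
  · simp
  · right
    simp only [chartP1] at h ⊢
    have h' := invPt_eq_coe.1 (by simpa using h.symm)
    refine ⟨by rw [h'.2]; exact inv_ne_zero h'.1, fun t ht => ?_⟩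
    simpa using (invPt_eq_coe.2 ⟨inv_ne_zero ht, by simp⟩).symm
  · right
    simp only [chartP1] at h ⊢
    have h' := invPt_eq_coe.1 (by simpa using h)
    refine ⟨h'.1, fun t ht => ?_⟩
    simpa using invPt_of_ne ht
  · simp

/-- Local regularity of the changes of charts on a factor `ℙ¹`. -/
theorem chartP1_reg {i j : Fin 2} {f : ℂ × ℂ → ℂ} {z : ℂ × ℂ} {v : ℂ} (hf : RegFunAt f z)
    (h : chartP1 i (f z) = chartP1 j v) :
    ∃ g : ℂ × ℂ → ℂ, RegFunAt g z ∧
      ∀ᶠ w in zariskiNhds z, chartP1 i (f w) = chartP1 j (g w) := by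
  rcases chartP1_change h with rfl | ⟨h0, h1⟩
  · exact ⟨f, hf, .of_forall fun _ => rfl⟩
  · exact ⟨_, hf.inv h0, (hf.eventually_ne h0).mono fun w hw => h1 _ hw⟩

/-- `ℙ¹ × ℙ¹` with its four affine charts: `(0,0)`, `(0,1)`, `(1,0)`, `(1,1)` are the charts with
coordinates `(x, y)`, `(x, 1/y)`, `(1/x, y)`, `(1/x, 1/y)`. -/
noncomputable def P1xP1 : AlgSurface where
  Pt := OnePoint ℂ × OnePoint ℂ
  Idx := Fin 2 × Fin 2
  dom := fun _ => Set.univ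
  par := fun i z => (chartP1 i.1 z.1, chartP1 i.2 z.2)
  finite_idx := inferInstance
  isOpen_dom := fun _ _ _ => Filter.univ_mem
  injOn_par := by
    intro i z _ w _ h
    rw [Prod.mk.injEq] at h
    exact Prod.ext (chartP1_injective _ h.1) (chartP1_injective _ h.2)
  cover := by
    have key : ∀ q : OnePoint ℂ, ∃ i u, chartP1 i u = q := by
      intro q
      induction q using OnePoint.rec with
      | infty => exact ⟨1, 0, by simp [chartP1, invPt_zero]⟩
      | coe m => exact ⟨0, m, by simp [chartP1]⟩
    rintro ⟨q, r⟩
    obtain ⟨i, u, rfl⟩ := key q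
    obtain ⟨j, v, rfl⟩ := key r
    exact ⟨(i, j), (u, v), trivial, rfl⟩
  compat := by
    intro i j z _ w _ h
    rw [Prod.mk.injEq] at h
    obtain ⟨g₁, hg₁, h₁⟩ := chartP1_reg (regFunAt_fst z) h.1
    obtain ⟨g₂, hg₂, h₂⟩ := chartP1_reg (regFunAt_snd z) h.2
    refine ⟨fun w => (g₁ w, g₂ w), ⟨hg₁, hg₂⟩, ?_⟩
    filter_upwards [h₁, h₂] with w h1 h2 _
    exact ⟨trivial, by rw [h1, h2]⟩

/-! ### Blowing up a point -/

/-- The points of the blow-up of a surface with set of points `A` at the point `p`: the points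
other than `p`, and the points of the exceptional curve `ℙ¹`. -/
abbrev BlowUpPt (A : Type) (p : A) : Type := {q : A // q ≠ p} ⊕ OnePoint ℂ

open scoped Classical in
/-- The point of the blow-up that lies over `q` if `q ≠ p`, and the point `e` of the exceptional
curve if `q = p`. -/
noncomputable def overPt {A : Type} (p q : A) (e : OnePoint ℂ) : BlowUpPt A p :=
  if h : q = p then Sum.inr e else Sum.inl ⟨q, h⟩

theorem overPt_eq_iff {A : Type} {p q q' : A} {e e' : OnePoint ℂ} :
    overPt p q e = overPt p q' e' ↔ q = q' ∧ (q = p → e = e') := by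
  by_cases h : q = p
  · by_cases h' : q' = p
    · simp [overPt, h, h']
    · simp [overPt, h, h', Ne.symm h']
  · by_cases h' : q' = p
    · simp [overPt, h, h']
    · simp [overPt, h, h']

/-- The two affine pieces of the blow-up of `ℂ²` at `z₀ = (x₀, y₀)`, with coordinates
`(s, m) = (x - x₀, (y - y₀)/(x - x₀))` (index `0`) and
`(n, t) = ((x - x₀)/(y - y₀), y - y₀)` (index `1`), projected to `ℂ²`. -/
def blowMap (z₀ : ℂ × ℂ) (b : Fin 2) (w : ℂ × ℂ) : ℂ × ℂ :=
  if b = 0 then (z₀.1 + w.1, z₀.2 + w.1 * w.2) else (z₀.1 + w.1 * w.2, z₀.2 + w.2)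

/-- The points of the exceptional curve in these pieces. The exceptional curve `ℙ¹` has the
coordinate `m = (y - y₀)/(x - x₀)`, which is `1/n` in the second piece. -/
noncomputable def exSlope (b : Fin 2) (w : ℂ × ℂ) : OnePoint ℂ :=
  if b = 0 then (w.2 : OnePoint ℂ) else invPt w.1

theorem regMapAt_blowMap (z₀ : ℂ × ℂ) (b : Fin 2) (z : ℂ × ℂ) : RegMapAt (blowMap z₀ b) z := by
  fin_cases b
  · exact ⟨(regFunAt_const z₀.1 z).add (regFunAt_fst z),
      (regFunAt_const z₀.2 z).add ((regFunAt_fst z).mul (regFunAt_snd z))⟩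
  · exact ⟨(regFunAt_const z₀.1 z).add ((regFunAt_fst z).mul (regFunAt_snd z)),
      (regFunAt_const z₀.2 z).add (regFunAt_snd z)⟩

/-- Two points of the same piece with the same image, and the same slope if the image is the
centre, agree. -/
theorem blowMap_inj {z₀ : ℂ × ℂ} {b : Fin 2} {z w : ℂ × ℂ} (h : blowMap z₀ b z = blowMap z₀ b w)
    (h' : blowMap z₀ b z = z₀ → exSlope b z = exSlope b w) : z = w := by
  obtain ⟨x₀, y₀⟩ := z₀
  obtain ⟨s, m⟩ := z
  obtain ⟨s', m'⟩ := w
  fin_cases b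
  · simp only [blowMap, exSlope, Fin.zero_eta, if_true, Prod.mk.injEq, add_right_inj,
      add_eq_left, OnePoint.coe_eq_coe] at h h' ⊢
    obtain ⟨rfl, h2⟩ := h
    by_cases hs : s = 0
    · exact ⟨rfl, h' ⟨hs, by simp [hs]⟩⟩
    · exact ⟨rfl, mul_left_cancel₀ hs h2⟩
  · simp only [blowMap, exSlope, Fin.mk_one, one_ne_zero, if_false, Prod.mk.injEq, add_right_inj,
      add_eq_left] at h h' ⊢
    obtain ⟨h1, rfl⟩ := h
    by_cases hs : m = 0
    · exact ⟨invPt_injective (h' ⟨by simp [hs], hs⟩), rfl⟩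
    · exact ⟨mul_right_cancel₀ hs h1, rfl⟩

/-- The change of charts between the two pieces. -/
theorem blowMap_change {z₀ : ℂ × ℂ} {b b' : Fin 2} {z w : ℂ × ℂ}
    (h : blowMap z₀ b z = blowMap z₀ b' w)
    (h' : blowMap z₀ b z = z₀ → exSlope b z = exSlope b' w) :
    ∃ g, RegMapAt g z ∧ ∀ᶠ v in zariskiNhds z,
      blowMap z₀ b v = blowMap z₀ b' (g v) ∧ exSlope b v = exSlope b' (g v) := by
  obtain ⟨x₀, y₀⟩ := z₀
  obtain ⟨s, m⟩ := z
  obtain ⟨s', m'⟩ := w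
  fin_cases b <;> fin_cases b'
  · exact ⟨_, regMapAt_id _, .of_forall fun _ => ⟨rfl, rfl⟩⟩
  · have hm : m ≠ 0 := by
      rintro rfl
      simp only [blowMap, exSlope, Fin.zero_eta, Fin.mk_one, one_ne_zero, if_true, if_false,
        Prod.mk.injEq, add_right_inj, add_eq_left, mul_zero] at h h'
      have hs : s = 0 := by rw [h.1, ← h.2, mul_zero]
      have := invPt_eq_coe.1 (h' ⟨hs, trivial⟩).symm
      exact inv_ne_zero this.1 this.2.symm
    refine ⟨fun v => (v.2⁻¹, v.1 * v.2), ⟨(regFunAt_snd _).inv hm,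
      (regFunAt_fst _).mul (regFunAt_snd _)⟩, ?_⟩
    filter_upwards [(regFunAt_snd (s, m)).eventually_ne hm] with v hv
    refine ⟨?_, ?_⟩
    · simp only [blowMap, Fin.zero_eta, Fin.mk_one, one_ne_zero, if_true, if_false]
      rw [mul_comm v.1, inv_mul_cancel_left₀ hv]
    · simp [exSlope, invPt_of_ne (inv_ne_zero hv)]
  · have hn : s ≠ 0 := by
      rintro rfl
      simp only [blowMap, exSlope, Fin.zero_eta, Fin.mk_one, one_ne_zero, if_true, if_false,
        Prod.mk.injEq, add_right_inj, add_eq_left, zero_mul] at h h'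
      have hm : m = 0 := by rw [h.2, ← h.1, zero_mul]
      exact (invPt_eq_coe.1 (h' ⟨trivial, hm⟩)).1 rfl
    refine ⟨fun v => (v.1 * v.2, v.1⁻¹), ⟨(regFunAt_fst _).mul (regFunAt_snd _),
      (regFunAt_fst _).inv hn⟩, ?_⟩
    filter_upwards [(regFunAt_fst (s, m)).eventually_ne hn] with v hv
    refine ⟨?_, ?_⟩
    · simp only [blowMap, Fin.zero_eta, Fin.mk_one, one_ne_zero, if_true, if_false]
      rw [mul_comm v.1, mul_assoc, mul_inv_cancel₀ hv, mul_one]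
    · simp [exSlope, invPt_of_ne hv]
  · exact ⟨_, regMapAt_id _, .of_forall fun _ => ⟨rfl, rfl⟩⟩

/-- Away from the centre, the projection of each piece has a regular inverse. -/
theorem blowMap_section {z₀ : ℂ × ℂ} {b : Fin 2} {w : ℂ × ℂ} (h : blowMap z₀ b w ≠ z₀) :
    ∃ g, RegMapAt g (blowMap z₀ b w) ∧
      ∀ᶠ v in zariskiNhds (blowMap z₀ b w), blowMap z₀ b (g v) = v := by
  obtain ⟨x₀, y₀⟩ := z₀
  obtain ⟨s, m⟩ := w
  fin_cases b
  · have hs : s ≠ 0 := by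
      rintro rfl
      simp [blowMap] at h
    have h1 := (regFunAt_fst (blowMap (x₀, y₀) 0 (s, m))).sub_const x₀
    have h2 := (regFunAt_snd (blowMap (x₀, y₀) 0 (s, m))).sub_const y₀
    have h0 : (blowMap (x₀, y₀) 0 (s, m)).1 - x₀ ≠ 0 := by simpa [blowMap] using hs
    refine ⟨fun v => (v.1 - x₀, (v.2 - y₀) * (v.1 - x₀)⁻¹), ⟨h1, h2.mul (h1.inv h0)⟩, ?_⟩
    refine (h1.eventually_ne h0).mono fun v hv => ?_
    ext
    · simp [blowMap]
    · simp only [blowMap, Fin.zero_eta, if_true]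
      rw [mul_comm (v.2 - y₀), mul_inv_cancel_left₀ hv]
      ring
  · have hs : m ≠ 0 := by
      rintro rfl
      simp [blowMap] at h
    have h1 := (regFunAt_fst (blowMap (x₀, y₀) 1 (s, m))).sub_const x₀
    have h2 := (regFunAt_snd (blowMap (x₀, y₀) 1 (s, m))).sub_const y₀
    have h0 : (blowMap (x₀, y₀) 1 (s, m)).2 - y₀ ≠ 0 := by simpa [blowMap] using hs
    refine ⟨fun v => ((v.1 - x₀) * (v.2 - y₀)⁻¹, v.2 - y₀), ⟨h1.mul (h2.inv h0), h2⟩, ?_⟩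
    refine (h2.eventually_ne h0).mono fun v hv => ?_
    ext
    · simp only [blowMap, Fin.mk_one, one_ne_zero, if_false]
      rw [inv_mul_cancel_right₀ hv]
      ring
    · simp [blowMap]

/-- The blow-up of the surface `X` at the point with coordinates `z₀ = (x₀, y₀)` in the chart `c`.
Its charts are the charts of `X` (without the centre), with the indices `Sum.inl i`, and the two
charts `(x - x₀, (y - y₀)/(x - x₀))` and `((x - x₀)/(y - y₀), y - y₀)`, where `(x, y)` are the
coordinates of the chart `c`, with the indices `Sum.inr 0` and `Sum.inr 1`. -/
noncomputable def blowUp (X : AlgSurface) (c : X.Idx) (z₀ : ℂ × ℂ) (hz₀ : z₀ ∈ X.dom c) :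
    AlgSurface where
  Pt := BlowUpPt X.Pt (X.par c z₀)
  Idx := X.Idx ⊕ Fin 2
  dom := Sum.elim (fun i => {z | z ∈ X.dom i ∧ X.par i z ≠ X.par c z₀})
    (fun b => {w | blowMap z₀ b w ∈ X.dom c})
  par := Sum.elim (fun i z => overPt (X.par c z₀) (X.par i z) OnePoint.infty)
    (fun b w => overPt (X.par c z₀) (X.par c (blowMap z₀ b w)) (exSlope b w))
  finite_idx := by
    have := X.finite_idx
    infer_instance
  isOpen_dom := by
    rintro (i | b) z hz
    · obtain ⟨hz, hzp⟩ := hz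
      by_cases hp : ∃ w ∈ X.dom i, X.par i w = X.par c z₀
      · obtain ⟨w, hw, hwp⟩ := hp
        have hne : z.1 - w.1 ≠ 0 ∨ z.2 - w.2 ≠ 0 := by
          by_contra! hc
          exact hzp (by rw [Prod.ext (sub_eq_zero.1 hc.1) (sub_eq_zero.1 hc.2), hwp])
        have hev : ∀ᶠ v in zariskiNhds z, v ≠ w := by
          rcases hne with hne | hne
          · filter_upwards [((regFunAt_fst z).sub_const w.1).eventually_ne hne] with v hv hvw
            exact hv (by rw [hvw, sub_self])
          · filter_upwards [((regFunAt_snd z).sub_const w.2).eventually_ne hne] with v hv hvw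
            exact hv (by rw [hvw, sub_self])
        filter_upwards [X.isOpen_dom i z hz, hev] with v hv hvw
        exact ⟨hv, fun h => hvw (X.injOn_par i hv hw (h.trans hwp.symm))⟩
      · filter_upwards [X.isOpen_dom i z hz] with v hv
        exact ⟨hv, fun h => hp ⟨v, hv, h⟩⟩
    · exact (regMapAt_blowMap z₀ b z).tendsto (X.isOpen_dom c _ hz)
  injOn_par := by
    rintro (i | b) z hz w hw h
    · exact X.injOn_par i hz.1 hw.1 (overPt_eq_iff.1 h).1
    · obtain ⟨h1, h2⟩ := overPt_eq_iff.1 h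
      exact blowMap_inj (X.injOn_par c hz hw h1) fun h3 => h2 (by rw [h3])
  cover := by
    rintro (⟨q, hq⟩ | e)
    · obtain ⟨i, z, hz, rfl⟩ := X.cover q
      exact ⟨Sum.inl i, z, ⟨hz, hq⟩, by simp [overPt, hq]⟩
    · induction e using OnePoint.rec with
      | infty =>
        exact ⟨Sum.inr 1, (0, 0), by simpa [blowMap] using hz₀,
          by simp [overPt, blowMap, exSlope, invPt_zero]⟩
      | coe m =>
        exact ⟨Sum.inr 0, (0, m), by simpa [blowMap] using hz₀,
          by simp [overPt, blowMap, exSlope]⟩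
  compat := by
    rintro (i | b) (j | b') z hz w hw h
    · obtain ⟨h1, -⟩ := overPt_eq_iff.1 h
      obtain ⟨g, hg, hev⟩ := X.compat i j z hz.1 w hw.1 h1
      refine ⟨g, hg, hev.mono fun v hv hvd => ?_⟩
      obtain ⟨h2, h3⟩ := hv hvd.1
      exact ⟨⟨h2, h3 ▸ hvd.2⟩, overPt_eq_iff.2 ⟨h3, fun _ => rfl⟩⟩
    · obtain ⟨h1, -⟩ := overPt_eq_iff.1 h
      obtain ⟨g, hg, hev⟩ := X.compat i c z hz.1 (blowMap z₀ b' w) hw h1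
      have h2 := (zariski_self_mem hev : _) hz.1
      have h3 : g z = blowMap z₀ b' w := X.injOn_par c h2.1 hw (h2.2.symm.trans h1)
      have h4 : blowMap z₀ b' w ≠ z₀ := fun h4 => hz.2 (by rw [h1, h4])
      obtain ⟨k, hk, hkev⟩ := blowMap_section h4
      rw [← h3] at hk hkev
      refine ⟨fun v => k (g v), hk.comp hg, ?_⟩
      filter_upwards [hev, hg.tendsto.eventually hkev] with v h5 h6 hvd
      obtain ⟨h7, h8⟩ := h5 hvd.1
      refine ⟨?_, overPt_eq_iff.2 ⟨?_, fun h => absurd h hvd.2⟩⟩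
      · change blowMap z₀ b' (k (g v)) ∈ X.dom c
        rwa [h6]
      · rw [h6, h8]
    · obtain ⟨h1, -⟩ := overPt_eq_iff.1 h
      obtain ⟨g, hg, hev⟩ := X.compat c j (blowMap z₀ b z) hz w hw.1 h1
      have hb := regMapAt_blowMap z₀ b z
      have h2 := (zariski_self_mem hev : _) hz
      have hp : ∀ᶠ v in zariskiNhds z, v ∈ {v | blowMap z₀ b v ∈ X.dom c} →
          X.par c (blowMap z₀ b v) ≠ X.par c z₀ := by
        have hne : (blowMap z₀ b z).1 - z₀.1 ≠ 0 ∨ (blowMap z₀ b z).2 - z₀.2 ≠ 0 := by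
          by_contra! hc
          exact hw.2 (by
            rw [← h1, Prod.ext (sub_eq_zero.1 hc.1) (sub_eq_zero.1 hc.2)])
        rcases hne with hne | hne
        · filter_upwards [(hb.1.sub_const z₀.1).eventually_ne hne] with v hv hvd hvp
          exact hv (by rw [X.injOn_par c hvd hz₀ hvp, sub_self])
        · filter_upwards [(hb.2.sub_const z₀.2).eventually_ne hne] with v hv hvd hvp
          exact hv (by rw [X.injOn_par c hvd hz₀ hvp, sub_self])
      refine ⟨fun v => g (blowMap z₀ b v), hg.comp hb, ?_⟩
      filter_upwards [hb.tendsto.eventually hev, hp] with v h5 h6 hvd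
      obtain ⟨h7, h8⟩ := h5 hvd
      exact ⟨⟨h7, h8 ▸ h6 hvd⟩, overPt_eq_iff.2 ⟨h8, fun h => absurd h (h6 hvd)⟩⟩
    · obtain ⟨h1, h2⟩ := overPt_eq_iff.1 h
      obtain ⟨g, hg, hev⟩ := blowMap_change (X.injOn_par c hz hw h1) fun h3 => h2 (by rw [h3])
      refine ⟨g, hg, ?_⟩
      filter_upwards [hev] with v hv hvd
      have hvd' : blowMap z₀ b v ∈ X.dom c := hvd
      refine ⟨?_, overPt_eq_iff.2 ⟨by rw [hv.1], fun _ => hv.2⟩⟩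
      change blowMap z₀ b' (g v) ∈ X.dom c
      rwa [← hv.1]

/-- The projection of the blow-up to the surface; it contracts the exceptional curve. -/
def blowDown (X : AlgSurface) (c : X.Idx) (z₀ : ℂ × ℂ) (hz₀ : z₀ ∈ X.dom c) :
    (blowUp X c z₀ hz₀).Pt → X.Pt :=
  Sum.elim (fun q => q.1) (fun _ => X.par c z₀)

/-- Two points of charts that are distinct on `X` stay distinct on the blow-up; here the first one
lies in an old chart and the second one in a new chart. -/
theorem blowUp_ne (X : AlgSurface) (c : X.Idx) (z₀ : ℂ × ℂ) (hz₀ : z₀ ∈ X.dom c) (i : X.Idx)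
    (z : ℂ × ℂ) (b : Fin 2) (w : ℂ × ℂ) (h : X.par i z ≠ X.par c (blowMap z₀ b w)) :
    (blowUp X c z₀ hz₀).par (Sum.inl i) z ≠ (blowUp X c z₀ hz₀).par (Sum.inr b) w :=
  fun h' => h (overPt_eq_iff.1 h').1

/-- The same for two points in old charts. -/
theorem blowUp_ne' (X : AlgSurface) (c : X.Idx) (z₀ : ℂ × ℂ) (hz₀ : z₀ ∈ X.dom c) (i : X.Idx)
    (z : ℂ × ℂ) (j : X.Idx) (w : ℂ × ℂ) (h : X.par i z ≠ X.par j w) :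
    (blowUp X c z₀ hz₀).par (Sum.inl i) z ≠ (blowUp X c z₀ hz₀).par (Sum.inl j) w :=
  fun h' => h (overPt_eq_iff.1 h').1

/-! ### The fourteen blow-ups

`X5, …, X8` blow up over `(0, ∞)`, then `X9, X10, …, X14` over `(∞, ∞)`, and finally
`X1, …, X4` over `(∞, 0)`. The surface `Xk` arises by the blow-up with exceptional curve `E_k`.
The comments give the coordinates (as functions of `x`, `y`) of the chart that contains the centre,
and the centre. -/

theorem P1xP1_ne₁ (i j : Fin 2) (w : ℂ × ℂ) :
    P1xP1.par (1, i) (0, 0) ≠ P1xP1.par (0, j) w := by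
  intro h
  have h1 : chartP1 1 0 = chartP1 0 w.1 := (Prod.mk.inj h).1
  simp [chartP1, invPt_zero] at h1

theorem P1xP1_ne₂ (w : ℂ × ℂ) : P1xP1.par (1, 0) (0, 0) ≠ P1xP1.par (1, 1) w := by
  intro h
  have h1 : chartP1 0 0 = chartP1 1 w.2 := (Prod.mk.inj h).2
  have h2 := invPt_eq_coe.1 (by simpa [chartP1] using h1.symm)
  exact inv_ne_zero h2.1 h2.2.symm

/-- `(x, 1/y)` at `(0, 0)` -/
noncomputable def X5 : AlgSurface := blowUp P1xP1 (0, 1) (0, 0) trivial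

/-- `(x, 1/(xy))` at `(0, 0)` -/
noncomputable def X6 : AlgSurface := blowUp X5 (Sum.inr 0) (0, 0) trivial

/-- `(x²y, 1/(xy))` at `(a, 0)` -/
noncomputable def X7 (a : ℂ) : AlgSurface := blowUp X6 (Sum.inr 1) (a, 0) trivial

/-- `(xy(x²y - a), 1/(xy))` at `(0, 0)` -/
noncomputable def X8 (a : ℂ) : AlgSurface := blowUp (X7 a) (Sum.inr 1) (0, 0) trivial

/-- The charts `(1/x, y)` and `(1/x, 1/y)` of `ℙ¹ × ℙ¹`, as charts of `X8`. -/
def old8 (a : ℂ) (i : Fin 2) : (X8 a).Idx := Sum.inl (Sum.inl (Sum.inl (Sum.inl (1, i))))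

theorem old8_mem (a : ℂ) (i : Fin 2) : ((0, 0) : ℂ × ℂ) ∈ (X8 a).dom (old8 a i) := by
  refine ⟨⟨⟨⟨trivial, P1xP1_ne₁ i 1 _⟩, ?_⟩, ?_⟩, ?_⟩
  · exact blowUp_ne _ _ _ _ _ _ _ _ (P1xP1_ne₁ i 1 _)
  · exact blowUp_ne _ _ _ _ _ _ _ _ (blowUp_ne _ _ _ _ _ _ _ _ (P1xP1_ne₁ i 1 _))
  · exact blowUp_ne _ _ _ _ _ _ _ _ (blowUp_ne _ _ _ _ _ _ _ _
      (blowUp_ne _ _ _ _ _ _ _ _ (P1xP1_ne₁ i 1 _)))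

theorem old8_ne (a : ℂ) (w : ℂ × ℂ) :
    (X8 a).par (old8 a 0) (0, 0) ≠ (X8 a).par (old8 a 1) w :=
  blowUp_ne' _ _ _ _ _ _ _ _ (blowUp_ne' _ _ _ _ _ _ _ _ (blowUp_ne' _ _ _ _ _ _ _ _
    (blowUp_ne' _ _ _ _ _ _ _ _ (P1xP1_ne₂ w))))

/-- `(1/x, 1/y)` at `(0, 0)` -/
noncomputable def X9 (a : ℂ) : AlgSurface := blowUp (X8 a) (old8 a 1) (0, 0) (old8_mem a 1)

theorem X9_mem (a : ℂ) {b : Fin 2} {w : ℂ × ℂ} (h : blowMap (0, 0) b w = (0, 0)) :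
    w ∈ (X9 a).dom (Sum.inr b) := by
  change blowMap (0, 0) b w ∈ (X8 a).dom (old8 a 1)
  rw [h]
  exact old8_mem a 1

theorem X9_mem₀ (a m : ℂ) : ((0, m) : ℂ × ℂ) ∈ (X9 a).dom (Sum.inr 0) :=
  X9_mem a (by simp [blowMap])

/-- `(1/x, x/y)` at `(0, 1)` -/
noncomputable def X10 (a : ℂ) : AlgSurface := blowUp (X9 a) (Sum.inr 0) (0, 1) (X9_mem₀ a 1)

theorem X10_mem (a m : ℂ) : ((0, m) : ℂ × ℂ) ∈ (X10 a).dom (Sum.inr 0) := by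
  change blowMap (0, 1) 0 (0, m) ∈ (X9 a).dom (Sum.inr 0)
  simpa [blowMap] using X9_mem₀ a 1

/-- `(1/x, x(x/y - 1))` at `(0, 0)` -/
noncomputable def X11 (a : ℂ) : AlgSurface := blowUp (X10 a) (Sum.inr 0) (0, 0) (X10_mem a 0)

theorem X11_mem (a n : ℂ) : ((n, 0) : ℂ × ℂ) ∈ (X11 a).dom (Sum.inr 1) := by
  change blowMap (0, 0) 1 (n, 0) ∈ (X10 a).dom (Sum.inr 0)
  simpa [blowMap] using X10_mem a 0

/-- `(1/(x²(x/y - 1)), x(x/y - 1))` at `(0, 0)` -/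
noncomputable def X12 (a : ℂ) : AlgSurface := blowUp (X11 a) (Sum.inr 1) (0, 0) (X11_mem a 0)

theorem X12_mem (a m : ℂ) : ((0, m) : ℂ × ℂ) ∈ (X12 a).dom (Sum.inr 0) := by
  change blowMap (0, 0) 0 (0, m) ∈ (X11 a).dom (Sum.inr 1)
  simpa [blowMap] using X11_mem a 0

/-- `(1/(x²(x/y - 1)), x³(x/y - 1)²)` at `(0, a)` -/
noncomputable def X13 (a : ℂ) : AlgSurface := blowUp (X12 a) (Sum.inr 0) (0, a) (X12_mem a a)

theorem X13_mem (a m : ℂ) : ((0, m) : ℂ × ℂ) ∈ (X13 a).dom (Sum.inr 0) := by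
  change blowMap (0, a) 0 (0, m) ∈ (X12 a).dom (Sum.inr 0)
  simpa [blowMap] using X12_mem a a

/-- `(1/(x²(x/y - 1)), x²(x/y - 1)(x³(x/y - 1)² - a))` at `(0, 0)` -/
noncomputable def X14 (a : ℂ) : AlgSurface := blowUp (X13 a) (Sum.inr 0) (0, 0) (X13_mem a 0)

/-- The chart `(1/x, y)` of `ℙ¹ × ℙ¹`, as a chart of `X14`. -/
def old14 (a : ℂ) : (X14 a).Idx :=
  Sum.inl (Sum.inl (Sum.inl (Sum.inl (Sum.inl (Sum.inl (old8 a 0))))))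

theorem old14_mem (a : ℂ) : ((0, 0) : ℂ × ℂ) ∈ (X14 a).dom (old14 a) := by
  have h9 := fun b w => blowUp_ne (X8 a) (old8 a 1) (0, 0) (old8_mem a 1) _ _ b w (old8_ne a _)
  have h10 := fun b w => blowUp_ne (X9 a) (Sum.inr 0) (0, 1) (X9_mem₀ a 1) _ _ b w (h9 _ _)
  have h11 := fun b w => blowUp_ne (X10 a) (Sum.inr 0) (0, 0) (X10_mem a 0) _ _ b w (h10 _ _)
  have h12 := fun b w => blowUp_ne (X11 a) (Sum.inr 1) (0, 0) (X11_mem a 0) _ _ b w (h11 _ _)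
  have h13 := fun b w => blowUp_ne (X12 a) (Sum.inr 0) (0, a) (X12_mem a a) _ _ b w (h12 _ _)
  exact ⟨⟨⟨⟨⟨⟨old8_mem a 0, old8_ne a _⟩, h9 _ _⟩, h10 _ _⟩, h11 _ _⟩, h12 _ _⟩, h13 _ _⟩

/-- `(1/x, y)` at `(0, 0)` -/
noncomputable def X1 (a : ℂ) : AlgSurface := blowUp (X14 a) (old14 a) (0, 0) (old14_mem a)

theorem X1_mem (a n : ℂ) : ((n, 0) : ℂ × ℂ) ∈ (X1 a).dom (Sum.inr 1) := by
  change blowMap (0, 0) 1 (n, 0) ∈ (X14 a).dom (old14 a)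
  simpa [blowMap] using old14_mem a

/-- `(1/(xy), y)` at `(0, 0)` -/
noncomputable def X2 (a : ℂ) : AlgSurface := blowUp (X1 a) (Sum.inr 1) (0, 0) (X1_mem a 0)

theorem X2_mem (a m : ℂ) : ((0, m) : ℂ × ℂ) ∈ (X2 a).dom (Sum.inr 0) := by
  change blowMap (0, 0) 0 (0, m) ∈ (X1 a).dom (Sum.inr 1)
  simpa [blowMap] using X1_mem a 0

/-- `(1/(xy), xy²)` at `(0, a)` -/
noncomputable def X3 (a : ℂ) : AlgSurface := blowUp (X2 a) (Sum.inr 0) (0, a) (X2_mem a a)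

theorem X3_mem (a m : ℂ) : ((0, m) : ℂ × ℂ) ∈ (X3 a).dom (Sum.inr 0) := by
  change blowMap (0, a) 0 (0, m) ∈ (X2 a).dom (Sum.inr 0)
  simpa [blowMap] using X2_mem a a

/-- `(1/(xy), xy(xy² - a))` at `(0, 0)` -/
noncomputable def X4 (a : ℂ) : AlgSurface := blowUp (X3 a) (Sum.inr 0) (0, 0) (X3_mem a 0)

/-- The surface obtained by all fourteen blow-ups. -/
noncomputable def hvSurface (a : ℂ) : AlgSurface := X4 a

/-- The projection of the surface to `ℙ¹ × ℙ¹`. -/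
noncomputable def hvProj (a : ℂ) (q : (hvSurface a).Pt) : OnePoint ℂ × OnePoint ℂ :=
  (blowDown P1xP1 (0, 1) (0, 0) trivial ∘ blowDown X5 (Sum.inr 0) (0, 0) trivial ∘
    blowDown X6 (Sum.inr 1) (a, 0) trivial ∘ blowDown (X7 a) (Sum.inr 1) (0, 0) trivial ∘
    blowDown (X8 a) (old8 a 1) (0, 0) (old8_mem a 1) ∘
    blowDown (X9 a) (Sum.inr 0) (0, 1) (X9_mem₀ a 1) ∘
    blowDown (X10 a) (Sum.inr 0) (0, 0) (X10_mem a 0) ∘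
    blowDown (X11 a) (Sum.inr 1) (0, 0) (X11_mem a 0) ∘
    blowDown (X12 a) (Sum.inr 0) (0, a) (X12_mem a a) ∘
    blowDown (X13 a) (Sum.inr 0) (0, 0) (X13_mem a 0) ∘
    blowDown (X14 a) (old14 a) (0, 0) (old14_mem a) ∘
    blowDown (X1 a) (Sum.inr 1) (0, 0) (X1_mem a 0) ∘
    blowDown (X2 a) (Sum.inr 0) (0, a) (X2_mem a a) ∘
    blowDown (X3 a) (Sum.inr 0) (0, 0) (X3_mem a 0)) q

/-! ### The map -/

/-- The Hietarinta–Viallet map `φ(x, y) = (y, -x + y + a/y²)`, as a map on the set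
`{y ≠ 0} ⊆ ℂ² ⊆ ℙ¹ × ℙ¹`, which is dense in `ℙ¹ × ℙ¹`. -/
noncomputable def hvMap (a : ℂ) (w : ℂ × ℂ) : ℂ × ℂ := (w.2, -w.1 + w.2 + a / w.2 ^ 2)

/-- The inverse map `φ⁻¹(x, y) = (-y + x + a/x², x)`, on the set `{x ≠ 0} ⊆ ℂ²`. -/
noncomputable def hvInv (a : ℂ) (w : ℂ × ℂ) : ℂ × ℂ := (-w.2 + w.1 + a / w.1 ^ 2, w.1)

/-- The point of `ℙ¹ × ℙ¹` with the finite coordinates `(x, y)`. -/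
def affPt (w : ℂ × ℂ) : OnePoint ℂ × OnePoint ℂ := (w.1, w.2)

/-- The map `F` of the surface is a lift of the rational map of `ℙ¹ × ℙ¹` that is represented by
`f` on the (dense, Zariski open) set `U` of finite points. -/
def IsLiftOf (a : ℂ) (F : (hvSurface a).Pt → (hvSurface a).Pt) (U : Set (ℂ × ℂ))
    (f : ℂ × ℂ → ℂ × ℂ) : Prop :=
  ∀ q, ∀ w ∈ U, hvProj a q = affPt w → hvProj a (F q) = affPt (f w)

/-!
The map `φ` is the composition `σ ∘ ι` of two birational involutions, the transposition
`σ (x, y) = (y, x)` and `ι (x, y) = (-x + y + a/y², y)`, and each of them lifts to an involutive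
automorphism of the surface. So `F` is the lift of `ι` followed by the lift of `σ`, and `F⁻¹` is
composed of the same two lifts in the other order.

To lift an involution `f`, it suffices to extend it locally around every point of the surface
(`exists_lift_involution`). The surface is separated: two regular maps to it that agree at generic
points agree (`isSeparated_hvSurface`; the property is inherited by blow-ups, see
`isSeparated_blowUp`). Hence local extensions of the same rational map have the same values, and
they patch to a regular map (`exists_regular_extension`), whose square is the identity since it is
so at generic points. As no centre lies over `ℂ²`, the projection is injective over `ℂ²`
(`hvProj_injective_over`), which identifies the patched map with `f` there.

The local extensions are rational formulas in the charts. The points of the surface are the finite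
points, the points at infinity, and for each exceptional curve the points of one affine line and
one further point, less the centres of later blow-ups (`forall_hvSurface`). The transposition
exchanges `E₁, E₂, E₃, E₄` with `E₅, E₆, E₇, E₈`, where it exchanges the coordinates of the charts,
and preserves each of `E₉, …, E₁₄`. The involution `ι` exchanges `E₅, E₆, E₇, E₈` with
`E₁₁, E₁₂, E₁₃, E₁₄`, exchanges `E₁` with `E₃`, the line `y = ∞` with `E₁₀`, and the line `y = 0`
with `E₄`, and preserves `E₂`, `E₉` and the line `x = ∞`. A formula is verified by checking that its
projection to `ℙ¹ × ℙ¹` is on the graph of the involution (`OnGraph`). For a curve that arises by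
further blow-ups the formula follows from the one for the first curve of the chain, after a factor
that cancels has been split off (`e6_coordinate_sub`, `e12_coordinate_sub`).
-/

/-! ### Generic points of the affine plane -/

/-- The filter of dense Zariski open subsets of `ℂ²`: the sets that contain a nonempty principal
open set `{Q ≠ 0}`. -/
def genericFilter : Filter (ℂ × ℂ) where
  sets := {s | ∃ Q : MvPolynomial (Fin 2) ℂ, Q ≠ 0 ∧ ∀ w, ev Q w ≠ 0 → w ∈ s}
  univ_sets := ⟨1, one_ne_zero, by simp⟩
  sets_of_superset := by
    rintro s t ⟨Q, hz, hQ⟩ hst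
    exact ⟨Q, hz, fun w hw => hst (hQ w hw)⟩
  inter_sets := by
    rintro s t ⟨Q, hz, hQ⟩ ⟨R, hz', hR⟩
    refine ⟨Q * R, mul_ne_zero hz hz', fun w hw => ?_⟩
    simp only [ev, map_mul] at hw
    exact ⟨hQ w (left_ne_zero_of_mul hw), hR w (right_ne_zero_of_mul hw)⟩

theorem genericFilter_le (z : ℂ × ℂ) : genericFilter ≤ zariskiNhds z := by
  rintro s ⟨Q, hz, hQ⟩
  exact ⟨Q, by rintro rfl; simp [ev] at hz, hQ⟩

theorem eventually_generic {z : ℂ × ℂ} {p : ℂ × ℂ → Prop} (h : ∀ᶠ w in zariskiNhds z, p w) :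
    ∀ᶠ w in genericFilter, p w :=
  genericFilter_le z h

theorem eq_zero_of_ev {P : MvPolynomial (Fin 2) ℂ} (h : ∀ w, ev P w = 0) : P = 0 := by
  refine MvPolynomial.funext fun x => ?_
  have := h (x 0, x 1)
  rw [map_zero, ← this, ev]
  congr 2
  ext i
  fin_cases i <;> rfl

theorem exists_ev_ne_zero {P : MvPolynomial (Fin 2) ℂ} (h : P ≠ 0) : ∃ w, ev P w ≠ 0 := by
  by_contra! hc
  exact h (eq_zero_of_ev hc)

instance : genericFilter.NeBot := by
  refine ⟨fun h => ?_⟩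
  obtain ⟨Q, hQ, h'⟩ : (∅ : Set (ℂ × ℂ)) ∈ genericFilter := by rw [h]; trivial
  obtain ⟨w, hw⟩ := exists_ev_ne_zero hQ
  exact h' w hw

theorem RegFunAt.generic_ne {f : ℂ × ℂ → ℂ} {z : ℂ × ℂ} (hf : RegFunAt f z) (h0 : f z ≠ 0) :
    ∀ᶠ w in genericFilter, f w ≠ 0 :=
  eventually_generic (hf.eventually_ne h0)

/-- A regular function that vanishes at generic points vanishes. -/
theorem RegFunAt.eq_zero {f : ℂ × ℂ → ℂ} {z : ℂ × ℂ} (hf : RegFunAt f z)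
    (h : ∀ᶠ w in genericFilter, f w = 0) : f z = 0 := by
  by_contra h0
  obtain ⟨w, h1, h2⟩ := ((hf.generic_ne h0).and h).exists
  exact h1 h2

theorem zariski_eventually_eventually {z : ℂ × ℂ} {p : ℂ × ℂ → Prop}
    (h : ∀ᶠ w in zariskiNhds z, p w) : ∀ᶠ w in zariskiNhds z, ∀ᶠ v in zariskiNhds w, p v := by
  obtain ⟨Q, hz, hQ⟩ := h
  exact ⟨Q, hz, fun w hw => ⟨Q, hw, hQ⟩⟩

theorem RegFunAt.eventually {f : ℂ × ℂ → ℂ} {z : ℂ × ℂ} (hf : RegFunAt f z) :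
    ∀ᶠ w in zariskiNhds z, RegFunAt f w := by
  obtain ⟨P, Q, hz, h⟩ := hf
  filter_upwards [zariski_eventually_eventually h, zariski_ne hz] with w h1 h2
  exact ⟨P, Q, h2, h1⟩

theorem RegMapAt.eventually {g : ℂ × ℂ → ℂ × ℂ} {z : ℂ × ℂ} (hg : RegMapAt g z) :
    ∀ᶠ w in zariskiNhds z, RegMapAt g w :=
  hg.1.eventually.and hg.2.eventually

/-- The affine plane is irreducible: a regular function vanishes near a point or is nonzero at
generic points. -/
theorem RegFunAt.eventually_zero_or_ne {f : ℂ × ℂ → ℂ} {z : ℂ × ℂ} (hf : RegFunAt f z) :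
    (∀ᶠ w in zariskiNhds z, f w = 0) ∨ ∀ᶠ w in genericFilter, f w ≠ 0 := by
  obtain ⟨P, R, hR, h⟩ := hf
  by_cases hP : P = 0
  · exact .inl (h.mono fun w hw => by simp [hw, hP, ev])
  · obtain ⟨w, hw⟩ := exists_ev_ne_zero hP
    refine .inr ?_
    filter_upwards [eventually_generic h, eventually_generic (zariski_ne hR),
      eventually_generic (zariski_ne hw)] with v h1 h2 h3
    rw [h1]
    exact div_ne_zero h3 h2

/-- A regular map with a regular right inverse maps generic points to generic points. -/
theorem RegMapAt.tendsto_generic {h k : ℂ × ℂ → ℂ × ℂ} {z z' : ℂ × ℂ} (hh : RegMapAt h z)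
    (hk : RegMapAt k z') (hkz : k z' = z) (hinv : ∀ᶠ w in zariskiNhds z', h (k w) = w) :
    Filter.Tendsto h genericFilter genericFilter := by
  rintro s ⟨Q, hQ, hs⟩
  rcases (hh.ev_comp Q).eventually_zero_or_ne with h0 | h0
  · subst hkz
    obtain ⟨v, hv⟩ := exists_ev_ne_zero hQ
    obtain ⟨w, ⟨h1, h2⟩, h3⟩ := ((eventually_generic (hinv.and (hk.tendsto.eventually h0))).and
      (eventually_generic (zariski_ne hv))).exists
    rw [h1] at h2
    exact absurd h2 h3
  · exact h0.mono fun w hw => hs _ hw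

/-! ### Regular maps in charts -/

theorem RegInCharts.comp {A B C : Type} {d d' d'' : Set (ℂ × ℂ)} {p : ℂ × ℂ → A}
    {p' : ℂ × ℂ → B} {p'' : ℂ × ℂ → C} {f : A → B} {f' : B → C} {z : ℂ × ℂ} (hz : z ∈ d)
    (hf : RegInCharts d p d' p' f z)
    (hf' : ∀ w ∈ d', f (p z) = p' w → RegInCharts d' p' d'' p'' f' w) :
    RegInCharts d p d'' p'' (f' ∘ f) z := by
  obtain ⟨g, hg, h⟩ := hf
  obtain ⟨h1, h2⟩ := zariski_self_mem h hz
  obtain ⟨g', hg', h'⟩ := hf' _ h1 h2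
  refine ⟨fun w => g' (g w), hg'.comp hg, ?_⟩
  filter_upwards [h, hg.tendsto.eventually h'] with w h3 h4 hw
  obtain ⟨h5, h6⟩ := h3 hw
  obtain ⟨h7, h8⟩ := h4 h5
  exact ⟨h7, by rw [Function.comp_apply, h6, h8]⟩

/-- Regularity at each point needs to be checked in one pair of charts only. -/
theorem isRegularMap_of_charts {X Y : AlgSurface} {f : X.Pt → Y.Pt}
    (h : ∀ q, ∃ i, ∃ z ∈ X.dom i, X.par i z = q ∧
      ∃ j, RegInCharts (X.dom i) (X.par i) (Y.dom j) (Y.par j) f z) : IsRegularMap f := by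
  intro i' j' z' hz' w' hw' hzw
  obtain ⟨i, z, hz, hq, j, hj⟩ := h (X.par i' z')
  have h1 := X.compat i' i z' hz' z hz hq.symm
  have h2 : RegInCharts (X.dom i') (X.par i') (Y.dom j) (Y.par j) (f ∘ fun q => q) z' := by
    refine h1.comp hz' fun w hw hww => ?_
    have : w = z := X.injOn_par i hw hz (by rw [hq]; exact hww.symm)
    rwa [this]
  have h3 := h2.comp hz' (f' := fun q => q) (d'' := Y.dom j') (p'' := Y.par j')
    fun w hw hww => Y.compat j j' w hw w' hw' (by rw [← hww]; exact hzw)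
  exact h3

theorem IsRegularMap.comp {X Y Z : AlgSurface} {f' : Y.Pt → Z.Pt} {f : X.Pt → Y.Pt}
    (hf' : IsRegularMap f') (hf : IsRegularMap f) : IsRegularMap (X := X) (Y := Z) (f' ∘ f) := by
  intro i j z hz w hw hzw
  obtain ⟨k, v, hv, hkv⟩ := Y.cover (f (X.par i z))
  refine (hf i k z hz v hv hkv.symm).comp hz fun w' hw' h => ?_
  exact hf' k j w' hw' w hw (by rw [← h]; exact hzw)

/-- The changes of charts, which moreover map generic points to generic points. -/
theorem AlgSurface.exists_change (X : AlgSurface) {i j : X.Idx} {z w : ℂ × ℂ} (hz : z ∈ X.dom i)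
    (hw : w ∈ X.dom j) (h : X.par i z = X.par j w) :
    ∃ g, RegMapAt g z ∧ g z = w ∧ Filter.Tendsto g genericFilter genericFilter ∧
      ∀ᶠ v in zariskiNhds z, g v ∈ X.dom j ∧ X.par i v = X.par j (g v) := by
  obtain ⟨g, hg, hgz⟩ := X.compat i j z hz w hw h
  obtain ⟨k, hk, hkw⟩ := X.compat j i w hw z hz h.symm
  obtain ⟨h1, h2⟩ := zariski_self_mem hgz hz
  obtain ⟨h3, h4⟩ := zariski_self_mem hkw hw
  have hgw : g z = w := X.injOn_par j h1 hw (h2.symm.trans h)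
  have hkz : k w = z := X.injOn_par i h3 hz (h4.symm.trans h.symm)
  refine ⟨g, hg, hgw, hg.tendsto_generic hk hkz ?_, ?_⟩
  · have h5 := hk.tendsto
    rw [hkz] at h5
    filter_upwards [h5.eventually hgz, hkw, X.isOpen_dom j w hw] with v h6 h7 h8
    obtain ⟨h9, h10⟩ := h7 h8
    obtain ⟨h11, h12⟩ := h6 h9
    exact X.injOn_par j h11 h8 (h12.symm.trans h10.symm)
  · filter_upwards [hgz, X.isOpen_dom i z hz] with v h5 h6
    exact h5 h6

/-! ### Separated surfaces -/

/-- A surface is separated if two regular maps from an open subset of `ℂ²` to it that agree at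
generic points agree everywhere. -/
def IsSeparatedSurface (X : AlgSurface) : Prop :=
  ∀ z i j g h, RegMapAt g z → RegMapAt h z → g z ∈ X.dom i → h z ∈ X.dom j →
    (∀ᶠ w in genericFilter, X.par i (g w) = X.par j (h w)) → X.par i (g z) = X.par j (h z)

/-- The projective line is separated. -/
theorem chartP1_separated {i j : Fin 2} {f g : ℂ × ℂ → ℂ} {z : ℂ × ℂ} (hf : RegFunAt f z)
    (hg : RegFunAt g z) (h : ∀ᶠ w in genericFilter, chartP1 i (f w) = chartP1 j (g w)) :
    chartP1 i (f z) = chartP1 j (g z) := by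
  have hne : ∀ i j : Fin 2, i ≠ j → ∀ u v, chartP1 i u = chartP1 j v ↔ u * v = 1 := by
    have hc : ∀ u v : ℂ, (v ≠ 0 ∧ u = v⁻¹) ↔ u * v = 1 := fun u v =>
      ⟨fun h => by rw [h.2, inv_mul_cancel₀ h.1],
        fun h => ⟨right_ne_zero_of_mul_eq_one h, eq_inv_of_mul_eq_one_left h⟩⟩
    intro i j hij u v
    fin_cases i <;> fin_cases j
    · exact absurd rfl hij
    · simpa [chartP1, @eq_comm _ (u : OnePoint ℂ), invPt_eq_coe] using hc u v
    · simpa [chartP1, invPt_eq_coe, mul_comm u] using hc v u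
    · exact absurd rfl hij
  by_cases hij : i = j
  · subst hij
    have h1 : (fun w => f w + -1 * g w) z = 0 := by
      refine (hf.add ((regFunAt_const (-1) z).mul hg)).eq_zero (h.mono fun w hw => ?_)
      rw [chartP1_injective i hw]
      ring
    rw [show f z = g z by linear_combination h1]
  · have h1 : (fun w => f w * g w - 1) z = 0 := by
      refine ((hf.mul hg).sub_const 1).eq_zero (h.mono fun w hw => ?_)
      rw [(hne i j hij _ _).1 hw, sub_self]
    exact (hne i j hij _ _).2 (by linear_combination h1)

theorem isSeparated_P1xP1 : IsSeparatedSurface P1xP1 := by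
  intro z i j g h hg hh _ _ hgh
  exact Prod.ext (chartP1_separated hg.1 hh.1 (hgh.mono fun w hw => (Prod.mk.inj hw).1))
    (chartP1_separated hg.2 hh.2 (hgh.mono fun w hw => (Prod.mk.inj hw).2))

/-- Points off the exceptional curve of the blown-up plane have the slope of their image. -/
theorem exSlope_eq_of_blowMap_eq {z₀ : ℂ × ℂ} {b b' : Fin 2} {z w : ℂ × ℂ}
    (h : blowMap z₀ b z = blowMap z₀ b' w) (h0 : blowMap z₀ b z ≠ z₀) :
    exSlope b z = exSlope b' w := by
  obtain ⟨g, -, hg⟩ := blowMap_change h fun h1 => absurd h1 h0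
  obtain ⟨h1, h2⟩ := zariski_self_mem hg
  rw [h2, blowMap_inj (h1.symm.trans h) fun h3 => absurd (h1.trans h3) h0]

theorem exSlope_eq_chartP1 (b : Fin 2) (w : ℂ × ℂ) :
    exSlope b w = chartP1 b (if b = 0 then w.2 else w.1) := by
  fin_cases b <;> simp [exSlope, chartP1]

theorem isSeparated_blowUp {X : AlgSurface} (hX : IsSeparatedSurface X) (c : X.Idx) (z₀ : ℂ × ℂ)
    (hz₀ : z₀ ∈ X.dom c) : IsSeparatedSurface (blowUp X c z₀ hz₀) := by
  rintro z (i | b) (j | b') g h hg hh hgz hhz hgh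
  · exact overPt_eq_iff.2 ⟨hX z i j g h hg hh hgz.1 hhz.1
      (hgh.mono fun w hw => (overPt_eq_iff.1 hw).1), fun _ => rfl⟩
  · have hb := (regMapAt_blowMap z₀ b' (h z)).comp hh
    exact overPt_eq_iff.2 ⟨hX z i c g _ hg hb hgz.1 hhz
      (hgh.mono fun w hw => (overPt_eq_iff.1 hw).1), fun h1 => absurd h1 hgz.2⟩
  · have hb := (regMapAt_blowMap z₀ b (g z)).comp hg
    have h1 := hX z c j _ h hb hh hgz hhz.1 (hgh.mono fun w hw => (overPt_eq_iff.1 hw).1)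
    exact overPt_eq_iff.2 ⟨h1, fun h2 => absurd (h1.symm.trans h2) hhz.2⟩
  · have hb := (regMapAt_blowMap z₀ b (g z)).comp hg
    have hb' := (regMapAt_blowMap z₀ b' (h z)).comp hh
    refine overPt_eq_iff.2 ⟨hX z c c _ _ hb hb' hgz hhz
      (hgh.mono fun w hw => (overPt_eq_iff.1 hw).1), fun _ => ?_⟩
    rw [exSlope_eq_chartP1, exSlope_eq_chartP1]
    refine chartP1_separated (f := fun w => if b = 0 then (g w).2 else (g w).1)
      (g := fun w => if b' = 0 then (h w).2 else (h w).1) ?_ ?_ ?_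
    · split_ifs
      exacts [hg.2, hg.1]
    · split_ifs
      exacts [hh.2, hh.1]
    · filter_upwards [hgh, eventually_generic (hb.tendsto.eventually (X.isOpen_dom c _ hgz)),
        eventually_generic (hb'.tendsto.eventually (X.isOpen_dom c _ hhz))] with w h1 h2 h3
      obtain ⟨h4, h5⟩ := overPt_eq_iff.1 h1
      rw [← exSlope_eq_chartP1, ← exSlope_eq_chartP1]
      have h6 : blowMap z₀ b (g w) = blowMap z₀ b' (h w) := X.injOn_par c h2 h3 h4
      by_cases h7 : blowMap z₀ b (g w) = z₀
      · exact h5 (by rw [h7])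
      · exact exSlope_eq_of_blowMap_eq h6 h7

/-- Two regular maps to a separated surface that agree at generic points are equal. -/
theorem IsSeparatedSurface.eq_of_generic {X Y : AlgSurface} (hY : IsSeparatedSurface Y)
    {F G : X.Pt → Y.Pt} (hF : IsRegularMap F) (hG : IsRegularMap G)
    (h : ∀ q, ∃ i, ∃ z ∈ X.dom i, X.par i z = q ∧
      ∀ᶠ w in genericFilter, F (X.par i w) = G (X.par i w)) : F = G := by
  funext q
  obtain ⟨i, z, hz, rfl, h⟩ := h q
  obtain ⟨j, u, hu, hju⟩ := Y.cover (F (X.par i z))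
  obtain ⟨k, v, hv, hkv⟩ := Y.cover (G (X.par i z))
  obtain ⟨f, hf, h1⟩ := hF i j z hz u hu hju.symm
  obtain ⟨g, hg, h2⟩ := hG i k z hz v hv hkv.symm
  obtain ⟨h3, h4⟩ := zariski_self_mem h1 hz
  obtain ⟨h5, h6⟩ := zariski_self_mem h2 hz
  rw [h4, h6]
  refine hY z j k f g hf hg h3 h5 ?_
  filter_upwards [h, eventually_generic h1, eventually_generic h2,
    eventually_generic (X.isOpen_dom i z hz)] with w h7 h8 h9 h10
  rw [← (h8 h10).2, ← (h9 h10).2, h7]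

/-! ### Extending rational maps -/

/-- In a chart `i` around the point `q = par i z`, and with values in the chart `j`, the map `g`
is regular, and at generic points it is a branch of the relation `R`. -/
def IsLocalExtension {X Y : AlgSurface} (R : X.Pt → Y.Pt → Prop) (i : X.Idx) (z : ℂ × ℂ)
    (j : Y.Idx) (g : ℂ × ℂ → ℂ × ℂ) : Prop :=
  z ∈ X.dom i ∧ RegMapAt g z ∧ g z ∈ Y.dom j ∧
    ∀ᶠ w in genericFilter, R (X.par i w) (Y.par j (g w))

theorem IsLocalExtension.eventually {X Y : AlgSurface} {R : X.Pt → Y.Pt → Prop} {i : X.Idx}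
    {z : ℂ × ℂ} {j : Y.Idx} {g : ℂ × ℂ → ℂ × ℂ} (h : IsLocalExtension R i z j g) :
    ∀ᶠ w in zariskiNhds z, IsLocalExtension R i w j g := by
  filter_upwards [X.isOpen_dom i z h.1, h.2.1.eventually,
    h.2.1.tendsto (Y.isOpen_dom j _ h.2.2.1)] with w h1 h2 h3
  exact ⟨h1, h2, h3, h.2.2.2⟩

/-- The value of a local extension of a single-valued relation is unique. -/
theorem IsLocalExtension.value_unique {X Y : AlgSurface} (hY : IsSeparatedSurface Y)
    {R : X.Pt → Y.Pt → Prop} (hR : ∀ p q q', R p q → R p q' → q = q') {i i' : X.Idx}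
    {z z' : ℂ × ℂ} {j j' : Y.Idx} {g g' : ℂ × ℂ → ℂ × ℂ} (h : IsLocalExtension R i z j g)
    (h' : IsLocalExtension R i' z' j' g') (hzz : X.par i z = X.par i' z') :
    Y.par j (g z) = Y.par j' (g' z') := by
  obtain ⟨hz, hg, hgz, hRg⟩ := h
  obtain ⟨hz', hg', hgz', hRg'⟩ := h'
  obtain ⟨k, hk, hkz, hkt, hkc⟩ := X.exists_change hz hz' hzz
  subst hkz
  refine hY z j j' g (fun w => g' (k w)) hg (hg'.comp hk) hgz hgz' ?_
  filter_upwards [hRg, hkt.eventually hRg', eventually_generic hkc] with w h1 h2 h3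
  refine hR _ _ _ h1 ?_
  rwa [h3.2]

/-- A single-valued relation that extends regularly around every point defines a regular map. -/
theorem exists_regular_extension {X Y : AlgSurface} (hY : IsSeparatedSurface Y)
    {R : X.Pt → Y.Pt → Prop} (hR : ∀ p q q', R p q → R p q' → q = q')
    (h : ∀ q, ∃ i z j g, X.par i z = q ∧ IsLocalExtension R i z j g) :
    ∃ F : X.Pt → Y.Pt, IsRegularMap F ∧
      ∀ i z j g, IsLocalExtension R i z j g → F (X.par i z) = Y.par j (g z) := by
  choose i z j g hq hloc using h
  have hval : ∀ i' z' j' g', IsLocalExtension R i' z' j' g' →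
      Y.par (j (X.par i' z')) (g (X.par i' z') (z (X.par i' z'))) = Y.par j' (g' z') :=
    fun i' z' j' g' h' => (hloc _).value_unique hY hR h' (hq _)
  refine ⟨fun q => Y.par (j q) (g q (z q)), isRegularMap_of_charts fun q => ?_, hval⟩
  refine ⟨i q, z q, (hloc q).1, hq q, j q, g q, (hloc q).2.1, ?_⟩
  filter_upwards [(hloc q).eventually] with w hw _
  exact ⟨hw.2.2.1, hval _ _ _ _ hw⟩

/-! ### Points of blow-ups -/

section BlowUp

variable {X : AlgSurface} {c : X.Idx} {z₀ : ℂ × ℂ} {hz₀ : z₀ ∈ X.dom c}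

theorem blowDown_overPt (q : X.Pt) (e : OnePoint ℂ) :
    blowDown X c z₀ hz₀ (overPt (X.par c z₀) q e) = q := by
  by_cases h : q = X.par c z₀ <;> simp [blowDown, overPt, h]

theorem blowDown_par_inl (i : X.Idx) (z : ℂ × ℂ) :
    blowDown X c z₀ hz₀ ((blowUp X c z₀ hz₀).par (Sum.inl i) z) = X.par i z :=
  blowDown_overPt _ _

theorem blowDown_par_inr (b : Fin 2) (w : ℂ × ℂ) :
    blowDown X c z₀ hz₀ ((blowUp X c z₀ hz₀).par (Sum.inr b) w) = X.par c (blowMap z₀ b w) :=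
  blowDown_overPt _ _

theorem blowMap_zero_left (z₀ : ℂ × ℂ) (m : ℂ) : blowMap z₀ 0 (0, m) = z₀ := by simp [blowMap]

theorem blowMap_zero_right (z₀ : ℂ × ℂ) (n : ℂ) : blowMap z₀ 1 (n, 0) = z₀ := by simp [blowMap]

/-- To prove something for all points of a blow-up, it suffices to treat the points `(0, m)` of the
first new chart, the origin of the second one, and the points off the exceptional curve. -/
theorem forall_blowUp {P : (blowUp X c z₀ hz₀).Pt → Prop}
    (h0 : ∀ m, P ((blowUp X c z₀ hz₀).par (Sum.inr 0) (0, m)))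
    (h1 : P ((blowUp X c z₀ hz₀).par (Sum.inr 1) (0, 0)))
    (h : ∀ q, q ≠ X.par c z₀ → P (overPt (X.par c z₀) q OnePoint.infty)) (q) : P q := by
  rcases q with ⟨q, hq⟩ | e
  · simpa [overPt, hq] using h q hq
  · induction e using OnePoint.rec with
    | infty => simpa [blowUp, overPt, blowMap, exSlope, invPt_zero] using h1
    | coe m => simpa [blowUp, overPt, blowMap, exSlope] using h0 m

/-- The variant of `forall_blowUp` with the points `(n, 0)` of the second new chart and the origin
of the first one. -/
theorem forall_blowUp' {P : (blowUp X c z₀ hz₀).Pt → Prop}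
    (h0 : P ((blowUp X c z₀ hz₀).par (Sum.inr 0) (0, 0)))
    (h1 : ∀ n, P ((blowUp X c z₀ hz₀).par (Sum.inr 1) (n, 0)))
    (h : ∀ q, q ≠ X.par c z₀ → P (overPt (X.par c z₀) q OnePoint.infty)) (q) : P q := by
  refine forall_blowUp (fun m => ?_) (h1 0) h q
  by_cases hm : m = 0
  · rwa [hm]
  · simpa [blowUp, overPt, blowMap, exSlope, invPt_of_ne (inv_ne_zero hm)] using h1 m⁻¹

/-- The points of the two new charts with slopes `m` and `1/n` are distinct if `m * n ≠ 1`. -/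
theorem par_zero_ne_par_one {w w' : ℂ × ℂ} (hw' : w'.2 = 0) (h : w.2 * w'.1 ≠ 1) :
    (blowUp X c z₀ hz₀).par (Sum.inr 0) w ≠ (blowUp X c z₀ hz₀).par (Sum.inr 1) w' := by
  obtain ⟨n, t⟩ := w'
  obtain rfl : t = 0 := hw'
  intro h'
  obtain ⟨h1, h2⟩ := overPt_eq_iff.1 h'
  rw [blowMap_zero_right] at h1
  obtain ⟨h3, h4⟩ := invPt_eq_coe.1 (h2 h1).symm
  exact h (by rw [h4]; exact inv_mul_cancel₀ h3)

theorem par_one_ne_par_zero {w w' : ℂ × ℂ} (hw' : w'.1 = 0) (h : w.1 * w'.2 ≠ 1) :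
    (blowUp X c z₀ hz₀).par (Sum.inr 1) w ≠ (blowUp X c z₀ hz₀).par (Sum.inr 0) w' := by
  obtain ⟨s, m⟩ := w'
  obtain rfl : s = 0 := hw'
  intro h'
  obtain ⟨h1, h2⟩ := overPt_eq_iff.1 h'
  rw [blowMap_zero_left] at h1
  obtain ⟨h3, h4⟩ := invPt_eq_coe.1 (h2 h1)
  exact h (by rw [show m = w.1⁻¹ from h4]; exact mul_inv_cancel₀ h3)

/-- If a map from a surface to a set is injective over `x`, and does not map the centre to `x`,
then its composition with the blow-up is injective over `x`. -/
theorem injective_over_blowDown {A : Type} {f : X.Pt → A} {x : A}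
    (hf : ∀ q q', f q = x → f q' = x → q = q') (hp : f (X.par c z₀) ≠ x)
    (q q' : (blowUp X c z₀ hz₀).Pt) (hq : f (blowDown X c z₀ hz₀ q) = x)
    (hq' : f (blowDown X c z₀ hz₀ q') = x) : q = q' := by
  rcases q with ⟨q, h⟩ | e
  · rcases q' with ⟨q', h'⟩ | e'
    · obtain rfl : q = q' := hf _ _ hq hq'
      rfl
    · exact absurd hq' hp
  · exact absurd hq hp

end BlowUp

/-! ### The charts of the surface -/

theorem P1xP1_cases (q : P1xP1.Pt) : (∃ x y, q = P1xP1.par (0, 0) (x, y)) ∨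
    (∃ x, q = P1xP1.par (0, 1) (x, 0)) ∨ (∃ y, q = P1xP1.par (1, 0) (0, y)) ∨
      q = P1xP1.par (1, 1) (0, 0) := by
  rcases q with ⟨x, y⟩
  induction x using OnePoint.rec <;> induction y using OnePoint.rec <;>
    simp [P1xP1, chartP1, invPt_zero]

section Charts

variable (a : ℂ)

/-- The charts of `X8`, as charts of the final surface. -/
def up8 (i : (X8 a).Idx) : (hvSurface a).Idx :=
  Sum.inl (Sum.inl (Sum.inl (Sum.inl (Sum.inl
    (Sum.inl (Sum.inl (Sum.inl (Sum.inl (Sum.inl i)))))))))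

/-- The charts of `X14`, as charts of the final surface. -/
def up14 (i : (X14 a).Idx) : (hvSurface a).Idx := Sum.inl (Sum.inl (Sum.inl (Sum.inl i)))

/-- The charts of `ℙ¹ × ℙ¹`, as charts of the final surface. -/
def base (i : Fin 2 × Fin 2) : (hvSurface a).Idx :=
  up8 a (Sum.inl (Sum.inl (Sum.inl (Sum.inl i))))

/-- The two charts around the exceptional curve `E₅`. -/
def e5 (b : Fin 2) : (hvSurface a).Idx := up8 a (Sum.inl (Sum.inl (Sum.inl (Sum.inr b))))
/-- The two charts around the exceptional curve `E₆`. -/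
def e6 (b : Fin 2) : (hvSurface a).Idx := up8 a (Sum.inl (Sum.inl (Sum.inr b)))
/-- The two charts around the exceptional curve `E₇`. -/
def e7 (b : Fin 2) : (hvSurface a).Idx := up8 a (Sum.inl (Sum.inr b))
/-- The two charts around the exceptional curve `E₈`. -/
def e8 (b : Fin 2) : (hvSurface a).Idx := up8 a (Sum.inr b)
/-- The two charts around the exceptional curve `E₉`. -/
def e9 (b : Fin 2) : (hvSurface a).Idx :=
  up14 a (Sum.inl (Sum.inl (Sum.inl (Sum.inl (Sum.inl (Sum.inr b))))))
/-- The two charts around the exceptional curve `E₁₀`. -/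
def e10 (b : Fin 2) : (hvSurface a).Idx :=
  up14 a (Sum.inl (Sum.inl (Sum.inl (Sum.inl (Sum.inr b)))))
/-- The two charts around the exceptional curve `E₁₁`. -/
def e11 (b : Fin 2) : (hvSurface a).Idx := up14 a (Sum.inl (Sum.inl (Sum.inl (Sum.inr b))))
/-- The two charts around the exceptional curve `E₁₂`. -/
def e12 (b : Fin 2) : (hvSurface a).Idx := up14 a (Sum.inl (Sum.inl (Sum.inr b)))
/-- The two charts around the exceptional curve `E₁₃`. -/
def e13 (b : Fin 2) : (hvSurface a).Idx := up14 a (Sum.inl (Sum.inr b))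
/-- The two charts around the exceptional curve `E₁₄`. -/
def e14 (b : Fin 2) : (hvSurface a).Idx := up14 a (Sum.inr b)
/-- The two charts around the exceptional curve `E₁`. -/
def e1 (b : Fin 2) : (hvSurface a).Idx := Sum.inl (Sum.inl (Sum.inl (Sum.inr b)))
/-- The two charts around the exceptional curve `E₂`. -/
def e2 (b : Fin 2) : (hvSurface a).Idx := Sum.inl (Sum.inl (Sum.inr b))
/-- The two charts around the exceptional curve `E₃`. -/
def e3 (b : Fin 2) : (hvSurface a).Idx := Sum.inl (Sum.inr b)
/-- The two charts around the exceptional curve `E₄`. -/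
def e4 (b : Fin 2) : (hvSurface a).Idx := Sum.inr b

variable {a}

/-- The points of the surface: the finite points, the points at infinity that are not centres, and
for each exceptional curve the points of an affine line in one of its charts that are not centres
of later blow-ups, and the origin of the other chart, if it is not such a centre. -/
theorem forall_hvSurface {P : (hvSurface a).Pt → Prop}
    (h00 : ∀ x y, P ((hvSurface a).par (base a (0, 0)) (x, y)))
    (h01 : ∀ x, x ≠ 0 → P ((hvSurface a).par (base a (0, 1)) (x, 0)))
    (h10 : ∀ y, y ≠ 0 → P ((hvSurface a).par (base a (1, 0)) (0, y)))
    (h5 : ∀ m, m ≠ 0 → P ((hvSurface a).par (e5 a 0) (0, m)))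
    (h5' : P ((hvSurface a).par (e5 a 1) (0, 0)))
    (h6 : P ((hvSurface a).par (e6 a 0) (0, 0)))
    (h6' : ∀ n, n ≠ a → P ((hvSurface a).par (e6 a 1) (n, 0)))
    (h7 : ∀ m, P ((hvSurface a).par (e7 a 0) (0, m)))
    (h8 : ∀ m, P ((hvSurface a).par (e8 a 0) (0, m)))
    (h8' : P ((hvSurface a).par (e8 a 1) (0, 0)))
    (h9 : ∀ m, m ≠ 1 → P ((hvSurface a).par (e9 a 0) (0, m)))
    (h9' : P ((hvSurface a).par (e9 a 1) (0, 0)))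
    (h10c : ∀ m, m ≠ 0 → P ((hvSurface a).par (e10 a 0) (0, m)))
    (h10' : P ((hvSurface a).par (e10 a 1) (0, 0)))
    (h11 : ∀ m, P ((hvSurface a).par (e11 a 0) (0, m)))
    (h12 : ∀ m, m ≠ a → P ((hvSurface a).par (e12 a 0) (0, m)))
    (h12' : P ((hvSurface a).par (e12 a 1) (0, 0)))
    (h13 : ∀ m, m ≠ 0 → P ((hvSurface a).par (e13 a 0) (0, m)))
    (h13' : P ((hvSurface a).par (e13 a 1) (0, 0)))
    (h14 : ∀ m, P ((hvSurface a).par (e14 a 0) (0, m)))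
    (h14' : P ((hvSurface a).par (e14 a 1) (0, 0)))
    (h1 : ∀ m, P ((hvSurface a).par (e1 a 0) (0, m)))
    (h2 : ∀ m, m ≠ a → P ((hvSurface a).par (e2 a 0) (0, m)))
    (h2' : P ((hvSurface a).par (e2 a 1) (0, 0)))
    (h3 : ∀ m, m ≠ 0 → P ((hvSurface a).par (e3 a 0) (0, m)))
    (h3' : P ((hvSurface a).par (e3 a 1) (0, 0)))
    (h4 : ∀ m, P ((hvSurface a).par (e4 a 0) (0, m)))
    (h4' : P ((hvSurface a).par (e4 a 1) (0, 0))) : ∀ q, P q := by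
  -- At each blow-up, the points of the exceptional curve are treated, and the hypothesis that the
  -- remaining points are not the centre is carried along.
  refine forall_blowUp (hz₀ := X3_mem a 0) h4 h4'
    (forall_blowUp (hz₀ := X2_mem a a) (fun m hm => h3 m ?_) (fun _ => h3')
    (forall_blowUp (hz₀ := X1_mem a 0) (fun m hm _ => h2 m ?_) (fun _ _ => h2')
    (forall_blowUp (hz₀ := old14_mem a) (fun m _ _ _ => h1 m) (fun h => absurd rfl h)
    (forall_blowUp (hz₀ := X13_mem a 0) (fun m _ _ _ _ => h14 m) (fun _ _ _ _ => h14')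
    (forall_blowUp (hz₀ := X12_mem a a) (fun m hm _ _ _ _ => h13 m ?_) (fun _ _ _ _ _ => h13')
    (forall_blowUp (hz₀ := X11_mem a 0) (fun m hm _ _ _ _ _ => h12 m ?_) (fun _ _ _ _ _ _ => h12')
    (forall_blowUp (hz₀ := X10_mem a 0) (fun m _ _ _ _ _ _ _ => h11 m) (fun h => absurd rfl h)
    (forall_blowUp (hz₀ := X9_mem₀ a 1) (fun m hm _ _ _ _ _ _ _ => h10c m ?_)
      (fun _ _ _ _ _ _ _ _ => h10')
    (forall_blowUp (hz₀ := old8_mem a 1) (fun m hm _ _ _ _ _ _ _ _ => h9 m ?_)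
      (fun _ _ _ _ _ _ _ _ _ => h9')
    (forall_blowUp (X := X7 a) (c := Sum.inr 1) (z₀ := (0, 0)) (hz₀ := trivial)
      (fun m _ _ _ _ _ _ _ _ _ _ => h8 m) (fun _ _ _ _ _ _ _ _ _ _ => h8')
    (forall_blowUp (X := X6) (c := Sum.inr 1) (z₀ := (a, 0)) (hz₀ := trivial)
      (fun m _ _ _ _ _ _ _ _ _ _ _ => h7 m) (fun h => absurd rfl h)
    (forall_blowUp' (X := X5) (c := Sum.inr 0) (z₀ := (0, 0)) (hz₀ := trivial)
      (fun _ _ _ _ _ _ _ _ _ _ _ _ => h6)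
      (fun n hn _ _ _ _ _ _ _ _ _ _ _ => h6' n ?_)
    (forall_blowUp (X := P1xP1) (c := (0, 1)) (z₀ := (0, 0)) (hz₀ := trivial)
      (fun m hm _ _ _ _ _ _ _ _ _ _ _ _ => h5 m ?_)
      (fun _ _ _ _ _ _ _ _ _ _ _ _ _ => h5') ?_)))))))))))))
  · rintro rfl; exact hm rfl
  · rintro rfl; exact hm rfl
  · rintro rfl; exact hm rfl
  · rintro rfl; exact hm rfl
  · rintro rfl; exact hm rfl
  · rintro rfl; exact hm rfl
  · rintro rfl; exact hn rfl
  · rintro rfl; exact hm rfl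
  · intro q
    rcases P1xP1_cases q with ⟨x, y, rfl⟩ | ⟨x, rfl⟩ | ⟨y, rfl⟩ | rfl
    · exact fun _ _ _ _ _ _ _ _ _ _ _ _ _ _ => h00 x y
    · exact fun h _ _ _ _ _ _ _ _ _ _ _ _ _ => h01 x (by rintro rfl; exact h rfl)
    · exact fun _ _ _ _ _ _ _ _ _ _ h _ _ _ => h10 y (by rintro rfl; exact h rfl)
    · exact fun _ _ _ _ h => absurd rfl h

/-! ### The projection in the charts -/

/-- The projection of `X5` to `ℙ¹ × ℙ¹`. -/
noncomputable def proj5 : X5.Pt → P1xP1.Pt :=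
  blowDown P1xP1 (0, 1) (0, 0) trivial

/-- The projection of `X6` to `ℙ¹ × ℙ¹`. -/
noncomputable def proj6 : X6.Pt → P1xP1.Pt :=
  proj5 ∘ blowDown X5 (Sum.inr 0) (0, 0) trivial

/-- The projection of `X7` to `ℙ¹ × ℙ¹`. -/
noncomputable def proj7 (a : ℂ) : (X7 a).Pt → P1xP1.Pt :=
  proj6 ∘ blowDown X6 (Sum.inr 1) (a, 0) trivial

/-- The projection of `X8` to `ℙ¹ × ℙ¹`. -/
noncomputable def proj8 (a : ℂ) : (X8 a).Pt → P1xP1.Pt :=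
  proj7 a ∘ blowDown (X7 a) (Sum.inr 1) (0, 0) trivial

/-- The projection of `X9` to `ℙ¹ × ℙ¹`. -/
noncomputable def proj9 (a : ℂ) : (X9 a).Pt → P1xP1.Pt :=
  proj8 a ∘ blowDown (X8 a) (old8 a 1) (0, 0) (old8_mem a 1)

/-- The projection of `X10` to `ℙ¹ × ℙ¹`. -/
noncomputable def proj10 (a : ℂ) : (X10 a).Pt → P1xP1.Pt :=
  proj9 a ∘ blowDown (X9 a) (Sum.inr 0) (0, 1) (X9_mem₀ a 1)

/-- The projection of `X11` to `ℙ¹ × ℙ¹`. -/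
noncomputable def proj11 (a : ℂ) : (X11 a).Pt → P1xP1.Pt :=
  proj10 a ∘ blowDown (X10 a) (Sum.inr 0) (0, 0) (X10_mem a 0)

/-- The projection of `X12` to `ℙ¹ × ℙ¹`. -/
noncomputable def proj12 (a : ℂ) : (X12 a).Pt → P1xP1.Pt :=
  proj11 a ∘ blowDown (X11 a) (Sum.inr 1) (0, 0) (X11_mem a 0)

/-- The projection of `X13` to `ℙ¹ × ℙ¹`. -/
noncomputable def proj13 (a : ℂ) : (X13 a).Pt → P1xP1.Pt :=
  proj12 a ∘ blowDown (X12 a) (Sum.inr 0) (0, a) (X12_mem a a)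

/-- The projection of `X14` to `ℙ¹ × ℙ¹`. -/
noncomputable def proj14 (a : ℂ) : (X14 a).Pt → P1xP1.Pt :=
  proj13 a ∘ blowDown (X13 a) (Sum.inr 0) (0, 0) (X13_mem a 0)

/-- The projection of `X1` to `ℙ¹ × ℙ¹`. -/
noncomputable def proj1 (a : ℂ) : (X1 a).Pt → P1xP1.Pt :=
  proj14 a ∘ blowDown (X14 a) (old14 a) (0, 0) (old14_mem a)

/-- The projection of `X2` to `ℙ¹ × ℙ¹`. -/
noncomputable def proj2 (a : ℂ) : (X2 a).Pt → P1xP1.Pt :=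
  proj1 a ∘ blowDown (X1 a) (Sum.inr 1) (0, 0) (X1_mem a 0)

/-- The projection of `X3` to `ℙ¹ × ℙ¹`. -/
noncomputable def proj3 (a : ℂ) : (X3 a).Pt → P1xP1.Pt :=
  proj2 a ∘ blowDown (X2 a) (Sum.inr 0) (0, a) (X2_mem a a)

theorem comp_blowDown_inl {X : AlgSurface} {c : X.Idx} {z₀ : ℂ × ℂ} {hz₀ : z₀ ∈ X.dom c} {A : Type}
    (f : X.Pt → A) (i : X.Idx) (z : ℂ × ℂ) :
    (f ∘ blowDown X c z₀ hz₀) ((blowUp X c z₀ hz₀).par (Sum.inl i) z) = f (X.par i z) :=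
  congrArg f (blowDown_par_inl i z)

theorem comp_blowDown_inr {X : AlgSurface} {c : X.Idx} {z₀ : ℂ × ℂ} {hz₀ : z₀ ∈ X.dom c} {A : Type}
    (f : X.Pt → A) (b : Fin 2) (w : ℂ × ℂ) :
    (f ∘ blowDown X c z₀ hz₀) ((blowUp X c z₀ hz₀).par (Sum.inr b) w) =
      f (X.par c (blowMap z₀ b w)) :=
  congrArg f (blowDown_par_inr b w)

theorem hvProj_up14 (i : (X14 a).Idx) (z : ℂ × ℂ) :
    hvProj a ((hvSurface a).par (up14 a i) z) = proj14 a ((X14 a).par i z) :=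
  (comp_blowDown_inl (proj3 a) _ z).trans <| (comp_blowDown_inl (proj2 a) _ z).trans <|
    (comp_blowDown_inl (proj1 a) _ z).trans <| comp_blowDown_inl (proj14 a) i z

theorem hvProj_up8 (i : (X8 a).Idx) (z : ℂ × ℂ) :
    hvProj a ((hvSurface a).par (up8 a i) z) = proj8 a ((X8 a).par i z) :=
  (hvProj_up14 _ z).trans <| (comp_blowDown_inl (proj13 a) _ z).trans <|
    (comp_blowDown_inl (proj12 a) _ z).trans <| (comp_blowDown_inl (proj11 a) _ z).trans <|
    (comp_blowDown_inl (proj10 a) _ z).trans <| (comp_blowDown_inl (proj9 a) _ z).trans <|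
    comp_blowDown_inl (proj8 a) i z

theorem proj8_base (i : Fin 2 × Fin 2) (z : ℂ × ℂ) :
    proj8 a ((X8 a).par (Sum.inl (Sum.inl (Sum.inl (Sum.inl i)))) z) = P1xP1.par i z :=
  (comp_blowDown_inl (proj7 a) _ z).trans <| (comp_blowDown_inl proj6 _ z).trans <|
    (comp_blowDown_inl proj5 _ z).trans <| blowDown_par_inl (X := P1xP1) i z

theorem proj14_base (i : Fin 2 × Fin 2) (z : ℂ × ℂ) :
    proj14 a ((X14 a).par (Sum.inl (Sum.inl (Sum.inl (Sum.inl (Sum.inl (Sum.inl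
      (Sum.inl (Sum.inl (Sum.inl (Sum.inl i)))))))))) z) = P1xP1.par i z :=
  (hvProj_up14 _ z).symm.trans <| (hvProj_up8 _ z).trans <| proj8_base i z

theorem hvProj_base (i : Fin 2 × Fin 2) (z : ℂ × ℂ) :
    hvProj a ((hvSurface a).par (base a i) z) = P1xP1.par i z :=
  (hvProj_up8 _ z).trans (proj8_base i z)

theorem hvProj_e5 (b : Fin 2) (w : ℂ × ℂ) :
    hvProj a ((hvSurface a).par (e5 a b) w) = P1xP1.par (0, 1) (blowMap (0, 0) b w) :=
  (hvProj_up8 _ w).trans <| (comp_blowDown_inl (proj7 a) _ w).trans <|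
    (comp_blowDown_inl proj6 _ w).trans <| (comp_blowDown_inl proj5 _ w).trans <|
    blowDown_par_inr (X := P1xP1) b w

theorem hvProj_e6 (b : Fin 2) (w : ℂ × ℂ) :
    hvProj a ((hvSurface a).par (e6 a b) w) =
      hvProj a ((hvSurface a).par (e5 a 0) (blowMap (0, 0) b w)) :=
  ((hvProj_up8 _ w).trans <| (comp_blowDown_inl (proj7 a) _ w).trans <|
    (comp_blowDown_inl proj6 _ w).trans <| comp_blowDown_inr proj5 b w).trans <|
  ((hvProj_up8 _ _).trans <| (comp_blowDown_inl (proj7 a) _ _).trans <|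
    (comp_blowDown_inl proj6 _ _).trans <| comp_blowDown_inl proj5 _ _).symm

theorem hvProj_e7 (b : Fin 2) (w : ℂ × ℂ) :
    hvProj a ((hvSurface a).par (e7 a b) w) =
      hvProj a ((hvSurface a).par (e6 a 1) (blowMap (a, 0) b w)) :=
  ((hvProj_up8 _ w).trans <| (comp_blowDown_inl (proj7 a) _ w).trans <|
    comp_blowDown_inr proj6 b w).trans <|
  ((hvProj_up8 _ _).trans <| (comp_blowDown_inl (proj7 a) _ _).trans <|
    comp_blowDown_inl proj6 _ _).symm

theorem hvProj_e8 (b : Fin 2) (w : ℂ × ℂ) :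
    hvProj a ((hvSurface a).par (e8 a b) w) =
      hvProj a ((hvSurface a).par (e7 a 1) (blowMap (0, 0) b w)) :=
  ((hvProj_up8 _ w).trans <| comp_blowDown_inr (proj7 a) b w).trans <|
  ((hvProj_up8 _ _).trans <| comp_blowDown_inl (proj7 a) _ _).symm

theorem hvProj_e9 (b : Fin 2) (w : ℂ × ℂ) :
    hvProj a ((hvSurface a).par (e9 a b) w) = P1xP1.par (1, 1) (blowMap (0, 0) b w) :=
  (hvProj_up14 _ w).trans <| (comp_blowDown_inl (proj13 a) _ w).trans <|
    (comp_blowDown_inl (proj12 a) _ w).trans <| (comp_blowDown_inl (proj11 a) _ w).trans <|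
    (comp_blowDown_inl (proj10 a) _ w).trans <| (comp_blowDown_inl (proj9 a) _ w).trans <|
    (comp_blowDown_inr (proj8 a) b w).trans <| proj8_base _ _

theorem hvProj_e10 (b : Fin 2) (w : ℂ × ℂ) :
    hvProj a ((hvSurface a).par (e10 a b) w) =
      hvProj a ((hvSurface a).par (e9 a 0) (blowMap (0, 1) b w)) :=
  ((hvProj_up14 _ w).trans <| (comp_blowDown_inl (proj13 a) _ w).trans <|
    (comp_blowDown_inl (proj12 a) _ w).trans <| (comp_blowDown_inl (proj11 a) _ w).trans <|
    (comp_blowDown_inl (proj10 a) _ w).trans <| comp_blowDown_inr (proj9 a) b w).trans <|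
  ((hvProj_up14 _ _).trans <| (comp_blowDown_inl (proj13 a) _ _).trans <|
    (comp_blowDown_inl (proj12 a) _ _).trans <| (comp_blowDown_inl (proj11 a) _ _).trans <|
    (comp_blowDown_inl (proj10 a) _ _).trans <| comp_blowDown_inl (proj9 a) _ _).symm

theorem hvProj_e11 (b : Fin 2) (w : ℂ × ℂ) :
    hvProj a ((hvSurface a).par (e11 a b) w) =
      hvProj a ((hvSurface a).par (e10 a 0) (blowMap (0, 0) b w)) :=
  ((hvProj_up14 _ w).trans <| (comp_blowDown_inl (proj13 a) _ w).trans <|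
    (comp_blowDown_inl (proj12 a) _ w).trans <| (comp_blowDown_inl (proj11 a) _ w).trans <|
    comp_blowDown_inr (proj10 a) b w).trans <|
  ((hvProj_up14 _ _).trans <| (comp_blowDown_inl (proj13 a) _ _).trans <|
    (comp_blowDown_inl (proj12 a) _ _).trans <| (comp_blowDown_inl (proj11 a) _ _).trans <|
    comp_blowDown_inl (proj10 a) _ _).symm

theorem hvProj_e12 (b : Fin 2) (w : ℂ × ℂ) :
    hvProj a ((hvSurface a).par (e12 a b) w) =
      hvProj a ((hvSurface a).par (e11 a 1) (blowMap (0, 0) b w)) :=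
  ((hvProj_up14 _ w).trans <| (comp_blowDown_inl (proj13 a) _ w).trans <|
    (comp_blowDown_inl (proj12 a) _ w).trans <| comp_blowDown_inr (proj11 a) b w).trans <|
  ((hvProj_up14 _ _).trans <| (comp_blowDown_inl (proj13 a) _ _).trans <|
    (comp_blowDown_inl (proj12 a) _ _).trans <| comp_blowDown_inl (proj11 a) _ _).symm

theorem hvProj_e13 (b : Fin 2) (w : ℂ × ℂ) :
    hvProj a ((hvSurface a).par (e13 a b) w) =
      hvProj a ((hvSurface a).par (e12 a 0) (blowMap (0, a) b w)) :=
  ((hvProj_up14 _ w).trans <| (comp_blowDown_inl (proj13 a) _ w).trans <|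
    comp_blowDown_inr (proj12 a) b w).trans <|
  ((hvProj_up14 _ _).trans <| (comp_blowDown_inl (proj13 a) _ _).trans <|
    comp_blowDown_inl (proj12 a) _ _).symm

theorem hvProj_e14 (b : Fin 2) (w : ℂ × ℂ) :
    hvProj a ((hvSurface a).par (e14 a b) w) =
      hvProj a ((hvSurface a).par (e13 a 0) (blowMap (0, 0) b w)) :=
  ((hvProj_up14 _ w).trans <| comp_blowDown_inr (proj13 a) b w).trans <|
  ((hvProj_up14 _ _).trans <| comp_blowDown_inl (proj13 a) _ _).symm

theorem hvProj_e1 (b : Fin 2) (w : ℂ × ℂ) :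
    hvProj a ((hvSurface a).par (e1 a b) w) = P1xP1.par (1, 0) (blowMap (0, 0) b w) :=
  (comp_blowDown_inl (proj3 a) _ w).trans <| (comp_blowDown_inl (proj2 a) _ w).trans <|
    (comp_blowDown_inl (proj1 a) _ w).trans <| (comp_blowDown_inr (proj14 a) b w).trans <|
    proj14_base _ _

theorem hvProj_e2 (b : Fin 2) (w : ℂ × ℂ) :
    hvProj a ((hvSurface a).par (e2 a b) w) =
      hvProj a ((hvSurface a).par (e1 a 1) (blowMap (0, 0) b w)) :=
  ((comp_blowDown_inl (proj3 a) _ w).trans <| (comp_blowDown_inl (proj2 a) _ w).trans <|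
    comp_blowDown_inr (proj1 a) b w).trans <|
  ((comp_blowDown_inl (proj3 a) _ _).trans <| (comp_blowDown_inl (proj2 a) _ _).trans <|
    comp_blowDown_inl (proj1 a) _ _).symm

theorem hvProj_e3 (b : Fin 2) (w : ℂ × ℂ) :
    hvProj a ((hvSurface a).par (e3 a b) w) =
      hvProj a ((hvSurface a).par (e2 a 0) (blowMap (0, a) b w)) :=
  ((comp_blowDown_inl (proj3 a) _ w).trans <| comp_blowDown_inr (proj2 a) b w).trans <|
  ((comp_blowDown_inl (proj3 a) _ _).trans <| comp_blowDown_inl (proj2 a) _ _).symm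

theorem hvProj_e4 (b : Fin 2) (w : ℂ × ℂ) :
    hvProj a ((hvSurface a).par (e4 a b) w) =
      hvProj a ((hvSurface a).par (e3 a 0) (blowMap (0, 0) b w)) :=
  (comp_blowDown_inr (proj3 a) b w).trans (comp_blowDown_inl (proj3 a) _ _).symm

end Charts

/-! ### The domains of the charts -/

section Domains

/-- A point of an old chart, off the centre, is not a point of the exceptional curve. -/
theorem par_inl_ne_par_inr {X : AlgSurface} {c : X.Idx} {z₀ : ℂ × ℂ} {hz₀ : z₀ ∈ X.dom c}
    {i : X.Idx} {z : ℂ × ℂ} (h : X.par i z ≠ X.par c z₀) {b : Fin 2} {w : ℂ × ℂ}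
    (hw : blowMap z₀ b w = z₀) :
    (blowUp X c z₀ hz₀).par (Sum.inl i) z ≠ (blowUp X c z₀ hz₀).par (Sum.inr b) w :=
  blowUp_ne X c z₀ hz₀ i z b w (by rwa [hw])

variable {a : ℂ}

theorem mem_up14 {i : (X14 a).Idx} {z : ℂ × ℂ} (hz : z ∈ (X14 a).dom i)
    (h : hvProj a ((hvSurface a).par (up14 a i) z) ≠ P1xP1.par (1, 0) (0, 0)) :
    z ∈ (hvSurface a).dom (up14 a i) := by
  have h1 : (X14 a).par i z ≠ (X14 a).par (old14 a) (0, 0) := fun h1 =>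
    h ((hvProj_up14 i z).trans ((congrArg (proj14 a) h1).trans (proj14_base (1, 0) (0, 0))))
  have h2 : (X1 a).par (Sum.inl i) z ≠ (X1 a).par (Sum.inr 1) (0, 0) :=
    par_inl_ne_par_inr h1 (blowMap_zero_right _ _)
  have h3 : (X2 a).par (Sum.inl (Sum.inl i)) z ≠ (X2 a).par (Sum.inr 0) (0, a) :=
    par_inl_ne_par_inr h2 (blowMap_zero_left _ _)
  have h4 : (X3 a).par (Sum.inl (Sum.inl (Sum.inl i))) z ≠ (X3 a).par (Sum.inr 0) (0, 0) :=
    par_inl_ne_par_inr h3 (blowMap_zero_left _ _)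
  exact ⟨⟨⟨⟨hz, h1⟩, h2⟩, h3⟩, h4⟩

theorem mem_up8 {i : (X8 a).Idx} {z : ℂ × ℂ} (hz : z ∈ (X8 a).dom i)
    (h : hvProj a ((hvSurface a).par (up8 a i) z) ≠ P1xP1.par (1, 0) (0, 0))
    (h' : hvProj a ((hvSurface a).par (up8 a i) z) ≠ P1xP1.par (1, 1) (0, 0)) :
    z ∈ (hvSurface a).dom (up8 a i) := by
  have h9 : (X8 a).par i z ≠ (X8 a).par (old8 a 1) (0, 0) := fun h9 =>
    h' ((hvProj_up8 i z).trans ((congrArg (proj8 a) h9).trans (proj8_base (1, 1) (0, 0))))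
  have h10 : (X9 a).par (Sum.inl i) z ≠ (X9 a).par (Sum.inr 0) (0, 1) :=
    par_inl_ne_par_inr h9 (blowMap_zero_left _ _)
  have h11 : (X10 a).par (Sum.inl (Sum.inl i)) z ≠ (X10 a).par (Sum.inr 0) (0, 0) :=
    par_inl_ne_par_inr h10 (blowMap_zero_left _ _)
  have h12 : (X11 a).par (Sum.inl (Sum.inl (Sum.inl i))) z ≠ (X11 a).par (Sum.inr 1) (0, 0) :=
    par_inl_ne_par_inr h11 (blowMap_zero_right _ _)
  have h13 : (X12 a).par (Sum.inl (Sum.inl (Sum.inl (Sum.inl i)))) z ≠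
      (X12 a).par (Sum.inr 0) (0, a) :=
    par_inl_ne_par_inr h12 (blowMap_zero_left _ _)
  have h14 : (X13 a).par (Sum.inl (Sum.inl (Sum.inl (Sum.inl (Sum.inl i))))) z ≠
      (X13 a).par (Sum.inr 0) (0, 0) :=
    par_inl_ne_par_inr h13 (blowMap_zero_left _ _)
  exact mem_up14 (i := Sum.inl (Sum.inl (Sum.inl (Sum.inl (Sum.inl (Sum.inl i))))))
    ⟨⟨⟨⟨⟨⟨hz, h9⟩, h10⟩, h11⟩, h12⟩, h13⟩, h14⟩ h

theorem P1xP1_par_zero_ne (j k : Fin 2) (w : ℂ × ℂ) :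
    P1xP1.par (0, j) w ≠ P1xP1.par (1, k) (0, 0) := (P1xP1_ne₁ k j w).symm

theorem mem_up8_of_fst {i : (X8 a).Idx} {z : ℂ × ℂ} (hz : z ∈ (X8 a).dom i) {j : Fin 2}
    {w : ℂ × ℂ} (h : hvProj a ((hvSurface a).par (up8 a i) z) = P1xP1.par (0, j) w) :
    z ∈ (hvSurface a).dom (up8 a i) :=
  mem_up8 hz (by rw [h]; exact P1xP1_par_zero_ne _ _ _) (by rw [h]; exact P1xP1_par_zero_ne _ _ _)

theorem mem_X8_base {i : Fin 2 × Fin 2} {z : ℂ × ℂ}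
    (h : P1xP1.par i z ≠ P1xP1.par (0, 1) (0, 0)) :
    z ∈ (X8 a).dom (Sum.inl (Sum.inl (Sum.inl (Sum.inl i)))) := by
  have h6 : X5.par (Sum.inl i) z ≠ X5.par (Sum.inr 0) (0, 0) :=
    par_inl_ne_par_inr h (blowMap_zero_left _ _)
  have h7 : X6.par (Sum.inl (Sum.inl i)) z ≠ X6.par (Sum.inr 1) (a, 0) :=
    par_inl_ne_par_inr h6 (blowMap_zero_right _ _)
  have h8 : (X7 a).par (Sum.inl (Sum.inl (Sum.inl i))) z ≠ (X7 a).par (Sum.inr 1) (0, 0) :=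
    par_inl_ne_par_inr h7 (blowMap_zero_right _ _)
  exact ⟨⟨⟨⟨trivial, h⟩, h6⟩, h7⟩, h8⟩

theorem mem_base {i : Fin 2 × Fin 2} {z : ℂ × ℂ}
    (h : P1xP1.par i z ≠ P1xP1.par (0, 1) (0, 0)) (h' : P1xP1.par i z ≠ P1xP1.par (1, 0) (0, 0))
    (h'' : P1xP1.par i z ≠ P1xP1.par (1, 1) (0, 0)) : z ∈ (hvSurface a).dom (base a i) :=
  mem_up8 (mem_X8_base h) (by rwa [← base, hvProj_base]) (by rwa [← base, hvProj_base])

theorem mem_base₀₀ (z : ℂ × ℂ) : z ∈ (hvSurface a).dom (base a (0, 0)) := by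
  refine mem_base (fun h => ?_) (P1xP1_par_zero_ne _ _ _) (P1xP1_par_zero_ne _ _ _)
  have := (Prod.mk.inj h).2
  simp [chartP1, invPt_zero] at this

theorem mem_base₀₁ {z : ℂ × ℂ} (h : z ≠ (0, 0)) : z ∈ (hvSurface a).dom (base a (0, 1)) :=
  mem_base ((P1xP1.injOn_par (0, 1)).ne trivial trivial h) (P1xP1_par_zero_ne _ _ _)
    (P1xP1_par_zero_ne _ _ _)

theorem P1xP1_par_ne {i : Fin 2} (z w : ℂ × ℂ) (hw : w.2 = 0) :
    P1xP1.par (1, 0) z ≠ P1xP1.par (i, 1) w := by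
  intro h
  have := (Prod.mk.inj h).2
  simp [chartP1, invPt_zero, hw] at this

theorem mem_base₁₀ {z : ℂ × ℂ} (h : z ≠ (0, 0)) : z ∈ (hvSurface a).dom (base a (1, 0)) :=
  mem_base (P1xP1_par_ne _ _ rfl) ((P1xP1.injOn_par (1, 0)).ne trivial trivial h)
    (P1xP1_par_ne _ _ rfl)

theorem mem_old8 (w : ℂ × ℂ) : w ∈ (X8 a).dom (old8 a 1) := by
  refine mem_X8_base fun h => ?_
  have := (Prod.mk.inj h).1
  simp [chartP1, invPt_eq_coe] at this
  exact this.1 this.2.symm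

theorem mem_old14 (w : ℂ × ℂ) : w ∈ (X14 a).dom (old14 a) := by
  have h9 : (X8 a).par (old8 a 0) w ≠ (X8 a).par (old8 a 1) (0, 0) := fun h =>
    P1xP1_par_ne w (0, 0) rfl
      ((proj8_base (1, 0) w).symm.trans ((congrArg (proj8 a) h).trans (proj8_base (1, 1) (0, 0))))
  have h10 : (X9 a).par (Sum.inl (old8 a 0)) w ≠ (X9 a).par (Sum.inr 0) (0, 1) :=
    par_inl_ne_par_inr h9 (blowMap_zero_left _ _)
  have h11 : (X10 a).par (Sum.inl (Sum.inl (old8 a 0))) w ≠ (X10 a).par (Sum.inr 0) (0, 0) :=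
    par_inl_ne_par_inr h10 (blowMap_zero_left _ _)
  have h12 : (X11 a).par (Sum.inl (Sum.inl (Sum.inl (old8 a 0)))) w ≠
      (X11 a).par (Sum.inr 1) (0, 0) :=
    par_inl_ne_par_inr h11 (blowMap_zero_right _ _)
  have h13 : (X12 a).par (Sum.inl (Sum.inl (Sum.inl (Sum.inl (old8 a 0))))) w ≠
      (X12 a).par (Sum.inr 0) (0, a) :=
    par_inl_ne_par_inr h12 (blowMap_zero_left _ _)
  have h14 : (X13 a).par (Sum.inl (Sum.inl (Sum.inl (Sum.inl (Sum.inl (old8 a 0)))))) w ≠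
      (X13 a).par (Sum.inr 0) (0, 0) :=
    par_inl_ne_par_inr h13 (blowMap_zero_left _ _)
  exact ⟨⟨⟨⟨⟨⟨mem_X8_base (P1xP1_par_ne _ _ rfl), h9⟩, h10⟩, h11⟩, h12⟩, h13⟩, h14⟩

theorem mem_X9 (b : Fin 2) (w : ℂ × ℂ) : w ∈ (X9 a).dom (Sum.inr b) := by
  change blowMap (0, 0) b w ∈ (X8 a).dom (old8 a 1)
  exact mem_old8 _

theorem mem_X10 (b : Fin 2) (w : ℂ × ℂ) : w ∈ (X10 a).dom (Sum.inr b) := by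
  change blowMap (0, 1) b w ∈ (X9 a).dom (Sum.inr 0)
  exact mem_X9 0 _

theorem mem_X11 (b : Fin 2) (w : ℂ × ℂ) : w ∈ (X11 a).dom (Sum.inr b) := by
  change blowMap (0, 0) b w ∈ (X10 a).dom (Sum.inr 0)
  exact mem_X10 0 _

theorem mem_X12 (b : Fin 2) (w : ℂ × ℂ) : w ∈ (X12 a).dom (Sum.inr b) := by
  change blowMap (0, 0) b w ∈ (X11 a).dom (Sum.inr 1)
  exact mem_X11 1 _

theorem mem_X13 (b : Fin 2) (w : ℂ × ℂ) : w ∈ (X13 a).dom (Sum.inr b) := by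
  change blowMap (0, a) b w ∈ (X12 a).dom (Sum.inr 0)
  exact mem_X12 0 _

theorem mem_X14 (b : Fin 2) (w : ℂ × ℂ) : w ∈ (X14 a).dom (Sum.inr b) := by
  change blowMap (0, 0) b w ∈ (X13 a).dom (Sum.inr 0)
  exact mem_X13 0 _

theorem mem_X1 (b : Fin 2) (w : ℂ × ℂ) : w ∈ (X1 a).dom (Sum.inr b) := by
  change blowMap (0, 0) b w ∈ (X14 a).dom (old14 a)
  exact mem_old14 _

theorem mem_X2 (b : Fin 2) (w : ℂ × ℂ) : w ∈ (X2 a).dom (Sum.inr b) := by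
  change blowMap (0, 0) b w ∈ (X1 a).dom (Sum.inr 1)
  exact mem_X1 1 _

theorem mem_X3 (b : Fin 2) (w : ℂ × ℂ) : w ∈ (X3 a).dom (Sum.inr b) := by
  change blowMap (0, a) b w ∈ (X2 a).dom (Sum.inr 0)
  exact mem_X2 0 _

theorem mem_X4 (b : Fin 2) (w : ℂ × ℂ) : w ∈ (X4 a).dom (Sum.inr b) := by
  change blowMap (0, 0) b w ∈ (X3 a).dom (Sum.inr 0)
  exact mem_X3 0 _

theorem mem_e5 {b : Fin 2} {w : ℂ × ℂ}
    (h : X5.par (Sum.inr b) w ≠ X5.par (Sum.inr 0) (0, 0)) : w ∈ (hvSurface a).dom (e5 a b) := by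
  have h7 : X6.par (Sum.inl (Sum.inr b)) w ≠
      X6.par (Sum.inr 1) (a, 0) :=
    par_inl_ne_par_inr h (blowMap_zero_right _ _)
  have h8 : (X7 a).par (Sum.inl (Sum.inl (Sum.inr b))) w ≠
      (X7 a).par (Sum.inr 1) (0, 0) :=
    par_inl_ne_par_inr h7 (blowMap_zero_right _ _)
  exact mem_up8_of_fst ⟨⟨⟨trivial, h⟩, h7⟩, h8⟩
    (hvProj_e5 b w)

theorem mem_e6 {b : Fin 2} {w : ℂ × ℂ}
    (h : X6.par (Sum.inr b) w ≠ X6.par (Sum.inr 1) (a, 0)) : w ∈ (hvSurface a).dom (e6 a b) := by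
  have h8 : (X7 a).par (Sum.inl (Sum.inr b)) w ≠
      (X7 a).par (Sum.inr 1) (0, 0) :=
    par_inl_ne_par_inr h (blowMap_zero_right _ _)
  exact mem_up8_of_fst ⟨⟨trivial, h⟩, h8⟩
    ((hvProj_e6 b w).trans (hvProj_e5 0 _))

theorem mem_e7 {b : Fin 2} {w : ℂ × ℂ}
    (h : (X7 a).par (Sum.inr b) w ≠ (X7 a).par (Sum.inr 1) (0, 0)) :
    w ∈ (hvSurface a).dom (e7 a b) := by
  exact mem_up8_of_fst ⟨trivial, h⟩
    ((hvProj_e7 b w).trans ((hvProj_e6 1 _).trans (hvProj_e5 0 _)))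

theorem mem_e8 (b : Fin 2) (w : ℂ × ℂ) : w ∈ (hvSurface a).dom (e8 a b) := by
  exact mem_up8_of_fst (i := Sum.inr b) trivial
    ((hvProj_e8 b w).trans ((hvProj_e7 1 _).trans ((hvProj_e6 1 _).trans (hvProj_e5 0 _))))

theorem mem_e5_zero {w : ℂ × ℂ} (h : w ≠ (0, 0)) : w ∈ (hvSurface a).dom (e5 a 0) :=
  mem_e5 (X5.injOn_par _ |>.ne trivial trivial h)

theorem mem_e5_one {w : ℂ × ℂ} (h : w.1 * 0 ≠ 1) : w ∈ (hvSurface a).dom (e5 a 1) :=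
  mem_e5 (par_one_ne_par_zero rfl h)

theorem mem_e6_one {w : ℂ × ℂ} (h : w ≠ (a, 0)) : w ∈ (hvSurface a).dom (e6 a 1) :=
  mem_e6 (X6.injOn_par _ |>.ne trivial trivial h)

theorem mem_e6_zero {w : ℂ × ℂ} (h : w.2 * a ≠ 1) : w ∈ (hvSurface a).dom (e6 a 0) :=
  mem_e6 (par_zero_ne_par_one rfl h)

theorem mem_e7_one {w : ℂ × ℂ} (h : w ≠ (0, 0)) : w ∈ (hvSurface a).dom (e7 a 1) :=
  mem_e7 ((X7 a).injOn_par _ |>.ne trivial trivial h)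

theorem mem_e7_zero {w : ℂ × ℂ} (h : w.2 * 0 ≠ 1) : w ∈ (hvSurface a).dom (e7 a 0) :=
  mem_e7 (par_zero_ne_par_one rfl h)

theorem mem_e9 {b : Fin 2} {w : ℂ × ℂ}
    (h : (X9 a).par (Sum.inr b) w ≠ (X9 a).par (Sum.inr 0) (0, 1)) :
    w ∈ (hvSurface a).dom (e9 a b) := by
  have h11 : (X10 a).par (Sum.inl (Sum.inr b)) w ≠
      (X10 a).par (Sum.inr 0) (0, 0) :=
    par_inl_ne_par_inr h (blowMap_zero_left _ _)
  have h12 : (X11 a).par (Sum.inl (Sum.inl (Sum.inr b))) w ≠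
      (X11 a).par (Sum.inr 1) (0, 0) :=
    par_inl_ne_par_inr h11 (blowMap_zero_right _ _)
  have h13 : (X12 a).par (Sum.inl (Sum.inl (Sum.inl (Sum.inr b)))) w ≠
      (X12 a).par (Sum.inr 0) (0, a) :=
    par_inl_ne_par_inr h12 (blowMap_zero_left _ _)
  have h14 : (X13 a).par (Sum.inl (Sum.inl (Sum.inl (Sum.inl (Sum.inr b))))) w ≠
      (X13 a).par (Sum.inr 0) (0, 0) :=
    par_inl_ne_par_inr h13 (blowMap_zero_left _ _)
  refine mem_up14 ⟨⟨⟨⟨⟨mem_X9 b w, h⟩, h11⟩, h12⟩, h13⟩, h14⟩ ?_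
  rw [← e9, hvProj_e9]
  exact (P1xP1_ne₂ _).symm

theorem mem_e10 {b : Fin 2} {w : ℂ × ℂ}
    (h : (X10 a).par (Sum.inr b) w ≠ (X10 a).par (Sum.inr 0) (0, 0)) :
    w ∈ (hvSurface a).dom (e10 a b) := by
  have h12 : (X11 a).par (Sum.inl (Sum.inr b)) w ≠
      (X11 a).par (Sum.inr 1) (0, 0) :=
    par_inl_ne_par_inr h (blowMap_zero_right _ _)
  have h13 : (X12 a).par (Sum.inl (Sum.inl (Sum.inr b))) w ≠
      (X12 a).par (Sum.inr 0) (0, a) :=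
    par_inl_ne_par_inr h12 (blowMap_zero_left _ _)
  have h14 : (X13 a).par (Sum.inl (Sum.inl (Sum.inl (Sum.inr b)))) w ≠
      (X13 a).par (Sum.inr 0) (0, 0) :=
    par_inl_ne_par_inr h13 (blowMap_zero_left _ _)
  refine mem_up14 ⟨⟨⟨⟨mem_X10 b w, h⟩, h12⟩, h13⟩, h14⟩ ?_
  rw [← e10, hvProj_e10, hvProj_e9]
  exact (P1xP1_ne₂ _).symm

theorem mem_e11 {b : Fin 2} {w : ℂ × ℂ}
    (h : (X11 a).par (Sum.inr b) w ≠ (X11 a).par (Sum.inr 1) (0, 0)) :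
    w ∈ (hvSurface a).dom (e11 a b) := by
  have h13 : (X12 a).par (Sum.inl (Sum.inr b)) w ≠
      (X12 a).par (Sum.inr 0) (0, a) :=
    par_inl_ne_par_inr h (blowMap_zero_left _ _)
  have h14 : (X13 a).par (Sum.inl (Sum.inl (Sum.inr b))) w ≠
      (X13 a).par (Sum.inr 0) (0, 0) :=
    par_inl_ne_par_inr h13 (blowMap_zero_left _ _)
  refine mem_up14 ⟨⟨⟨mem_X11 b w, h⟩, h13⟩, h14⟩ ?_
  rw [← e11, hvProj_e11, hvProj_e10, hvProj_e9]
  exact (P1xP1_ne₂ _).symm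

theorem mem_e12 {b : Fin 2} {w : ℂ × ℂ}
    (h : (X12 a).par (Sum.inr b) w ≠ (X12 a).par (Sum.inr 0) (0, a)) :
    w ∈ (hvSurface a).dom (e12 a b) := by
  have h14 : (X13 a).par (Sum.inl (Sum.inr b)) w ≠
      (X13 a).par (Sum.inr 0) (0, 0) :=
    par_inl_ne_par_inr h (blowMap_zero_left _ _)
  refine mem_up14 ⟨⟨mem_X12 b w, h⟩, h14⟩ ?_
  rw [← e12, hvProj_e12, hvProj_e11, hvProj_e10, hvProj_e9]
  exact (P1xP1_ne₂ _).symm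

theorem mem_e13 {b : Fin 2} {w : ℂ × ℂ}
    (h : (X13 a).par (Sum.inr b) w ≠ (X13 a).par (Sum.inr 0) (0, 0)) :
    w ∈ (hvSurface a).dom (e13 a b) := by
  refine mem_up14 ⟨mem_X13 b w, h⟩ ?_
  rw [← e13, hvProj_e13, hvProj_e12, hvProj_e11, hvProj_e10, hvProj_e9]
  exact (P1xP1_ne₂ _).symm

theorem mem_e14 (b : Fin 2) (w : ℂ × ℂ) : w ∈ (hvSurface a).dom (e14 a b) := by
  refine mem_up14 (mem_X14 b w) ?_
  rw [← e14, hvProj_e14, hvProj_e13, hvProj_e12, hvProj_e11, hvProj_e10, hvProj_e9]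
  exact (P1xP1_ne₂ _).symm

theorem mem_e9_zero {w : ℂ × ℂ} (h : w ≠ (0, 1)) : w ∈ (hvSurface a).dom (e9 a 0) :=
  mem_e9 ((X9 a).injOn_par _ |>.ne (mem_X9 _ _) (mem_X9 _ _) h)

theorem mem_e9_one {w : ℂ × ℂ} (h : w.1 * 1 ≠ 1) : w ∈ (hvSurface a).dom (e9 a 1) :=
  mem_e9 (par_one_ne_par_zero rfl h)

theorem mem_e10_zero {w : ℂ × ℂ} (h : w ≠ (0, 0)) : w ∈ (hvSurface a).dom (e10 a 0) :=
  mem_e10 ((X10 a).injOn_par _ |>.ne (mem_X10 _ _) (mem_X10 _ _) h)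

theorem mem_e10_one {w : ℂ × ℂ} (h : w.1 * 0 ≠ 1) : w ∈ (hvSurface a).dom (e10 a 1) :=
  mem_e10 (par_one_ne_par_zero rfl h)

theorem mem_e11_one {w : ℂ × ℂ} (h : w ≠ (0, 0)) : w ∈ (hvSurface a).dom (e11 a 1) :=
  mem_e11 ((X11 a).injOn_par _ |>.ne (mem_X11 _ _) (mem_X11 _ _) h)

theorem mem_e11_zero {w : ℂ × ℂ} (h : w.2 * 0 ≠ 1) : w ∈ (hvSurface a).dom (e11 a 0) :=
  mem_e11 (par_zero_ne_par_one rfl h)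

theorem mem_e12_zero {w : ℂ × ℂ} (h : w ≠ (0, a)) : w ∈ (hvSurface a).dom (e12 a 0) :=
  mem_e12 ((X12 a).injOn_par _ |>.ne (mem_X12 _ _) (mem_X12 _ _) h)

theorem mem_e12_one {w : ℂ × ℂ} (h : w.1 * a ≠ 1) : w ∈ (hvSurface a).dom (e12 a 1) :=
  mem_e12 (par_one_ne_par_zero rfl h)

theorem mem_e13_zero {w : ℂ × ℂ} (h : w ≠ (0, 0)) : w ∈ (hvSurface a).dom (e13 a 0) :=
  mem_e13 ((X13 a).injOn_par _ |>.ne (mem_X13 _ _) (mem_X13 _ _) h)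

theorem mem_e13_one {w : ℂ × ℂ} (h : w.1 * 0 ≠ 1) : w ∈ (hvSurface a).dom (e13 a 1) :=
  mem_e13 (par_one_ne_par_zero rfl h)

theorem mem_e1 {b : Fin 2} {w : ℂ × ℂ}
    (h : (X1 a).par (Sum.inr b) w ≠ (X1 a).par (Sum.inr 1) (0, 0)) :
    w ∈ (hvSurface a).dom (e1 a b) := by
  have h3 : (X2 a).par (Sum.inl (Sum.inr b)) w ≠
      (X2 a).par (Sum.inr 0) (0, a) :=
    par_inl_ne_par_inr h (blowMap_zero_left _ _)
  have h4 : (X3 a).par (Sum.inl (Sum.inl (Sum.inr b))) w ≠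
      (X3 a).par (Sum.inr 0) (0, 0) :=
    par_inl_ne_par_inr h3 (blowMap_zero_left _ _)
  exact ⟨⟨⟨mem_X1 b w, h⟩, h3⟩, h4⟩

theorem mem_e2 {b : Fin 2} {w : ℂ × ℂ}
    (h : (X2 a).par (Sum.inr b) w ≠ (X2 a).par (Sum.inr 0) (0, a)) :
    w ∈ (hvSurface a).dom (e2 a b) := by
  have h4 : (X3 a).par (Sum.inl (Sum.inr b)) w ≠
      (X3 a).par (Sum.inr 0) (0, 0) :=
    par_inl_ne_par_inr h (blowMap_zero_left _ _)
  exact ⟨⟨mem_X2 b w, h⟩, h4⟩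

theorem mem_e3 {b : Fin 2} {w : ℂ × ℂ}
    (h : (X3 a).par (Sum.inr b) w ≠ (X3 a).par (Sum.inr 0) (0, 0)) :
    w ∈ (hvSurface a).dom (e3 a b) := by
  exact ⟨mem_X3 b w, h⟩

theorem mem_e4 (b : Fin 2) (w : ℂ × ℂ) : w ∈ (hvSurface a).dom (e4 a b) := by
  exact mem_X4 b w

theorem mem_e1_one {w : ℂ × ℂ} (h : w ≠ (0, 0)) : w ∈ (hvSurface a).dom (e1 a 1) :=
  mem_e1 ((X1 a).injOn_par _ |>.ne (mem_X1 _ _) (mem_X1 _ _) h)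

theorem mem_e1_zero {w : ℂ × ℂ} (h : w.2 * 0 ≠ 1) : w ∈ (hvSurface a).dom (e1 a 0) :=
  mem_e1 (par_zero_ne_par_one rfl h)

theorem mem_e2_zero {w : ℂ × ℂ} (h : w ≠ (0, a)) : w ∈ (hvSurface a).dom (e2 a 0) :=
  mem_e2 ((X2 a).injOn_par _ |>.ne (mem_X2 _ _) (mem_X2 _ _) h)

theorem mem_e2_one {w : ℂ × ℂ} (h : w.1 * a ≠ 1) : w ∈ (hvSurface a).dom (e2 a 1) :=
  mem_e2 (par_one_ne_par_zero rfl h)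

theorem mem_e3_zero {w : ℂ × ℂ} (h : w ≠ (0, 0)) : w ∈ (hvSurface a).dom (e3 a 0) :=
  mem_e3 ((X3 a).injOn_par _ |>.ne (mem_X3 _ _) (mem_X3 _ _) h)

theorem mem_e3_one {w : ℂ × ℂ} (h : w.1 * 0 ≠ 1) : w ∈ (hvSurface a).dom (e3 a 1) :=
  mem_e3 (par_one_ne_par_zero rfl h)

end Domains

/-! ### The surface is separated, and contains the affine plane -/

theorem isSeparated_hvSurface (a : ℂ) : IsSeparatedSurface (hvSurface a) := by
  have s5 : IsSeparatedSurface X5 := isSeparated_blowUp isSeparated_P1xP1 (0, 1) (0, 0) trivial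
  have s6 : IsSeparatedSurface X6 := isSeparated_blowUp s5 (Sum.inr 0) (0, 0) trivial
  have s7 : IsSeparatedSurface (X7 a) := isSeparated_blowUp s6 (Sum.inr 1) (a, 0) trivial
  have s8 : IsSeparatedSurface (X8 a) := isSeparated_blowUp s7 (Sum.inr 1) (0, 0) trivial
  have s9 : IsSeparatedSurface (X9 a) := isSeparated_blowUp s8 (old8 a 1) (0, 0) (old8_mem a 1)
  have s10 : IsSeparatedSurface (X10 a) := isSeparated_blowUp s9 (Sum.inr 0) (0, 1) (X9_mem₀ a 1)
  have s11 : IsSeparatedSurface (X11 a) := isSeparated_blowUp s10 (Sum.inr 0) (0, 0) (X10_mem a 0)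
  have s12 : IsSeparatedSurface (X12 a) := isSeparated_blowUp s11 (Sum.inr 1) (0, 0) (X11_mem a 0)
  have s13 : IsSeparatedSurface (X13 a) := isSeparated_blowUp s12 (Sum.inr 0) (0, a) (X12_mem a a)
  have s14 : IsSeparatedSurface (X14 a) := isSeparated_blowUp s13 (Sum.inr 0) (0, 0) (X13_mem a 0)
  have s1 : IsSeparatedSurface (X1 a) := isSeparated_blowUp s14 (old14 a) (0, 0) (old14_mem a)
  have s2 : IsSeparatedSurface (X2 a) := isSeparated_blowUp s1 (Sum.inr 1) (0, 0) (X1_mem a 0)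
  have s3 : IsSeparatedSurface (X3 a) := isSeparated_blowUp s2 (Sum.inr 0) (0, a) (X2_mem a a)
  exact isSeparated_blowUp s3 _ _ (X3_mem a 0)

theorem chartP1_zero_eq_coe {u x : ℂ} : chartP1 0 u = (x : OnePoint ℂ) ↔ u = x := by
  simp [chartP1]

theorem chartP1_one_eq_coe {u x : ℂ} : chartP1 1 u = (x : OnePoint ℂ) ↔ u * x = 1 := by
  simp only [chartP1, one_ne_zero, if_false, invPt_eq_coe]
  exact ⟨fun h => by rw [h.2, mul_inv_cancel₀ h.1],
    fun h => ⟨left_ne_zero_of_mul_eq_one h, eq_inv_of_mul_eq_one_right h⟩⟩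

theorem par_eq_affPt {i j : Fin 2} {u v : ℂ} {w : ℂ × ℂ} :
    P1xP1.par (i, j) (u, v) = affPt w ↔ chartP1 i u = w.1 ∧ chartP1 j v = w.2 :=
  Prod.mk_inj

/-- No centre of a blow-up lies over the affine plane, so the projection is injective there. -/
theorem hvProj_injective_over {a : ℂ} {q q' : (hvSurface a).Pt} {v : ℂ × ℂ}
    (hq : hvProj a q = affPt v) (hq' : hvProj a q' = affPt v) : q = q' := by
  have key : ∀ {X : AlgSurface} {c : X.Idx} {z₀ : ℂ × ℂ} {hz₀ : z₀ ∈ X.dom c}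
      {f : X.Pt → P1xP1.Pt} (_ : f (X.par c z₀) ≠ affPt v) (b : Fin 2) (w : ℂ × ℂ)
      (_ : blowMap z₀ b w = z₀),
      (f ∘ blowDown X c z₀ hz₀) ((blowUp X c z₀ hz₀).par (Sum.inr b) w) ≠ affPt v := by
    intro X c z₀ hz₀ f h b w hw
    rwa [comp_blowDown_inr, hw]
  have hinf : ∀ i : Fin 2 × Fin 2, i ≠ (0, 0) → P1xP1.par i (0, 0) ≠ affPt v := by
    rintro ⟨i, j⟩ hi h
    obtain ⟨h1, h2⟩ := par_eq_affPt.1 h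
    fin_cases i <;> fin_cases j
    · exact hi rfl
    · simpa using chartP1_one_eq_coe.1 h2
    · simpa using chartP1_one_eq_coe.1 h1
    · simpa using chartP1_one_eq_coe.1 h1
  have c5 : id (P1xP1.par (0, 1) (0, 0)) ≠ affPt v := hinf _ (by decide)
  have c6 : proj5 (X5.par (Sum.inr 0) (0, 0)) ≠ affPt v := key c5 _ _ (blowMap_zero_left _ _)
  have c7 : proj6 (X6.par (Sum.inr 1) (a, 0)) ≠ affPt v := key c6 _ _ (blowMap_zero_right _ _)
  have c8 : proj7 a ((X7 a).par (Sum.inr 1) (0, 0)) ≠ affPt v :=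
    key c7 _ _ (blowMap_zero_right _ _)
  have c9 : proj8 a ((X8 a).par (old8 a 1) (0, 0)) ≠ affPt v := by
    rw [show proj8 a ((X8 a).par (old8 a 1) (0, 0)) = _ from proj8_base (1, 1) (0, 0)]
    exact hinf _ (by decide)
  have c10 : proj9 a ((X9 a).par (Sum.inr 0) (0, 1)) ≠ affPt v :=
    key c9 _ _ (blowMap_zero_left _ _)
  have c11 : proj10 a ((X10 a).par (Sum.inr 0) (0, 0)) ≠ affPt v :=
    key c10 _ _ (blowMap_zero_left _ _)
  have c12 : proj11 a ((X11 a).par (Sum.inr 1) (0, 0)) ≠ affPt v :=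
    key c11 _ _ (blowMap_zero_right _ _)
  have c13 : proj12 a ((X12 a).par (Sum.inr 0) (0, a)) ≠ affPt v :=
    key c12 _ _ (blowMap_zero_left _ _)
  have c14 : proj13 a ((X13 a).par (Sum.inr 0) (0, 0)) ≠ affPt v :=
    key c13 _ _ (blowMap_zero_left _ _)
  have c1 : proj14 a ((X14 a).par (old14 a) (0, 0)) ≠ affPt v := by
    rw [show proj14 a ((X14 a).par (old14 a) (0, 0)) = _ from proj14_base (1, 0) (0, 0)]
    exact hinf _ (by decide)
  have c2 : proj1 a ((X1 a).par (Sum.inr 1) (0, 0)) ≠ affPt v :=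
    key c1 _ _ (blowMap_zero_right _ _)
  have c3 : proj2 a ((X2 a).par (Sum.inr 0) (0, a)) ≠ affPt v :=
    key c2 _ _ (blowMap_zero_left _ _)
  have c4 : proj3 a ((X3 a).par (Sum.inr 0) (0, 0)) ≠ affPt v :=
    key c3 _ _ (blowMap_zero_left _ _)
  have i0 : ∀ q q' : P1xP1.Pt, id q = affPt v → id q' = affPt v → q = q' :=
    fun _ _ h h' => h.trans h'.symm
  have i5 : ∀ q q', proj5 q = affPt v → proj5 q' = affPt v → q = q' :=
    injective_over_blowDown (X := P1xP1) (z₀ := (0, 0)) (hz₀ := trivial) i0 c5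
  have i6 : ∀ q q', proj6 q = affPt v → proj6 q' = affPt v → q = q' :=
    injective_over_blowDown (X := X5) (c := Sum.inr 0) (z₀ := (0, 0)) (hz₀ := trivial) i5 c6
  have i7 : ∀ q q', proj7 a q = affPt v → proj7 a q' = affPt v → q = q' :=
    injective_over_blowDown (X := X6) (c := Sum.inr 1) (z₀ := (a, 0)) (hz₀ := trivial) i6 c7
  have i8 : ∀ q q', proj8 a q = affPt v → proj8 a q' = affPt v → q = q' :=
    injective_over_blowDown (X := X7 a) (c := Sum.inr 1) (z₀ := (0, 0)) (hz₀ := trivial) i7 c8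
  have i9 : ∀ q q', proj9 a q = affPt v → proj9 a q' = affPt v → q = q' :=
    injective_over_blowDown (hz₀ := (old8_mem a 1)) i8 c9
  have i10 : ∀ q q', proj10 a q = affPt v → proj10 a q' = affPt v → q = q' :=
    injective_over_blowDown (hz₀ := (X9_mem₀ a 1)) i9 c10
  have i11 : ∀ q q', proj11 a q = affPt v → proj11 a q' = affPt v → q = q' :=
    injective_over_blowDown (hz₀ := (X10_mem a 0)) i10 c11
  have i12 : ∀ q q', proj12 a q = affPt v → proj12 a q' = affPt v → q = q' :=
    injective_over_blowDown (hz₀ := (X11_mem a 0)) i11 c12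
  have i13 : ∀ q q', proj13 a q = affPt v → proj13 a q' = affPt v → q = q' :=
    injective_over_blowDown (hz₀ := (X12_mem a a)) i12 c13
  have i14 : ∀ q q', proj14 a q = affPt v → proj14 a q' = affPt v → q = q' :=
    injective_over_blowDown (hz₀ := (X13_mem a 0)) i13 c14
  have i1 : ∀ q q', proj1 a q = affPt v → proj1 a q' = affPt v → q = q' :=
    injective_over_blowDown (hz₀ := (old14_mem a)) i14 c1
  have i2 : ∀ q q', proj2 a q = affPt v → proj2 a q' = affPt v → q = q' :=
    injective_over_blowDown (hz₀ := (X1_mem a 0)) i1 c2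
  have i3 : ∀ q q', proj3 a q = affPt v → proj3 a q' = affPt v → q = q' :=
    injective_over_blowDown (hz₀ := (X2_mem a a)) i2 c3
  exact injective_over_blowDown (hz₀ := X3_mem a 0) i3 c4 q q' hq hq'

/-! ### Generic points of the charts -/

theorem tendsto_blowMap_generic (z₀ : ℂ × ℂ) (b : Fin 2) :
    Filter.Tendsto (blowMap z₀ b) genericFilter genericFilter := by
  have h : blowMap z₀ b (1, 1) ≠ z₀ := by
    obtain ⟨x, y⟩ := z₀
    fin_cases b <;> simp [blowMap]
  obtain ⟨k, hk, hkb⟩ := blowMap_section h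
  exact (regMapAt_blowMap z₀ b (k (blowMap z₀ b (1, 1)))).tendsto_generic hk rfl hkb

/-- Generic points of the chart `i` lie over points `(x, y) ∈ ℂ²` with `x, y ≠ 0`. -/
def IsGenericallyFinite {a : ℂ} (i : (hvSurface a).Idx) : Prop :=
  ∀ᶠ w in genericFilter, ∃ v : ℂ × ℂ, v.1 ≠ 0 ∧ v.2 ≠ 0 ∧
    hvProj a ((hvSurface a).par i w) = affPt v

section Generic

variable {a : ℂ}

theorem P1xP1_generic (i : Fin 2 × Fin 2) : ∀ᶠ w in genericFilter, ∃ v : ℂ × ℂ,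
    v.1 ≠ 0 ∧ v.2 ≠ 0 ∧ P1xP1.par i w = affPt v := by
  have key : ∀ (j : Fin 2) (u : ℂ), u ≠ 0 → ∃ x : ℂ, x ≠ 0 ∧ chartP1 j u = x := by
    intro j u hu
    fin_cases j
    · exact ⟨u, hu, chartP1_zero_eq_coe.2 rfl⟩
    · exact ⟨u⁻¹, inv_ne_zero hu, chartP1_one_eq_coe.2 (mul_inv_cancel₀ hu)⟩
  filter_upwards [(regFunAt_fst (1, 1)).generic_ne one_ne_zero,
    (regFunAt_snd (1, 1)).generic_ne one_ne_zero] with w h1 h2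
  obtain ⟨x, hx, hx'⟩ := key i.1 w.1 h1
  obtain ⟨y, hy, hy'⟩ := key i.2 w.2 h2
  exact ⟨(x, y), hx, hy, par_eq_affPt.2 ⟨hx', hy'⟩⟩

theorem isGenericallyFinite_base (i : Fin 2 × Fin 2) : IsGenericallyFinite (base a i) :=
  (P1xP1_generic i).mono fun w hw => by rwa [hvProj_base]

theorem IsGenericallyFinite.blowUp {i j : (hvSurface a).Idx} {z₀ : ℂ × ℂ} {b : Fin 2}
    (hi : IsGenericallyFinite i) (h : ∀ w, hvProj a ((hvSurface a).par j w) =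
      hvProj a ((hvSurface a).par i (blowMap z₀ b w))) : IsGenericallyFinite j := by
  filter_upwards [(tendsto_blowMap_generic z₀ b).eventually hi] with w hw
  rwa [h]

theorem IsGenericallyFinite.blowUp_base {i : Fin 2 × Fin 2} {j : (hvSurface a).Idx} {z₀ : ℂ × ℂ}
    {b : Fin 2} (h : ∀ w, hvProj a ((hvSurface a).par j w) = P1xP1.par i (blowMap z₀ b w)) :
    IsGenericallyFinite j :=
  (isGenericallyFinite_base i).blowUp fun w => by rw [h, hvProj_base]

theorem isGenericallyFinite_e5 (b : Fin 2) : IsGenericallyFinite (e5 a b) :=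
  .blowUp_base (hvProj_e5 b)

theorem isGenericallyFinite_e6 (b : Fin 2) : IsGenericallyFinite (e6 a b) :=
  (isGenericallyFinite_e5 0).blowUp (hvProj_e6 b)

theorem isGenericallyFinite_e7 (b : Fin 2) : IsGenericallyFinite (e7 a b) :=
  (isGenericallyFinite_e6 1).blowUp (hvProj_e7 b)

theorem isGenericallyFinite_e8 (b : Fin 2) : IsGenericallyFinite (e8 a b) :=
  (isGenericallyFinite_e7 1).blowUp (hvProj_e8 b)

theorem isGenericallyFinite_e9 (b : Fin 2) : IsGenericallyFinite (e9 a b) :=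
  .blowUp_base (hvProj_e9 b)

theorem isGenericallyFinite_e10 (b : Fin 2) : IsGenericallyFinite (e10 a b) :=
  (isGenericallyFinite_e9 0).blowUp (hvProj_e10 b)

theorem isGenericallyFinite_e11 (b : Fin 2) : IsGenericallyFinite (e11 a b) :=
  (isGenericallyFinite_e10 0).blowUp (hvProj_e11 b)

theorem isGenericallyFinite_e12 (b : Fin 2) : IsGenericallyFinite (e12 a b) :=
  (isGenericallyFinite_e11 1).blowUp (hvProj_e12 b)

theorem isGenericallyFinite_e13 (b : Fin 2) : IsGenericallyFinite (e13 a b) :=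
  (isGenericallyFinite_e12 0).blowUp (hvProj_e13 b)

theorem isGenericallyFinite_e14 (b : Fin 2) : IsGenericallyFinite (e14 a b) :=
  (isGenericallyFinite_e13 0).blowUp (hvProj_e14 b)

theorem isGenericallyFinite_e1 (b : Fin 2) : IsGenericallyFinite (e1 a b) :=
  .blowUp_base (hvProj_e1 b)

theorem isGenericallyFinite_e2 (b : Fin 2) : IsGenericallyFinite (e2 a b) :=
  (isGenericallyFinite_e1 1).blowUp (hvProj_e2 b)

theorem isGenericallyFinite_e3 (b : Fin 2) : IsGenericallyFinite (e3 a b) :=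
  (isGenericallyFinite_e2 0).blowUp (hvProj_e3 b)

theorem isGenericallyFinite_e4 (b : Fin 2) : IsGenericallyFinite (e4 a b) :=
  (isGenericallyFinite_e3 0).blowUp (hvProj_e4 b)

end Generic

/-! ### Lifting maps of the affine plane to the surface -/

theorem RegFunAt.pow {f : ℂ × ℂ → ℂ} {z : ℂ × ℂ} (hf : RegFunAt f z) (n : ℕ) :
    RegFunAt (fun w => f w ^ n) z := by
  induction n with
  | zero => simpa using regFunAt_const 1 z
  | succ n ih => simpa [pow_succ] using ih.mul hf

theorem RegFunAt.neg {f : ℂ × ℂ → ℂ} {z : ℂ × ℂ} (hf : RegFunAt f z) :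
    RegFunAt (fun w => -f w) z := by
  simpa using (regFunAt_const (-1) z).mul hf

theorem RegFunAt.sub {f g : ℂ × ℂ → ℂ} {z : ℂ × ℂ} (hf : RegFunAt f z) (hg : RegFunAt g z) :
    RegFunAt (fun w => f w - g w) z := by
  simpa [sub_eq_add_neg] using hf.add hg.neg

theorem RegFunAt.div {f g : ℂ × ℂ → ℂ} {z : ℂ × ℂ} (hf : RegFunAt f z) (hg : RegFunAt g z)
    (h0 : g z ≠ 0) : RegFunAt (fun w => f w / g w) z := by
  simpa [div_eq_mul_inv] using hf.mul (hg.inv h0)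

attribute [fun_prop] RegFunAt
attribute [fun_prop] regFunAt_const regFunAt_fst regFunAt_snd RegFunAt.add RegFunAt.mul
  RegFunAt.pow RegFunAt.neg RegFunAt.sub RegFunAt.div

section Lift

variable {a : ℂ} {U : Set (ℂ × ℂ)} {f : ℂ × ℂ → ℂ × ℂ}

/-- The graph of the map `f : U → ℂ²`, as a relation between points of the surface. -/
def graphRel (a : ℂ) (U : Set (ℂ × ℂ)) (f : ℂ × ℂ → ℂ × ℂ) (q q' : (hvSurface a).Pt) : Prop :=
  ∃ v ∈ U, hvProj a q = affPt v ∧ hvProj a q' = affPt (f v)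

/-- The pair `(p, p')` of points of `ℙ¹ × ℙ¹` is on the graph of `f` if `p` is a finite point with
nonzero coordinates. -/
def OnGraph (f : ℂ × ℂ → ℂ × ℂ) (p p' : OnePoint ℂ × OnePoint ℂ) : Prop :=
  ∀ v : ℂ × ℂ, v.1 ≠ 0 → v.2 ≠ 0 → p = affPt v → p' = affPt (f v)

/-- The map `f` of the affine plane extends regularly around the point `q` of the surface. -/
def HasLift (f : ℂ × ℂ → ℂ × ℂ) (q : (hvSurface a).Pt) : Prop :=
  ∃ i z j g, (hvSurface a).par i z = q ∧ IsGenericallyFinite i ∧ z ∈ (hvSurface a).dom i ∧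
    RegMapAt g z ∧ g z ∈ (hvSurface a).dom j ∧ ∀ᶠ w in zariskiNhds z,
      OnGraph f (hvProj a ((hvSurface a).par i w)) (hvProj a ((hvSurface a).par j (g w)))

theorem affPt_injective : Function.Injective affPt := by
  rintro ⟨x, y⟩ ⟨x', y'⟩ h
  simpa [affPt] using h

theorem hvProj_base₀₀ (v : ℂ × ℂ) : hvProj a ((hvSurface a).par (base a (0, 0)) v) = affPt v :=
  (hvProj_base _ _).trans (par_eq_affPt.2 ⟨chartP1_zero_eq_coe.2 rfl, chartP1_zero_eq_coe.2 rfl⟩)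

/-- An involution of a subset `U` of `ℂ²` that contains all points with nonzero coordinates, and
that extends regularly around every point of the surface, lifts to an automorphism. -/
theorem exists_lift_involution (hU : ∀ v : ℂ × ℂ, v.1 ≠ 0 → v.2 ≠ 0 → v ∈ U)
    (hfU : ∀ v ∈ U, f v ∈ U) (hff : ∀ v ∈ U, f (f v) = v) (hfr : ∀ v ∈ U, RegMapAt f v)
    (h : ∀ q : (hvSurface a).Pt, HasLift f q) :
    ∃ F : (hvSurface a).Pt ≃ (hvSurface a).Pt, IsAutomorphism F ∧ F.symm = F ∧
      IsLiftOf a F U f := by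
  have hR : ∀ p q q', graphRel a U f p q → graphRel a U f p q' → q = q' := by
    rintro p q q' ⟨v, -, h1, h2⟩ ⟨v', -, h3, h4⟩
    obtain rfl := affPt_injective (h1.symm.trans h3)
    exact hvProj_injective_over h2 h4
  have hloc : ∀ q, ∃ i z j g, (hvSurface a).par i z = q ∧
      IsLocalExtension (graphRel a U f) i z j g := by
    intro q
    obtain ⟨i, z, j, g, hq, hi, hz, hg, hgz, hG⟩ := h q
    refine ⟨i, z, j, g, hq, hz, hg, hgz, ?_⟩
    filter_upwards [hi, eventually_generic hG] with w ⟨v, hv1, hv2, hv⟩ hw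
    exact ⟨v, hU v hv1 hv2, hv, hw v hv1 hv2 hv⟩
  obtain ⟨F, hF, hval⟩ := exists_regular_extension (isSeparated_hvSurface a) hR hloc
  have hlift : IsLiftOf a F U f := by
    intro q v hv hq
    have h0 : IsLocalExtension (graphRel a U f) (base a (0, 0)) v (base a (0, 0)) f := by
      refine ⟨mem_base₀₀ v, hfr v hv, mem_base₀₀ _, ?_⟩
      filter_upwards [(regFunAt_fst (1, 1)).generic_ne one_ne_zero,
        (regFunAt_snd (1, 1)).generic_ne one_ne_zero] with w h1 h2
      exact ⟨w, hU w h1 h2, hvProj_base₀₀ w, hvProj_base₀₀ _⟩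
    rw [hvProj_injective_over hq (hvProj_base₀₀ v), hval _ _ _ _ h0, hvProj_base₀₀]
  have hFF : F ∘ F = id := by
    refine (isSeparated_hvSurface a).eq_of_generic (hF.comp hF)
      (isRegularMap_of_charts fun q => ?_) fun q => ?_
    · obtain ⟨i, z, hz, hq⟩ := (hvSurface a).cover q
      exact ⟨i, z, hz, hq, i, fun w => w, regMapAt_id z, .of_forall fun w hw => ⟨hw, rfl⟩⟩
    · obtain ⟨i, z, j, g, hq, hi, hz, -⟩ := h q
      refine ⟨i, z, hz, hq, hi.mono ?_⟩
      rintro w ⟨v, hv1, hv2, hv⟩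
      have hvU := hU v hv1 hv2
      have h1 := hlift _ _ (hfU v hvU) (hlift _ v hvU hv)
      rw [hff v hvU] at h1
      exact hvProj_injective_over h1 hv
  exact ⟨⟨F, F, congrFun hFF, congrFun hFF⟩, ⟨hF, hF⟩, rfl, hlift⟩

/-- The values of the functions `g₁`, `g₂` are the coordinates, in the chart `j`, of the image of
the point with coordinates `w` in the chart `i`. -/
theorem HasLift.of_charts {i j : (hvSurface a).Idx} (hi : IsGenericallyFinite i) {z : ℂ × ℂ}
    (hz : z ∈ (hvSurface a).dom i) (g₁ g₂ : ℂ × ℂ → ℂ) (h₁ : RegFunAt g₁ z)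
    (h₂ : RegFunAt g₂ z) (hg : (g₁ z, g₂ z) ∈ (hvSurface a).dom j)
    (h : ∀ᶠ w in zariskiNhds z, OnGraph f (hvProj a ((hvSurface a).par i (w.1, w.2)))
      (hvProj a ((hvSurface a).par j (g₁ w, g₂ w)))) : HasLift f ((hvSurface a).par i z) :=
  ⟨i, z, j, fun w => (g₁ w, g₂ w), rfl, hi, hz, ⟨h₁, h₂⟩, hg, h⟩

/-- Gives a name to a regular function, without a value that simplification would unfold. -/
theorem exists_eq_regFun (f : ℂ × ℂ → ℂ) (hf : ∀ z, RegFunAt f z) :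
    ∃ A, A = f ∧ ∀ z, RegFunAt A z := ⟨f, rfl, hf⟩

theorem RegFunAt.eventually_onGraph {f : ℂ × ℂ → ℂ × ℂ} {A : ℂ × ℂ → ℂ} {z : ℂ × ℂ}
    (hA : RegFunAt A z) (h0 : A z ≠ 0) {p p' : ℂ × ℂ → OnePoint ℂ × OnePoint ℂ}
    (h : ∀ w, A w ≠ 0 → OnGraph f (p w) (p' w)) :
    ∀ᶠ w in zariskiNhds z, OnGraph f (p w) (p' w) :=
  (hA.eventually_ne h0).mono h

end Lift

/-! ### Coordinates on the charts -/

section Coordinates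

variable {a : ℂ} (u v : ℂ)

theorem proj_e5_zero : hvProj a ((hvSurface a).par (e5 a 0) (u, v)) =
    P1xP1.par (0, 1) (u, u * v) := by
  simp [hvProj_e5, blowMap]
  rfl

theorem proj_e5_one : hvProj a ((hvSurface a).par (e5 a 1) (u, v)) =
    P1xP1.par (0, 1) (u * v, v) := by
  simp [hvProj_e5, blowMap]
  rfl

theorem proj_e6_zero : hvProj a ((hvSurface a).par (e6 a 0) (u, v)) =
    hvProj a ((hvSurface a).par (e5 a 0) (u, u * v)) := by simp [hvProj_e6, blowMap]

theorem proj_e6_one : hvProj a ((hvSurface a).par (e6 a 1) (u, v)) =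
    hvProj a ((hvSurface a).par (e5 a 0) (u * v, v)) := by simp [hvProj_e6, blowMap]

theorem proj_e7_zero : hvProj a ((hvSurface a).par (e7 a 0) (u, v)) =
    hvProj a ((hvSurface a).par (e6 a 1) (a + u, u * v)) := by simp [hvProj_e7, blowMap]

theorem proj_e7_one : hvProj a ((hvSurface a).par (e7 a 1) (u, v)) =
    hvProj a ((hvSurface a).par (e6 a 1) (a + u * v, v)) := by simp [hvProj_e7, blowMap]

theorem proj_e8_zero : hvProj a ((hvSurface a).par (e8 a 0) (u, v)) =
    hvProj a ((hvSurface a).par (e6 a 1) (a + u * (u * v), u * v)) := by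
  simp [hvProj_e8, proj_e7_one, blowMap]

theorem proj_e8_one : hvProj a ((hvSurface a).par (e8 a 1) (u, v)) =
    hvProj a ((hvSurface a).par (e6 a 1) (a + u * v * v, v)) := by
  simp [hvProj_e8, proj_e7_one, blowMap]

theorem proj_e9_zero : hvProj a ((hvSurface a).par (e9 a 0) (u, v)) =
    P1xP1.par (1, 1) (u, u * v) := by
  simp [hvProj_e9, blowMap]
  rfl

theorem proj_e9_one : hvProj a ((hvSurface a).par (e9 a 1) (u, v)) =
    P1xP1.par (1, 1) (u * v, v) := by
  simp [hvProj_e9, blowMap]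
  rfl

theorem proj_e10_zero : hvProj a ((hvSurface a).par (e10 a 0) (u, v)) =
    P1xP1.par (1, 1) (u, u * (1 + u * v)) := by
  simp [hvProj_e10, proj_e9_zero, blowMap]
  rfl

theorem proj_e10_one : hvProj a ((hvSurface a).par (e10 a 1) (u, v)) =
    P1xP1.par (1, 1) (u * v, u * v * (1 + v)) := by
  simp [hvProj_e10, proj_e9_zero, blowMap]
  rfl

theorem proj_e11_zero : hvProj a ((hvSurface a).par (e11 a 0) (u, v)) =
    P1xP1.par (1, 1) (u, u * (1 + u ^ 2 * v)) := by
  simp [hvProj_e11, proj_e10_zero, blowMap, pow_two, mul_assoc]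
  rfl

theorem proj_e11_one : hvProj a ((hvSurface a).par (e11 a 1) (u, v)) =
    P1xP1.par (1, 1) (u * v, u * v * (1 + u * v ^ 2)) := by
  simp [hvProj_e11, proj_e10_zero, blowMap, pow_two, mul_assoc]
  rfl

theorem proj_e12_zero : hvProj a ((hvSurface a).par (e12 a 0) (u, v)) =
    hvProj a ((hvSurface a).par (e11 a 1) (u, u * v)) := by simp [hvProj_e12, blowMap]

theorem proj_e12_one : hvProj a ((hvSurface a).par (e12 a 1) (u, v)) =
    hvProj a ((hvSurface a).par (e11 a 1) (u * v, v)) := by simp [hvProj_e12, blowMap]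

theorem proj_e13_zero : hvProj a ((hvSurface a).par (e13 a 0) (u, v)) =
    hvProj a ((hvSurface a).par (e12 a 0) (u, a + u * v)) := by simp [hvProj_e13, blowMap]

theorem proj_e13_one : hvProj a ((hvSurface a).par (e13 a 1) (u, v)) =
    hvProj a ((hvSurface a).par (e12 a 0) (u * v, a + v)) := by simp [hvProj_e13, blowMap]

theorem proj_e14_zero : hvProj a ((hvSurface a).par (e14 a 0) (u, v)) =
    hvProj a ((hvSurface a).par (e12 a 0) (u, a + u * (u * v))) := by
  simp [hvProj_e14, proj_e13_zero, blowMap]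

theorem proj_e14_one : hvProj a ((hvSurface a).par (e14 a 1) (u, v)) =
    hvProj a ((hvSurface a).par (e12 a 0) (u * v, a + u * v * v)) := by
  simp [hvProj_e14, proj_e13_zero, blowMap]

theorem proj_e1_zero : hvProj a ((hvSurface a).par (e1 a 0) (u, v)) =
    P1xP1.par (1, 0) (u, u * v) := by
  simp [hvProj_e1, blowMap]
  rfl

theorem proj_e1_one : hvProj a ((hvSurface a).par (e1 a 1) (u, v)) =
    P1xP1.par (1, 0) (u * v, v) := by
  simp [hvProj_e1, blowMap]
  rfl

theorem proj_e2_zero : hvProj a ((hvSurface a).par (e2 a 0) (u, v)) =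
    P1xP1.par (1, 0) (u * (u * v), u * v) := by
  simp [hvProj_e2, proj_e1_one, blowMap]
  rfl

theorem proj_e2_one : hvProj a ((hvSurface a).par (e2 a 1) (u, v)) =
    P1xP1.par (1, 0) (u * v * v, v) := by
  simp [hvProj_e2, proj_e1_one, blowMap]
  rfl

theorem proj_e3_zero : hvProj a ((hvSurface a).par (e3 a 0) (u, v)) =
    hvProj a ((hvSurface a).par (e2 a 0) (u, a + u * v)) := by simp [hvProj_e3, blowMap]

theorem proj_e3_one : hvProj a ((hvSurface a).par (e3 a 1) (u, v)) =
    hvProj a ((hvSurface a).par (e2 a 0) (u * v, a + v)) := by simp [hvProj_e3, blowMap]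

theorem proj_e4_zero : hvProj a ((hvSurface a).par (e4 a 0) (u, v)) =
    hvProj a ((hvSurface a).par (e2 a 0) (u, a + u * (u * v))) := by
  simp [hvProj_e4, proj_e3_zero, blowMap]

theorem proj_e4_one : hvProj a ((hvSurface a).par (e4 a 1) (u, v)) =
    hvProj a ((hvSurface a).par (e2 a 0) (u * v, a + u * v * v)) := by
  simp [hvProj_e4, proj_e3_zero, blowMap]

end Coordinates

/-! ### The involution `(x, y) ↦ (y, x)` -/

section Swap

variable {a : ℂ}

theorem onGraph_swap {p p' : OnePoint ℂ × OnePoint ℂ} (h : p' = p.swap) :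
    OnGraph Prod.swap p p' := by
  rintro v - - rfl
  exact h

/-- The transposition of coordinates of `ℂ²` identifies the charts `i` and `j`, and there it lifts
the transposition of coordinates of `ℙ¹ × ℙ¹`. -/
def IsSwap (i j : (hvSurface a).Idx) : Prop :=
  ∀ w, hvProj a ((hvSurface a).par j w.swap) = (hvProj a ((hvSurface a).par i w)).swap

theorem IsSwap.symm {i j : (hvSurface a).Idx} (h : IsSwap i j) : IsSwap j i := fun w => by
  rw [← w.swap_swap, h, Prod.swap_swap, Prod.swap_swap]

theorem isSwap_base (i : Fin 2 × Fin 2) : IsSwap (base a i) (base a i.swap) := fun w => by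
  rw [hvProj_base, hvProj_base]
  rfl

theorem blowMap_swap (z₀ : ℂ × ℂ) {b b' : Fin 2} (hb : b ≠ b') (w : ℂ × ℂ) :
    blowMap z₀.swap b' w.swap = (blowMap z₀ b w).swap := by
  fin_cases b <;> fin_cases b' <;> simp_all [blowMap, mul_comm]

theorem IsSwap.blowUp {i j k l : (hvSurface a).Idx} (h : IsSwap i j) {z₀ : ℂ × ℂ} {b b' : Fin 2}
    (hb : b ≠ b') (hk : ∀ w, hvProj a ((hvSurface a).par k w) =
      hvProj a ((hvSurface a).par i (blowMap z₀ b w)))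
    (hl : ∀ w, hvProj a ((hvSurface a).par l w) =
      hvProj a ((hvSurface a).par j (blowMap z₀.swap b' w))) : IsSwap k l := fun w => by
  rw [hl, blowMap_swap z₀ hb, h, hk]

theorem isSwap_e5 {b b' : Fin 2} (hb : b ≠ b') : IsSwap (e5 a b) (e1 a b') :=
  (isSwap_base (0, 1)).blowUp (z₀ := (0, 0)) hb (fun w => by rw [hvProj_e5, hvProj_base])
    (fun w => by rw [hvProj_e1, hvProj_base]; rfl)

theorem isSwap_e6 {b b' : Fin 2} (hb : b ≠ b') : IsSwap (e6 a b) (e2 a b') :=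
  (isSwap_e5 zero_ne_one).blowUp hb (hvProj_e6 b) (hvProj_e2 b')

theorem isSwap_e7 {b b' : Fin 2} (hb : b ≠ b') : IsSwap (e7 a b) (e3 a b') :=
  (isSwap_e6 one_ne_zero).blowUp hb (hvProj_e7 b) (hvProj_e3 b')

theorem isSwap_e8 {b b' : Fin 2} (hb : b ≠ b') : IsSwap (e8 a b) (e4 a b') :=
  (isSwap_e7 one_ne_zero).blowUp hb (hvProj_e8 b) (hvProj_e4 b')

theorem isSwap_e9 {b b' : Fin 2} (hb : b ≠ b') : IsSwap (e9 a b) (e9 a b') :=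
  (isSwap_base (1, 1)).blowUp (z₀ := (0, 0)) hb (fun w => by rw [hvProj_e9, hvProj_base])
    (fun w => by rw [hvProj_e9, hvProj_base]; rfl)

theorem IsSwap.hasLift {i j : (hvSurface a).Idx} (h : IsSwap i j) (hi : IsGenericallyFinite i)
    {z : ℂ × ℂ} (hz : z ∈ (hvSurface a).dom i) (hz' : z.swap ∈ (hvSurface a).dom j) :
    HasLift Prod.swap ((hvSurface a).par i z) :=
  .of_charts hi hz (fun w => w.2) (fun w => w.1) (regFunAt_snd z) (regFunAt_fst z) hz'
    (.of_forall fun w => onGraph_swap (h w))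

theorem par_swap {i j : Fin 2} {u v u' v' : ℂ} (h : u' = v) (h' : v' = u) :
    P1xP1.par (j, i) (u', v') = (P1xP1.par (i, j) (u, v)).swap := by
  rw [h, h']
  rfl

/-! The exceptional curves over `(∞, ∞)` are preserved by the transposition. Below, `u` and `v` are
the coordinates of the chart, and `A` is the quotient `x/y`, as a function of them. -/

variable {u v A M : ℂ}

theorem swap_e10_zero (hA : A = 1 + u * v) (h0 : A ≠ 0) :
    hvProj a ((hvSurface a).par (e10 a 0) (u * A, -v / A ^ 2)) =
      (hvProj a ((hvSurface a).par (e10 a 0) (u, v))).swap := by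
  rw [proj_e10_zero, proj_e10_zero]
  refine par_swap (by rw [hA]) ?_
  field_simp
  linear_combination u * hA

theorem swap_e10_one (hA : A = 1 + v) (h0 : A ≠ 0) :
    hvProj a ((hvSurface a).par (e10 a 1) (-u * A ^ 2, -v / A)) =
      (hvProj a ((hvSurface a).par (e10 a 1) (u, v))).swap := by
  rw [proj_e10_one, proj_e10_one]
  refine par_swap ?_ ?_
  · rw [← hA]
    field_simp
  · field_simp
    linear_combination u * v * hA

theorem swap_e11_zero (hA : A = 1 + u ^ 2 * v) (h0 : A ≠ 0) :
    hvProj a ((hvSurface a).par (e11 a 0) (u * A, -v / A ^ 3)) =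
      (hvProj a ((hvSurface a).par (e11 a 0) (u, v))).swap := by
  rw [proj_e11_zero, proj_e11_zero]
  refine par_swap (by rw [hA]) ?_
  field_simp
  linear_combination u * hA

theorem swap_e11_one (hA : A = 1 + u * v ^ 2) (h0 : A ≠ 0) :
    hvProj a ((hvSurface a).par (e11 a 1) (-A ^ 3 * u, -v / A ^ 2)) =
      (hvProj a ((hvSurface a).par (e11 a 1) (u, v))).swap := by
  rw [proj_e11_one, proj_e11_one]
  refine par_swap ?_ ?_
  · rw [← hA]
    field_simp
  · field_simp
    linear_combination u * v * hA

theorem swap_e12_zero (hA : A = 1 + u ^ 3 * v ^ 2) (h0 : A ≠ 0) :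
    hvProj a ((hvSurface a).par (e12 a 0) (-A ^ 3 * u, v / A ^ 5)) =
      (hvProj a ((hvSurface a).par (e12 a 0) (u, v))).swap := by
  rw [proj_e12_zero, proj_e12_zero, ← swap_e11_one (A := A) (by rw [hA]; ring) h0]
  congr 3
  field_simp

theorem swap_e12_one (hA : A = 1 + u * v ^ 3) (h0 : A ≠ 0) :
    hvProj a ((hvSurface a).par (e12 a 1) (A ^ 5 * u, -v / A ^ 2)) =
      (hvProj a ((hvSurface a).par (e12 a 1) (u, v))).swap := by
  rw [proj_e12_one, proj_e12_one, ← swap_e11_one (A := A) (by rw [hA]; ring) h0]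
  congr 3
  field_simp

theorem swap_e13_zero (hM : M = a + u * v) (hA : A = 1 + u ^ 3 * M ^ 2) (h0 : A ≠ 0) :
    hvProj a ((hvSurface a).par (e13 a 0) (-A ^ 3 * u,
        -(v - a * u ^ 2 * M ^ 2 * (1 + A + A ^ 2 + A ^ 3 + A ^ 4)) / A ^ 8)) =
      (hvProj a ((hvSurface a).par (e13 a 0) (u, v))).swap := by
  rw [proj_e13_zero, proj_e13_zero, ← hM, ← swap_e12_zero hA h0]
  congr 3
  field_simp
  linear_combination -hM + a * (1 + A + A ^ 2 + A ^ 3 + A ^ 4) * hA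

theorem swap_e13_one {G : ℂ} (hM : M = a + v) (hA : A = 1 + u ^ 3 * v ^ 3 * M ^ 2) (h0 : A ≠ 0)
    (hG : G = 1 - a * u ^ 3 * v ^ 2 * M ^ 2 * (1 + A + A ^ 2 + A ^ 3 + A ^ 4)) (hG0 : G ≠ 0) :
    hvProj a ((hvSurface a).par (e13 a 1) (-u * A ^ 8 / G, v * G / A ^ 5)) =
      (hvProj a ((hvSurface a).par (e13 a 1) (u, v))).swap := by
  rw [proj_e13_one, proj_e13_one, ← hM, ← swap_e12_zero (by rw [hA]; ring) h0]
  congr 3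
  · field_simp
  · field_simp
    linear_combination v * hG - hM + a * (1 + A + A ^ 2 + A ^ 3 + A ^ 4) * hA

theorem swap_e14_zero (hM : M = a + u ^ 2 * v) (hA : A = 1 + u ^ 3 * M ^ 2) (h0 : A ≠ 0) :
    hvProj a ((hvSurface a).par (e14 a 0) (-A ^ 3 * u,
        (v - a * u * M ^ 2 * (1 + A + A ^ 2 + A ^ 3 + A ^ 4)) / A ^ 11)) =
      (hvProj a ((hvSurface a).par (e14 a 0) (u, v))).swap := by
  rw [proj_e14_zero, proj_e14_zero, show a + u * (u * v) = M by rw [hM]; ring,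
    ← swap_e12_zero hA h0]
  congr 3
  field_simp
  linear_combination -hM + a * (1 + A + A ^ 2 + A ^ 3 + A ^ 4) * hA

theorem swap_e14_one {G : ℂ} (hM : M = a + u * v ^ 2) (hA : A = 1 + u ^ 3 * v ^ 3 * M ^ 2)
    (h0 : A ≠ 0) (hG : G = 1 - a * u ^ 2 * v * M ^ 2 * (1 + A + A ^ 2 + A ^ 3 + A ^ 4))
    (hG0 : G ≠ 0) :
    hvProj a ((hvSurface a).par (e14 a 1) (u * A ^ 11 / G, -v * G / A ^ 8)) =
      (hvProj a ((hvSurface a).par (e14 a 1) (u, v))).swap := by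
  rw [proj_e14_one, proj_e14_one, show a + u * v * v = M by rw [hM]; ring,
    ← swap_e12_zero (by rw [hA]; ring) h0]
  congr 3
  · field_simp
  · field_simp
    linear_combination u * v ^ 2 * hG - hM + a * (1 + A + A ^ 2 + A ^ 3 + A ^ 4) * hA

end Swap

/-! ### The lift of `(x, y) ↦ (y, x)` -/

section SwapLift

variable {a : ℂ}

theorem hasLift_swap_e10_zero {m : ℂ} (hm : m ≠ 0) :
    HasLift Prod.swap ((hvSurface a).par (e10 a 0) (0, m)) := by
  obtain ⟨A, hA, rA⟩ := exists_eq_regFun (fun w => 1 + w.1 * w.2) (by fun_prop)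
  have A0 : A (0, m) = 1 := by simp [hA]
  refine .of_charts (isGenericallyFinite_e10 0) (mem_e10_zero (by simpa using hm))
    (fun w => w.1 * A w) (fun w => -w.2 / A w ^ 2) (by fun_prop) (by fun_prop (disch := simp [A0]))
    (mem_e10_zero (by simpa [A0] using hm)) ?_
  refine (rA _).eventually_onGraph (by simp [A0]) fun w hw => onGraph_swap ?_
  exact swap_e10_zero (by rw [hA]) hw

theorem hasLift_swap_e10_one : HasLift Prod.swap ((hvSurface a).par (e10 a 1) (0, 0)) := by
  obtain ⟨A, hA, rA⟩ := exists_eq_regFun (fun w => 1 + w.2) (by fun_prop)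
  have A0 : A (0, 0) = 1 := by simp [hA]
  refine .of_charts (isGenericallyFinite_e10 1) (mem_e10_one (by simp))
    (fun w => -w.1 * A w ^ 2) (fun w => -w.2 / A w) (by fun_prop) (by fun_prop (disch := simp [A0]))
    (mem_e10_one (by simp)) ?_
  refine (rA _).eventually_onGraph (by simp [A0]) fun w hw => onGraph_swap ?_
  exact swap_e10_one (by rw [hA]) hw

theorem hasLift_swap_e11_zero (m : ℂ) :
    HasLift Prod.swap ((hvSurface a).par (e11 a 0) (0, m)) := by
  obtain ⟨A, hA, rA⟩ := exists_eq_regFun (fun w => 1 + w.1 ^ 2 * w.2) (by fun_prop)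
  have A0 : A (0, m) = 1 := by simp [hA]
  refine .of_charts (isGenericallyFinite_e11 0) (mem_e11_zero (by simp))
    (fun w => w.1 * A w) (fun w => -w.2 / A w ^ 3) (by fun_prop) (by fun_prop (disch := simp [A0]))
    (mem_e11_zero (by simp)) ?_
  refine (rA _).eventually_onGraph (by simp [A0]) fun w hw => onGraph_swap ?_
  exact swap_e11_zero (by rw [hA]) hw

theorem hasLift_swap_e12_zero {m : ℂ} (hm : m ≠ a) :
    HasLift Prod.swap ((hvSurface a).par (e12 a 0) (0, m)) := by
  obtain ⟨A, hA, rA⟩ := exists_eq_regFun (fun w => 1 + w.1 ^ 3 * w.2 ^ 2) (by fun_prop)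
  have A0 : A (0, m) = 1 := by simp [hA]
  refine .of_charts (isGenericallyFinite_e12 0) (mem_e12_zero (by simpa using hm))
    (fun w => -A w ^ 3 * w.1) (fun w => w.2 / A w ^ 5) (by fun_prop)
    (by fun_prop (disch := simp [A0])) (mem_e12_zero (by simpa [A0] using hm)) ?_
  refine (rA _).eventually_onGraph (by simp [A0]) fun w hw => onGraph_swap ?_
  exact swap_e12_zero (by rw [hA]) hw

theorem hasLift_swap_e12_one : HasLift Prod.swap ((hvSurface a).par (e12 a 1) (0, 0)) := by
  obtain ⟨A, hA, rA⟩ := exists_eq_regFun (fun w => 1 + w.1 * w.2 ^ 3) (by fun_prop)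
  have A0 : A (0, 0) = 1 := by simp [hA]
  refine .of_charts (isGenericallyFinite_e12 1) (mem_e12_one (by simp))
    (fun w => A w ^ 5 * w.1) (fun w => -w.2 / A w ^ 2) (by fun_prop)
    (by fun_prop (disch := simp [A0])) (mem_e12_one (by simp)) ?_
  refine (rA _).eventually_onGraph (by simp [A0]) fun w hw => onGraph_swap ?_
  exact swap_e12_one (by rw [hA]) hw

theorem hasLift_swap_e13_zero {m : ℂ} (hm : m ≠ 0) :
    HasLift Prod.swap ((hvSurface a).par (e13 a 0) (0, m)) := by
  obtain ⟨M, hM, rM⟩ := exists_eq_regFun (fun w => a + w.1 * w.2) (by fun_prop)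
  obtain ⟨A, hA, rA⟩ := exists_eq_regFun (fun w => 1 + w.1 ^ 3 * M w ^ 2) (by fun_prop)
  have A0 : A (0, m) = 1 := by simp [hA]
  refine .of_charts (isGenericallyFinite_e13 0) (mem_e13_zero (by simpa using hm))
    (fun w => -A w ^ 3 * w.1)
    (fun w => -(w.2 - a * w.1 ^ 2 * M w ^ 2 * (1 + A w + A w ^ 2 + A w ^ 3 + A w ^ 4)) / A w ^ 8)
    (by fun_prop) (by fun_prop (disch := simp [A0])) (mem_e13_zero (by simpa [A0] using hm)) ?_
  refine (rA _).eventually_onGraph (by simp [A0]) fun w hw => onGraph_swap ?_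
  exact swap_e13_zero (by rw [hM]) (by rw [hA]) hw

theorem hasLift_swap_e13_one : HasLift Prod.swap ((hvSurface a).par (e13 a 1) (0, 0)) := by
  obtain ⟨M, hM, rM⟩ := exists_eq_regFun (fun w => a + w.2) (by fun_prop)
  obtain ⟨A, hA, rA⟩ := exists_eq_regFun (fun w => 1 + w.1 ^ 3 * w.2 ^ 3 * M w ^ 2) (by fun_prop)
  obtain ⟨G, hG, rG⟩ := exists_eq_regFun
    (fun w => 1 - a * w.1 ^ 3 * w.2 ^ 2 * M w ^ 2 * (1 + A w + A w ^ 2 + A w ^ 3 + A w ^ 4))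
    (by fun_prop)
  have A0 : A (0, 0) = 1 := by simp [hA]
  have G0 : G (0, 0) = 1 := by simp [hG]
  refine .of_charts (isGenericallyFinite_e13 1) (mem_e13_one (by simp))
    (fun w => -w.1 * A w ^ 8 / G w) (fun w => w.2 * G w / A w ^ 5)
    (by fun_prop (disch := simp [G0])) (by fun_prop (disch := simp [A0]))
    (mem_e13_one (by simp)) ?_
  refine ((rA _).mul (rG _)).eventually_onGraph (by simp [A0, G0]) fun w hw => onGraph_swap ?_
  exact swap_e13_one (M := M w) (A := A w) (by rw [hM]) (by rw [hA])
    (left_ne_zero_of_mul hw) (by rw [hG]) (right_ne_zero_of_mul hw)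

theorem hasLift_swap_e14_zero (m : ℂ) :
    HasLift Prod.swap ((hvSurface a).par (e14 a 0) (0, m)) := by
  obtain ⟨M, hM, rM⟩ := exists_eq_regFun (fun w => a + w.1 ^ 2 * w.2) (by fun_prop)
  obtain ⟨A, hA, rA⟩ := exists_eq_regFun (fun w => 1 + w.1 ^ 3 * M w ^ 2) (by fun_prop)
  have A0 : A (0, m) = 1 := by simp [hA]
  refine .of_charts (isGenericallyFinite_e14 0) (mem_e14 0 _)
    (fun w => -A w ^ 3 * w.1)
    (fun w => (w.2 - a * w.1 * M w ^ 2 * (1 + A w + A w ^ 2 + A w ^ 3 + A w ^ 4)) / A w ^ 11)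
    (by fun_prop) (by fun_prop (disch := simp [A0])) (mem_e14 0 _) ?_
  refine (rA _).eventually_onGraph (by simp [A0]) fun w hw => onGraph_swap ?_
  exact swap_e14_zero (by rw [hM]) (by rw [hA]) hw

theorem hasLift_swap_e14_one : HasLift Prod.swap ((hvSurface a).par (e14 a 1) (0, 0)) := by
  obtain ⟨M, hM, rM⟩ := exists_eq_regFun (fun w => a + w.1 * w.2 ^ 2) (by fun_prop)
  obtain ⟨A, hA, rA⟩ := exists_eq_regFun (fun w => 1 + w.1 ^ 3 * w.2 ^ 3 * M w ^ 2) (by fun_prop)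
  obtain ⟨G, hG, rG⟩ := exists_eq_regFun
    (fun w => 1 - a * w.1 ^ 2 * w.2 * M w ^ 2 * (1 + A w + A w ^ 2 + A w ^ 3 + A w ^ 4))
    (by fun_prop)
  have A0 : A (0, 0) = 1 := by simp [hA]
  have G0 : G (0, 0) = 1 := by simp [hG]
  refine .of_charts (isGenericallyFinite_e14 1) (mem_e14 1 _)
    (fun w => w.1 * A w ^ 11 / G w) (fun w => -w.2 * G w / A w ^ 8)
    (by fun_prop (disch := simp [G0])) (by fun_prop (disch := simp [A0])) (mem_e14 1 _) ?_
  refine ((rA _).mul (rG _)).eventually_onGraph (by simp [A0, G0]) fun w hw => onGraph_swap ?_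
  exact swap_e14_one (M := M w) (A := A w) (by rw [hM]) (by rw [hA])
    (left_ne_zero_of_mul hw) (by rw [hG]) (right_ne_zero_of_mul hw)

theorem hasLift_swap : ∀ q : (hvSurface a).Pt, HasLift Prod.swap q := by
  refine forall_hvSurface ?_ ?_ ?_ ?_ ?_ ?_ ?_ ?_ ?_ ?_ ?_ ?_ (fun _ => hasLift_swap_e10_zero)
    hasLift_swap_e10_one hasLift_swap_e11_zero (fun _ => hasLift_swap_e12_zero)
    hasLift_swap_e12_one (fun _ => hasLift_swap_e13_zero) hasLift_swap_e13_one
    hasLift_swap_e14_zero hasLift_swap_e14_one ?_ ?_ ?_ ?_ ?_ ?_ ?_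
  · exact fun x y => (isSwap_base (0, 0)).hasLift (isGenericallyFinite_base _) (mem_base₀₀ _)
      (mem_base₀₀ _)
  · exact fun x hx => (isSwap_base (0, 1)).hasLift (isGenericallyFinite_base _)
      (mem_base₀₁ (by simpa using hx)) (mem_base₁₀ (by simpa using hx))
  · exact fun y hy => (isSwap_base (1, 0)).hasLift (isGenericallyFinite_base _)
      (mem_base₁₀ (by simpa using hy)) (mem_base₀₁ (by simpa using hy))
  · exact fun m hm => (isSwap_e5 zero_ne_one).hasLift (isGenericallyFinite_e5 0)
      (mem_e5_zero (by simpa using hm)) (mem_e1_one (by simpa using hm))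
  · exact (isSwap_e5 one_ne_zero).hasLift (isGenericallyFinite_e5 1)
      (mem_e5_one (by simp)) (mem_e1_zero (by simp))
  · exact (isSwap_e6 zero_ne_one).hasLift (isGenericallyFinite_e6 0)
      (mem_e6_zero (by simp)) (mem_e2_one (by simp))
  · exact fun n hn => (isSwap_e6 one_ne_zero).hasLift (isGenericallyFinite_e6 1)
      (mem_e6_one (by simpa using hn)) (mem_e2_zero (by simpa using hn))
  · exact fun m => (isSwap_e7 zero_ne_one).hasLift (isGenericallyFinite_e7 0)
      (mem_e7_zero (by simp)) (mem_e3_one (by simp))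
  · exact fun m => (isSwap_e8 zero_ne_one).hasLift (isGenericallyFinite_e8 0)
      (mem_e8 _ _) (mem_e4 _ _)
  · exact (isSwap_e8 one_ne_zero).hasLift (isGenericallyFinite_e8 1) (mem_e8 _ _) (mem_e4 _ _)
  · exact fun m hm => (isSwap_e9 zero_ne_one).hasLift (isGenericallyFinite_e9 0)
      (mem_e9_zero (by simpa using hm)) (mem_e9_one (by simpa using hm))
  · exact (isSwap_e9 one_ne_zero).hasLift (isGenericallyFinite_e9 1)
      (mem_e9_one (by simp)) (mem_e9_zero (by simp))
  · exact fun m => (isSwap_e5 one_ne_zero).symm.hasLift (isGenericallyFinite_e1 0)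
      (mem_e1_zero (by simp)) (mem_e5_one (by simp))
  · exact fun m hm => (isSwap_e6 one_ne_zero).symm.hasLift (isGenericallyFinite_e2 0)
      (mem_e2_zero (by simpa using hm)) (mem_e6_one (by simpa using hm))
  · exact (isSwap_e6 zero_ne_one).symm.hasLift (isGenericallyFinite_e2 1)
      (mem_e2_one (by simp)) (mem_e6_zero (by simp))
  · exact fun m hm => (isSwap_e7 one_ne_zero).symm.hasLift (isGenericallyFinite_e3 0)
      (mem_e3_zero (by simpa using hm)) (mem_e7_one (by simpa using hm))
  · exact (isSwap_e7 zero_ne_one).symm.hasLift (isGenericallyFinite_e3 1)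
      (mem_e3_one (by simp)) (mem_e7_zero (by simp))
  · exact fun m => (isSwap_e8 one_ne_zero).symm.hasLift (isGenericallyFinite_e4 0)
      (mem_e4 _ _) (mem_e8 _ _)
  · exact (isSwap_e8 zero_ne_one).symm.hasLift (isGenericallyFinite_e4 1)
      (mem_e4 _ _) (mem_e8 _ _)

theorem exists_lift_swap (a : ℂ) : ∃ S : (hvSurface a).Pt ≃ (hvSurface a).Pt,
    IsAutomorphism S ∧ S.symm = S ∧ IsLiftOf a S Set.univ Prod.swap :=
  exists_lift_involution (fun _ _ _ => trivial) (fun _ _ => trivial) (fun v _ => v.swap_swap)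
    (fun v _ => ⟨regFunAt_snd v, regFunAt_fst v⟩) hasLift_swap

end SwapLift

/-! ### The involution `(x, y) ↦ (-x + y + a/y², y)` in coordinates -/

/-- The involution `(x, y) ↦ (-x + y + a/y², y)`, as a map on `{y ≠ 0} ⊆ ℂ²`. -/
noncomputable def hvInvol (a : ℂ) (w : ℂ × ℂ) : ℂ × ℂ := (-w.1 + w.2 + a / w.2 ^ 2, w.2)

section Invol

variable {a X Y X' Y' : ℂ}

theorem OnGraph.of_eq {f : ℂ × ℂ → ℂ × ℂ} {p p' p'' : OnePoint ℂ × OnePoint ℂ}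
    (h : OnGraph f p p') (e : p'' = p') : OnGraph f p p'' := e ▸ h

/-! The equation of the graph, in the charts of `ℙ¹ × ℙ¹`; the indices name the chart of the source
and the chart of the target. -/

theorem onGraph_par {f : ℂ × ℂ → ℂ × ℂ} {i j i' j' : Fin 2} (h : ∀ v : ℂ × ℂ, v.1 ≠ 0 → v.2 ≠ 0 →
    chartP1 i X = v.1 → chartP1 j Y = v.2 → chartP1 i' X' = (f v).1 ∧ chartP1 j' Y' = (f v).2) :
    OnGraph f (P1xP1.par (i, j) (X, Y)) (P1xP1.par (i', j') (X', Y')) := fun v h1 h2 hv =>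
  par_eq_affPt.2 (h v h1 h2 (par_eq_affPt.1 hv).1 (par_eq_affPt.1 hv).2)

theorem onGraph_invol₀₁₁₁ (h : X' * (1 - X * Y + a * Y ^ 3) = Y) (hY : Y' = Y) :
    OnGraph (hvInvol a) (P1xP1.par (0, 1) (X, Y)) (P1xP1.par (1, 1) (X', Y')) := by
  subst hY
  refine onGraph_par fun v _ h2 hX hY => ⟨chartP1_one_eq_coe.2 ?_, hY⟩
  obtain rfl := chartP1_zero_eq_coe.1 hX
  obtain rfl := eq_inv_of_mul_eq_one_left (chartP1_one_eq_coe.1 hY)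
  simp only [hvInvol]
  field_simp at h ⊢
  linear_combination h

theorem onGraph_invol₁₁₀₁ (h : X * Y * X' = -Y + X + a * X * Y ^ 3) (hY : Y' = Y) :
    OnGraph (hvInvol a) (P1xP1.par (1, 1) (X, Y)) (P1xP1.par (0, 1) (X', Y')) := by
  subst hY
  refine onGraph_par fun v h1 h2 hX hY => ⟨chartP1_zero_eq_coe.2 ?_, hY⟩
  obtain rfl := eq_inv_of_mul_eq_one_left (chartP1_one_eq_coe.1 hX)
  obtain rfl := eq_inv_of_mul_eq_one_left (chartP1_one_eq_coe.1 hY)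
  simp only [hvInvol]
  field_simp at h ⊢
  linear_combination h

theorem onGraph_invol₁₁₁₁ (h : X' * (-Y + X + a * X * Y ^ 3) = X * Y) (hY : Y' = Y) :
    OnGraph (hvInvol a) (P1xP1.par (1, 1) (X, Y)) (P1xP1.par (1, 1) (X', Y')) := by
  subst hY
  refine onGraph_par fun v h1 h2 hX hY => ⟨chartP1_one_eq_coe.2 ?_, hY⟩
  obtain rfl := eq_inv_of_mul_eq_one_left (chartP1_one_eq_coe.1 hX)
  obtain rfl := eq_inv_of_mul_eq_one_left (chartP1_one_eq_coe.1 hY)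
  simp only [hvInvol]
  field_simp at h ⊢
  linear_combination h

theorem onGraph_invol₁₀₁₀ (h : X' * (-Y ^ 2 + X * Y ^ 3 + a * X) = X * Y ^ 2) (hY : Y' = Y) :
    OnGraph (hvInvol a) (P1xP1.par (1, 0) (X, Y)) (P1xP1.par (1, 0) (X', Y')) := by
  subst hY
  refine onGraph_par fun v h1 h2 hX hY => ⟨chartP1_one_eq_coe.2 ?_, hY⟩
  obtain rfl := eq_inv_of_mul_eq_one_left (chartP1_one_eq_coe.1 hX)
  obtain rfl := chartP1_zero_eq_coe.1 hY
  simp only [hvInvol]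
  field_simp at h ⊢
  linear_combination h

theorem onGraph_invol₁₀₀₀ (h : X * Y ^ 2 * X' = -Y ^ 2 + X * Y ^ 3 + a * X) (hY : Y' = Y) :
    OnGraph (hvInvol a) (P1xP1.par (1, 0) (X, Y)) (P1xP1.par (0, 0) (X', Y')) := by
  subst hY
  refine onGraph_par fun v h1 h2 hX hY => ⟨chartP1_zero_eq_coe.2 ?_, hY⟩
  obtain rfl := eq_inv_of_mul_eq_one_left (chartP1_one_eq_coe.1 hX)
  obtain rfl := chartP1_zero_eq_coe.1 hY
  simp only [hvInvol]
  field_simp at h ⊢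
  linear_combination h

theorem onGraph_invol₀₀₁₀ (h : X' * (-X * Y ^ 2 + Y ^ 3 + a) = Y ^ 2) (hY : Y' = Y) :
    OnGraph (hvInvol a) (P1xP1.par (0, 0) (X, Y)) (P1xP1.par (1, 0) (X', Y')) := by
  subst hY
  refine onGraph_par fun v h1 h2 hX hY => ⟨chartP1_one_eq_coe.2 ?_, hY⟩
  obtain rfl := chartP1_zero_eq_coe.1 hX
  obtain rfl := chartP1_zero_eq_coe.1 hY
  simp only [hvInvol]
  field_simp at h ⊢
  linear_combination h

/-! The equations in the charts of the surface, with coordinates `u`, `v`. Here `A`, `B`, `C`, `D`,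
… abbreviate the functions of `u` and `v` that have to be inverted. -/

variable {u v A B C D K L M n t s : ℂ}

/-- The map from the neighbourhood of `E₅` to that of `E₁₁`. Its restrictions to the charts of the
blow-ups that follow `E₅` give the maps from `E₆`, `E₇`, `E₈` to `E₁₂`, `E₁₃`, `E₁₄`. -/
theorem onGraph_invol_e5_zero (hC : C = 1 - a * u * v ^ 2) (hB : B = 1 - u ^ 2 * v * C)
    (hC0 : C ≠ 0) (hB0 : B ≠ 0) :
    OnGraph (hvInvol a) (hvProj a ((hvSurface a).par (e5 a 0) (u, v)))
      (hvProj a ((hvSurface a).par (e11 a 1) (-v / (B ^ 2 * C), -u * B * C))) := by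
  rw [proj_e5_zero, proj_e11_one]
  refine onGraph_invol₀₁₁₁ ?_ ?_
  · field_simp
    linear_combination -u * v * hB + u ^ 3 * v ^ 2 * hC
  · field_simp
    linear_combination -u * v * hB

theorem onGraph_invol_e5_one (hB : B = 1 - u * v ^ 2 + a * v ^ 3) (hB0 : B ≠ 0) :
    OnGraph (hvInvol a) (hvProj a ((hvSurface a).par (e5 a 1) (u, v)))
      (hvProj a ((hvSurface a).par (e11 a 0) (v / B, B ^ 2 * (a * v - u)))) := by
  rw [proj_e5_one, proj_e11_zero]
  refine onGraph_invol₀₁₁₁ ?_ ?_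
  · field_simp
    linear_combination -v * hB
  · field_simp
    linear_combination -v * hB

theorem onGraph_invol_base₀₁ (hB : B = 1 - u * v + a * v ^ 3) (hB0 : B ≠ 0) :
    OnGraph (hvInvol a) (hvProj a ((hvSurface a).par (base a (0, 1)) (u, v)))
      (hvProj a ((hvSurface a).par (e10 a 0) (v / B, B * (a * v ^ 2 - u)))) := by
  rw [hvProj_base, proj_e10_zero]
  refine onGraph_invol₀₁₁₁ ?_ ?_
  · field_simp
    linear_combination -v * hB
  · field_simp
    linear_combination -v * hB

theorem onGraph_invol_e6_zero (hC : C = 1 - a * u ^ 3 * v ^ 2) (hB : B = 1 - u ^ 3 * v * C)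
    (hC0 : C ≠ 0) (hB0 : B ≠ 0) :
    OnGraph (hvInvol a) (hvProj a ((hvSurface a).par (e6 a 0) (u, v)))
      (hvProj a ((hvSurface a).par (e12 a 1) (v / (B ^ 3 * C ^ 2), -u * B * C))) := by
  rw [proj_e6_zero, proj_e12_one]
  refine (onGraph_invol_e5_zero (B := B) (by rw [hC]; ring) (by rw [hB]; ring) hC0 hB0).of_eq ?_
  congr 3
  field_simp

theorem onGraph_invol_e6_one (hC : C = 1 - a * u * v ^ 3) (hB : B = 1 - u ^ 2 * v ^ 3 * C)
    (hC0 : C ≠ 0) (hB0 : B ≠ 0) :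
    OnGraph (hvInvol a) (hvProj a ((hvSurface a).par (e6 a 1) (u, v)))
      (hvProj a ((hvSurface a).par (e12 a 0) (-v / (B ^ 2 * C), u * B ^ 3 * C ^ 2))) := by
  rw [proj_e6_one, proj_e12_zero]
  refine (onGraph_invol_e5_zero (B := B) (by rw [hC]; ring) (by rw [hB]; ring) hC0 hB0).of_eq ?_
  congr 3
  field_simp

/-- The expansion of the second coordinate of the image in `onGraph_invol_e6_one` around its value
`a`. -/
theorem e6_coordinate_sub (hC : C = 1 - a * n * t ^ 3) (hB : B = 1 - n ^ 2 * t ^ 3 * C)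
    (hK : K = n * C ^ 3 * (1 + B + B ^ 2) + a * (1 + C)) :
    n * B ^ 3 * C ^ 2 - a = (n - a) * B ^ 3 * C ^ 2 - a * n * t ^ 3 * K := by
  linear_combination a * (1 + C) * hC + a * C ^ 2 * (1 + B + B ^ 2) * hB + a * n * t ^ 3 * hK

theorem onGraph_invol_e7_zero {G : ℂ} (hn : n = a + u) (ht : t = u * v)
    (hC : C = 1 - a * n * t ^ 3) (hB : B = 1 - n ^ 2 * t ^ 3 * C)
    (hK : K = n * C ^ 3 * (1 + B + B ^ 2) + a * (1 + C))
    (hG : G = B ^ 3 * C ^ 2 - a * n * u ^ 2 * v ^ 3 * K) (hC0 : C ≠ 0) (hB0 : B ≠ 0)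
    (hG0 : G ≠ 0) :
    OnGraph (hvInvol a) (hvProj a ((hvSurface a).par (e7 a 0) (u, v)))
      (hvProj a ((hvSurface a).par (e13 a 1) (-v / (B ^ 2 * C * G), u * G))) := by
  rw [proj_e7_zero, proj_e13_one, ← hn, ← ht]
  refine (onGraph_invol_e6_one hC hB hC0 hB0).of_eq ?_
  have h := e6_coordinate_sub hC hB hK
  congr 3
  · rw [ht]
    field_simp
  · rw [hG]
    rw [ht] at h
    linear_combination -h - B ^ 3 * C ^ 2 * hn

theorem onGraph_invol_e8_zero {G : ℂ} (hn : n = a + u ^ 2 * v) (ht : t = u * v)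
    (hC : C = 1 - a * n * t ^ 3) (hB : B = 1 - n ^ 2 * t ^ 3 * C)
    (hK : K = n * C ^ 3 * (1 + B + B ^ 2) + a * (1 + C))
    (hG : G = B ^ 3 * C ^ 2 - a * n * u * v ^ 2 * K) (hC0 : C ≠ 0) (hB0 : B ≠ 0)
    (hG0 : G ≠ 0) :
    OnGraph (hvInvol a) (hvProj a ((hvSurface a).par (e8 a 0) (u, v)))
      (hvProj a ((hvSurface a).par (e14 a 1)
        (v / (G * B ^ 4 * C ^ 2), -u * G * B ^ 2 * C))) := by
  rw [proj_e8_zero, proj_e14_one, show a + u * (u * v) = n by rw [hn]; ring, ← ht]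
  refine (onGraph_invol_e6_one hC hB hC0 hB0).of_eq ?_
  have h := e6_coordinate_sub hC hB hK
  congr 3
  · rw [ht]
    field_simp
  · field_simp
    rw [hG]
    rw [ht] at h
    linear_combination -h - B ^ 3 * C ^ 2 * hn

theorem onGraph_invol_e8_one (hn : n = a + u * v ^ 2)
    (hC : C = 1 - a * n * v ^ 3) (hB : B = 1 - n ^ 2 * v ^ 3 * C)
    (hK : K = n * C ^ 3 * (1 + B + B ^ 2) + a * (1 + C)) (hC0 : C ≠ 0) (hB0 : B ≠ 0) :
    OnGraph (hvInvol a) (hvProj a ((hvSurface a).par (e8 a 1) (u, v)))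
      (hvProj a ((hvSurface a).par (e14 a 0)
        (-v / (B ^ 2 * C), (u * B ^ 3 * C ^ 2 - a * n * v * K) * B ^ 4 * C ^ 2))) := by
  rw [proj_e8_one, proj_e14_zero, show a + u * v * v = n by rw [hn]; ring]
  refine (onGraph_invol_e6_one hC hB hC0 hB0).of_eq ?_
  have h := e6_coordinate_sub hC hB hK
  congr 3
  field_simp
  linear_combination -h - B ^ 3 * C ^ 2 * hn

theorem onGraph_invol_e9_zero {N : ℂ} (hN : N = 1 - v + a * u ^ 3 * v ^ 3) (hN0 : N ≠ 0)
    (hD : D = a * u ^ 3 * v ^ 2 - 1) (hD0 : D ≠ 0) :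
    OnGraph (hvInvol a) (hvProj a ((hvSurface a).par (e9 a 0) (u, v)))
      (hvProj a ((hvSurface a).par (e10 a 1) (u / (N * D), v * D))) := by
  rw [proj_e9_zero, proj_e10_one]
  refine onGraph_invol₁₁₁₁ ?_ ?_
  · field_simp
    linear_combination -u ^ 2 * v * hN
  · field_simp
    linear_combination -u * v * hN + u * v ^ 2 * hD

theorem onGraph_invol_e9_one {N : ℂ} (hN : N = u - 1 + a * u * v ^ 3) (hN0 : N ≠ 0) :
    OnGraph (hvInvol a) (hvProj a ((hvSurface a).par (e9 a 1) (u, v)))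
      (hvProj a ((hvSurface a).par (e9 a 1) (u / N, v))) := by
  rw [proj_e9_one, proj_e9_one]
  refine onGraph_invol₁₁₁₁ ?_ rfl
  field_simp
  linear_combination -u * v ^ 2 * hN

theorem onGraph_invol_e10_zero (hA : A = 1 + u * v) (hA0 : A ≠ 0) :
    OnGraph (hvInvol a) (hvProj a ((hvSurface a).par (e10 a 0) (u, v)))
      (hvProj a ((hvSurface a).par (base a (0, 1)) (-v / A + a * u ^ 2 * A ^ 2, u * A))) := by
  rw [proj_e10_zero, hvProj_base, ← hA]
  refine onGraph_invol₁₁₀₁ ?_ rfl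
  field_simp
  linear_combination u * hA

theorem onGraph_invol_e10_one (hA : A = 1 + v) (hD : D = 1 - a * u ^ 3 * v ^ 2 * A ^ 3)
    (hD0 : D ≠ 0) :
    OnGraph (hvInvol a) (hvProj a ((hvSurface a).par (e10 a 1) (u, v)))
      (hvProj a ((hvSurface a).par (e9 a 0) (-u * A / D, -v * D))) := by
  rw [proj_e10_one, proj_e9_zero, ← hA]
  refine onGraph_invol₁₁₁₁ ?_ ?_
  · field_simp
    linear_combination u ^ 2 * A * v * hA - u ^ 2 * A * v ^ 2 * hD
  · field_simp

theorem onGraph_invol_e11_zero (hA : A = 1 + u ^ 2 * v) (hA0 : A ≠ 0) :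
    OnGraph (hvInvol a) (hvProj a ((hvSurface a).par (e11 a 0) (u, v)))
      (hvProj a ((hvSurface a).par (e5 a 1) (-v / A ^ 2 + a * u * A, u * A))) := by
  rw [proj_e11_zero, proj_e5_one, ← hA]
  refine onGraph_invol₁₁₀₁ ?_ rfl
  field_simp
  linear_combination u * hA

/-- The map from the neighbourhood of `E₁₁` to that of `E₅`. Its restrictions to the charts of the
blow-ups that follow `E₁₁` give the maps from `E₁₂`, `E₁₃`, `E₁₄` to `E₆`, `E₇`, `E₈`. -/
theorem onGraph_invol_e11_one (hA : A = 1 + u * v ^ 2) (hD : D = 1 - a * u ^ 2 * v * A ^ 3)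
    (hA0 : A ≠ 0) (hD0 : D ≠ 0) :
    OnGraph (hvInvol a) (hvProj a ((hvSurface a).par (e11 a 1) (u, v)))
      (hvProj a ((hvSurface a).par (e5 a 0) (-v * D / A, -u * A ^ 2 / D))) := by
  rw [proj_e11_one, proj_e5_zero, ← hA]
  refine onGraph_invol₁₁₀₁ ?_ ?_
  · field_simp
    linear_combination u * v * hA - u ^ 2 * v ^ 3 * hD
  · field_simp

theorem onGraph_invol_e12_zero (hA : A = 1 + u ^ 3 * v ^ 2) (hD : D = 1 - a * u ^ 3 * v * A ^ 3)
    (hA0 : A ≠ 0) (hD0 : D ≠ 0) :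
    OnGraph (hvInvol a) (hvProj a ((hvSurface a).par (e12 a 0) (u, v)))
      (hvProj a ((hvSurface a).par (e6 a 1) (v * D ^ 2 / A ^ 3, -u * A ^ 2 / D))) := by
  rw [proj_e12_zero, proj_e6_one]
  refine (onGraph_invol_e11_one (D := D) (A := A) (by rw [hA]; ring) (by rw [hD]; ring)
    hA0 hD0).of_eq ?_
  congr 3
  field_simp

theorem onGraph_invol_e12_one (hA : A = 1 + u * v ^ 3) (hD : D = 1 - a * u ^ 2 * v ^ 3 * A ^ 3)
    (hA0 : A ≠ 0) (hD0 : D ≠ 0) :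
    OnGraph (hvInvol a) (hvProj a ((hvSurface a).par (e12 a 1) (u, v)))
      (hvProj a ((hvSurface a).par (e6 a 0) (-v * D / A, u * A ^ 3 / D ^ 2))) := by
  rw [proj_e12_one, proj_e6_zero]
  refine (onGraph_invol_e11_one (D := D) (A := A) (by rw [hA]; ring) (by rw [hD]; ring)
    hA0 hD0).of_eq ?_
  congr 3
  field_simp

/-- The expansion of the first coordinate of the image in `onGraph_invol_e12_zero`, multiplied by
`A ^ 3`, around the value `a` of that coordinate. -/
theorem e12_coordinate_sub (hA : A = 1 + s ^ 3 * M ^ 2) (hD : D = 1 - a * s ^ 3 * M * A ^ 3)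
    (hL : L = a * A ^ 3 * (1 + D) + M * (1 + A + A ^ 2)) :
    M * D ^ 2 - a * A ^ 3 = (M - a) * D ^ 2 - a * s ^ 3 * M * L := by
  linear_combination a * (1 + D) * hD - a * (1 + A + A ^ 2) * hA + a * s ^ 3 * M * hL

theorem onGraph_invol_e13_zero (hM : M = a + u * v) (hA : A = 1 + u ^ 3 * M ^ 2)
    (hD : D = 1 - a * u ^ 3 * M * A ^ 3)
    (hL : L = a * A ^ 3 * (1 + D) + M * (1 + A + A ^ 2)) (hA0 : A ≠ 0) (hD0 : D ≠ 0) :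
    OnGraph (hvInvol a) (hvProj a ((hvSurface a).par (e13 a 0) (u, v)))
      (hvProj a ((hvSurface a).par (e7 a 1)
        (-(v * D ^ 2 - a * u ^ 2 * M * L) * D / A ^ 5, -u * A ^ 2 / D))) := by
  rw [proj_e13_zero, proj_e7_one, ← hM]
  refine (onGraph_invol_e12_zero hA hD hA0 hD0).of_eq ?_
  have h := e12_coordinate_sub hA hD hL
  congr 3
  field_simp
  linear_combination -h - D ^ 2 * hM

theorem onGraph_invol_e13_one {G : ℂ} (hs : s = u * v) (hM : M = a + v)
    (hA : A = 1 + s ^ 3 * M ^ 2) (hD : D = 1 - a * s ^ 3 * M * A ^ 3)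
    (hL : L = a * A ^ 3 * (1 + D) + M * (1 + A + A ^ 2))
    (hG : G = D ^ 2 - a * u ^ 3 * v ^ 2 * M * L) (hA0 : A ≠ 0) (hD0 : D ≠ 0) (hG0 : G ≠ 0) :
    OnGraph (hvInvol a) (hvProj a ((hvSurface a).par (e13 a 1) (u, v)))
      (hvProj a ((hvSurface a).par (e7 a 0) (v * G / A ^ 3, -u * A ^ 5 / (D * G)))) := by
  rw [proj_e13_one, proj_e7_zero, ← hM, ← hs]
  refine (onGraph_invol_e12_zero hA hD hA0 hD0).of_eq ?_
  have h := e12_coordinate_sub hA hD hL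
  rw [hs] at h ⊢
  congr 3
  · field_simp
    rw [hG]
    linear_combination -h - D ^ 2 * hM
  · field_simp

theorem onGraph_invol_e14_zero (hM : M = a + u ^ 2 * v) (hA : A = 1 + u ^ 3 * M ^ 2)
    (hD : D = 1 - a * u ^ 3 * M * A ^ 3)
    (hL : L = a * A ^ 3 * (1 + D) + M * (1 + A + A ^ 2)) (hA0 : A ≠ 0) (hD0 : D ≠ 0) :
    OnGraph (hvInvol a) (hvProj a ((hvSurface a).par (e14 a 0) (u, v)))
      (hvProj a ((hvSurface a).par (e8 a 1)
        ((v * D ^ 2 - a * u * M * L) * D ^ 2 / A ^ 7, -u * A ^ 2 / D))) := by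
  rw [proj_e14_zero, proj_e8_one, show a + u * (u * v) = M by rw [hM]; ring]
  refine (onGraph_invol_e12_zero hA hD hA0 hD0).of_eq ?_
  have h := e12_coordinate_sub hA hD hL
  congr 3
  field_simp
  linear_combination -h - D ^ 2 * hM

theorem onGraph_invol_e14_one {G : ℂ} (hs : s = u * v) (hM : M = a + u * v ^ 2)
    (hA : A = 1 + s ^ 3 * M ^ 2) (hD : D = 1 - a * s ^ 3 * M * A ^ 3)
    (hL : L = a * A ^ 3 * (1 + D) + M * (1 + A + A ^ 2))
    (hG : G = D ^ 2 - a * u ^ 2 * v * M * L) (hA0 : A ≠ 0) (hD0 : D ≠ 0) (hG0 : G ≠ 0) :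
    OnGraph (hvInvol a) (hvProj a ((hvSurface a).par (e14 a 1) (u, v)))
      (hvProj a ((hvSurface a).par (e8 a 0)
        (-v * G * D / A ^ 5, u * A ^ 7 / (G * D ^ 2)))) := by
  rw [proj_e14_one, proj_e8_zero, show a + u * v * v = M by rw [hM]; ring, ← hs]
  refine (onGraph_invol_e12_zero hA hD hA0 hD0).of_eq ?_
  have h := e12_coordinate_sub hA hD hL
  rw [hs] at h ⊢
  congr 3
  · field_simp
    rw [hG]
    linear_combination -h - D ^ 2 * hM
  · field_simp

theorem onGraph_invol_base₁₀ (hD : D = -v ^ 2 + u * v ^ 3 + a * u) (hD0 : D ≠ 0) :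
    OnGraph (hvInvol a) (hvProj a ((hvSurface a).par (base a (1, 0)) (u, v)))
      (hvProj a ((hvSurface a).par (base a (1, 0)) (u * v ^ 2 / D, v))) := by
  rw [hvProj_base, hvProj_base]
  refine onGraph_invol₁₀₁₀ ?_ rfl
  field_simp
  linear_combination -u * v ^ 2 * hD

theorem onGraph_invol_e1_zero (hD : D = u ^ 2 * v - 1) (hA : A = a + u * v ^ 2 * D)
    (hA0 : A ≠ 0) (hD0 : D ≠ 0) :
    OnGraph (hvInvol a) (hvProj a ((hvSurface a).par (e1 a 0) (u, v)))
      (hvProj a ((hvSurface a).par (e4 a 1) (u / (D * A ^ 2), v * D * A))) := by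
  have h : a + u / (D * A ^ 2) * (v * D * A) * (v * D * A) = A := by
    field_simp
    linear_combination -hA
  rw [proj_e1_zero, proj_e4_one, h, proj_e2_zero]
  refine onGraph_invol₁₀₁₀ ?_ ?_
  · field_simp
    linear_combination -u ^ 3 * v ^ 2 * hA - u ^ 4 * v ^ 4 * hD
  · field_simp

theorem onGraph_invol_e2_zero (hD : D = u ^ 3 * v ^ 2 - 1) (hA : A = a + v * D)
    (hA0 : A ≠ 0) (hD0 : D ≠ 0) :
    OnGraph (hvInvol a) (hvProj a ((hvSurface a).par (e2 a 0) (u, v)))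
      (hvProj a ((hvSurface a).par (e3 a 1) (u / (A * D), v * D))) := by
  rw [proj_e3_one, ← hA, proj_e2_zero, proj_e2_zero]
  refine onGraph_invol₁₀₁₀ ?_ ?_
  · field_simp
    linear_combination -u ^ 4 * v ^ 3 * hA - u ^ 4 * v ^ 4 * hD
  · field_simp

theorem onGraph_invol_e2_one (hD : D = a * u - 1 + u * v ^ 3) (hD0 : D ≠ 0) :
    OnGraph (hvInvol a) (hvProj a ((hvSurface a).par (e2 a 1) (u, v)))
      (hvProj a ((hvSurface a).par (e2 a 1) (u / D, v))) := by
  rw [proj_e2_one, proj_e2_one]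
  refine onGraph_invol₁₀₁₀ ?_ rfl
  field_simp
  linear_combination -u * v ^ 4 * hD

theorem onGraph_invol_e3_zero (hM : M = a + u * v) (hD : D = u ^ 2 * M ^ 3 - v)
    (hM0 : M ≠ 0) (hD0 : D ≠ 0) :
    OnGraph (hvInvol a) (hvProj a ((hvSurface a).par (e3 a 0) (u, v)))
      (hvProj a ((hvSurface a).par (e1 a 0) (u * M ^ 2 / D, D / M))) := by
  rw [proj_e3_zero, ← hM, proj_e2_zero, proj_e1_zero]
  refine onGraph_invol₁₀₁₀ ?_ ?_
  · field_simp
    linear_combination -u ^ 3 * hM - u ^ 4 * hD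
  · field_simp

theorem onGraph_invol_e3_one (hM : M = a + v) (hD : D = 1 - u ^ 3 * v ^ 2 * M ^ 3)
    (hD0 : D ≠ 0) :
    OnGraph (hvInvol a) (hvProj a ((hvSurface a).par (e3 a 1) (u, v)))
      (hvProj a ((hvSurface a).par (e2 a 0) (-u * M / D, -v * D))) := by
  rw [proj_e3_one, ← hM, proj_e2_zero, proj_e2_zero]
  refine onGraph_invol₁₀₁₀ ?_ ?_
  · field_simp
    linear_combination u ^ 4 * M ^ 3 * v ^ 3 * hM - u ^ 4 * M ^ 3 * v ^ 4 * hD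
  · field_simp

theorem onGraph_invol_e4_zero (hM : M = a + u ^ 2 * v) (hM0 : M ≠ 0) :
    OnGraph (hvInvol a) (hvProj a ((hvSurface a).par (e4 a 0) (u, v)))
      (hvProj a ((hvSurface a).par (base a (0, 0)) ((u * M ^ 3 - v) / M ^ 2, u * M))) := by
  rw [proj_e4_zero, show a + u * (u * v) = M by rw [hM]; ring, proj_e2_zero, hvProj_base]
  refine onGraph_invol₁₀₀₀ ?_ rfl
  field_simp
  linear_combination u ^ 2 * hM

theorem onGraph_invol_e4_one (hM : M = a + u * v ^ 2) (hD : D = 1 - u ^ 2 * v * M ^ 3)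
    (hM0 : M ≠ 0) (hD0 : D ≠ 0) :
    OnGraph (hvInvol a) (hvProj a ((hvSurface a).par (e4 a 1) (u, v)))
      (hvProj a ((hvSurface a).par (e1 a 0) (-u * M ^ 2 / D, -v * D / M))) := by
  rw [proj_e4_one, show a + u * v * v = M by rw [hM]; ring, proj_e2_zero, proj_e1_zero]
  refine onGraph_invol₁₀₁₀ ?_ ?_
  · field_simp
    linear_combination u ^ 3 * v ^ 2 * hM - u ^ 4 * v ^ 4 * hD
  · field_simp

theorem onGraph_invol_base₀₀ (hA : A = a + v ^ 3 - u * v ^ 2) (hA0 : A ≠ 0) :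
    OnGraph (hvInvol a) (hvProj a ((hvSurface a).par (base a (0, 0)) (u, v)))
      (hvProj a ((hvSurface a).par (e4 a 0) (v / A, (v - u) * A ^ 2))) := by
  have h : a + v / A * (v / A * ((v - u) * A ^ 2)) = A := by
    field_simp
    linear_combination -hA
  rw [proj_e4_zero, h, proj_e2_zero, hvProj_base]
  refine onGraph_invol₀₀₁₀ ?_ ?_
  · field_simp
    linear_combination -v ^ 2 * hA
  · field_simp

end Invol

/-! ### The lift of `(x, y) ↦ (-x + y + a/y², y)` -/

section InvolLift

variable {a : ℂ}

theorem regMapAt_hvInvol {v : ℂ × ℂ} (hv : v.2 ≠ 0) : RegMapAt (hvInvol a) v :=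
  ⟨by simp only [hvInvol]; fun_prop (disch := simp [hv]), by simp only [hvInvol]; fun_prop⟩

theorem hasLift_invol_base₀₁ {x : ℂ} (hx : x ≠ 0) :
    HasLift (hvInvol a) ((hvSurface a).par (base a (0, 1)) (x, 0)) := by
  obtain ⟨B, hB, rB⟩ := exists_eq_regFun (fun w => 1 - w.1 * w.2 + a * w.2 ^ 3) (by fun_prop)
  have B0 : B (x, 0) = 1 := by simp [hB]
  refine .of_charts (isGenericallyFinite_base _) (mem_base₀₁ (by simpa using hx))
    (fun w => w.2 / B w) (fun w => B w * (a * w.2 ^ 2 - w.1)) (by fun_prop (disch := simp [B0]))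
    (by fun_prop) (mem_e10_zero (by simpa [B0] using hx)) ?_
  refine (rB _).eventually_onGraph (by simp [B0]) fun w hw => ?_
  exact onGraph_invol_base₀₁ (B := B w) (by rw [hB]) hw

theorem hasLift_invol_base₁₀ {y : ℂ} (hy : y ≠ 0) :
    HasLift (hvInvol a) ((hvSurface a).par (base a (1, 0)) (0, y)) := by
  obtain ⟨D, hD, rD⟩ := exists_eq_regFun (fun w => -w.2 ^ 2 + w.1 * w.2 ^ 3 + a * w.1) (by fun_prop)
  have D0 : D (0, y) = -y ^ 2 := by simp [hD]
  refine .of_charts (isGenericallyFinite_base _) (mem_base₁₀ (by simpa using hy))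
    (fun w => w.1 * w.2 ^ 2 / D w) (fun w => w.2) (by fun_prop (disch := simp [D0, hy]))
    (by fun_prop) (mem_base₁₀ (by simpa using hy)) ?_
  refine (rD _).eventually_onGraph (by simp [D0, hy]) fun w hw => ?_
  exact onGraph_invol_base₁₀ (D := D w) (by rw [hD]) hw

theorem hasLift_invol_e5_zero {m : ℂ} (hm : m ≠ 0) :
    HasLift (hvInvol a) ((hvSurface a).par (e5 a 0) (0, m)) := by
  obtain ⟨C, hC, rC⟩ := exists_eq_regFun (fun w => 1 - a * w.1 * w.2 ^ 2) (by fun_prop)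
  obtain ⟨B, hB, rB⟩ := exists_eq_regFun (fun w => 1 - w.1 ^ 2 * w.2 * C w) (by fun_prop)
  have C0 : C (0, m) = 1 := by simp [hC]
  have B0 : B (0, m) = 1 := by simp [hB]
  refine .of_charts (isGenericallyFinite_e5 0) (mem_e5_zero (by simpa using hm))
    (fun w => -w.2 / (B w ^ 2 * C w)) (fun w => -w.1 * B w * C w)
    (by fun_prop (disch := simp [C0, B0])) (by fun_prop) (mem_e11_one (by simpa [B0, C0] using hm))
    ?_
  refine ((rC _).mul (rB _)).eventually_onGraph (by simp [C0, B0]) fun w hw => ?_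
  exact onGraph_invol_e5_zero (C := C w) (B := B w) (by rw [hC]) (by rw [hB])
    (left_ne_zero_of_mul hw) (right_ne_zero_of_mul hw)

theorem hasLift_invol_e5_one : HasLift (hvInvol a) ((hvSurface a).par (e5 a 1) (0, 0)) := by
  obtain ⟨B, hB, rB⟩ := exists_eq_regFun (fun w => 1 - w.1 * w.2 ^ 2 + a * w.2 ^ 3) (by fun_prop)
  have B0 : B (0, 0) = 1 := by simp [hB]
  refine .of_charts (isGenericallyFinite_e5 1) (mem_e5_one (by simp)) (fun w => w.2 / B w)
    (fun w => B w ^ 2 * (a * w.2 - w.1)) (by fun_prop (disch := simp [B0])) (by fun_prop)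
    (mem_e11_zero (by simp)) ?_
  refine (rB _).eventually_onGraph (by simp [B0]) fun w hw => ?_
  exact onGraph_invol_e5_one (B := B w) (by rw [hB]) hw

theorem hasLift_invol_e6_zero : HasLift (hvInvol a) ((hvSurface a).par (e6 a 0) (0, 0)) := by
  obtain ⟨C, hC, rC⟩ := exists_eq_regFun (fun w => 1 - a * w.1 ^ 3 * w.2 ^ 2) (by fun_prop)
  obtain ⟨B, hB, rB⟩ := exists_eq_regFun (fun w => 1 - w.1 ^ 3 * w.2 * C w) (by fun_prop)
  have C0 : C (0, 0) = 1 := by simp [hC]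
  have B0 : B (0, 0) = 1 := by simp [hB]
  refine .of_charts (isGenericallyFinite_e6 0) (mem_e6_zero (by simp))
    (fun w => w.2 / (B w ^ 3 * C w ^ 2)) (fun w => -w.1 * B w * C w)
    (by fun_prop (disch := simp [C0, B0])) (by fun_prop) (mem_e12_one (by simp)) ?_
  refine ((rC _).mul (rB _)).eventually_onGraph (by simp [C0, B0]) fun w hw => ?_
  exact onGraph_invol_e6_zero (C := C w) (B := B w) (by rw [hC]) (by rw [hB])
    (left_ne_zero_of_mul hw) (right_ne_zero_of_mul hw)

theorem hasLift_invol_e6_one {n : ℂ} (hn : n ≠ a) :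
    HasLift (hvInvol a) ((hvSurface a).par (e6 a 1) (n, 0)) := by
  obtain ⟨C, hC, rC⟩ := exists_eq_regFun (fun w => 1 - a * w.1 * w.2 ^ 3) (by fun_prop)
  obtain ⟨B, hB, rB⟩ := exists_eq_regFun (fun w => 1 - w.1 ^ 2 * w.2 ^ 3 * C w) (by fun_prop)
  have C0 : C (n, 0) = 1 := by simp [hC]
  have B0 : B (n, 0) = 1 := by simp [hB]
  refine .of_charts (isGenericallyFinite_e6 1) (mem_e6_one (by simpa using hn))
    (fun w => -w.2 / (B w ^ 2 * C w)) (fun w => w.1 * B w ^ 3 * C w ^ 2)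
    (by fun_prop (disch := simp [C0, B0])) (by fun_prop) (mem_e12_zero (by simpa [B0, C0] using hn))
    ?_
  refine ((rC _).mul (rB _)).eventually_onGraph (by simp [C0, B0]) fun w hw => ?_
  exact onGraph_invol_e6_one (C := C w) (B := B w) (by rw [hC]) (by rw [hB])
    (left_ne_zero_of_mul hw) (right_ne_zero_of_mul hw)

theorem hasLift_invol_e7_zero (m : ℂ) :
    HasLift (hvInvol a) ((hvSurface a).par (e7 a 0) (0, m)) := by
  obtain ⟨n, hn, rn⟩ := exists_eq_regFun (fun w => a + w.1) (by fun_prop)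
  obtain ⟨t, ht, rt⟩ := exists_eq_regFun (fun w => w.1 * w.2) (by fun_prop)
  obtain ⟨C, hC, rC⟩ := exists_eq_regFun (fun w => 1 - a * n w * t w ^ 3) (by fun_prop)
  obtain ⟨B, hB, rB⟩ := exists_eq_regFun (fun w => 1 - n w ^ 2 * t w ^ 3 * C w) (by fun_prop)
  obtain ⟨K, hK, rK⟩ := exists_eq_regFun
    (fun w => n w * C w ^ 3 * (1 + B w + B w ^ 2) + a * (1 + C w)) (by fun_prop)
  obtain ⟨G, hG, rG⟩ := exists_eq_regFun
    (fun w => B w ^ 3 * C w ^ 2 - a * n w * w.1 ^ 2 * w.2 ^ 3 * K w) (by fun_prop)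
  have t0 : t (0, m) = 0 := by simp [ht]
  have C0 : C (0, m) = 1 := by simp [hC, t0]
  have B0 : B (0, m) = 1 := by simp [hB, t0]
  have G0 : G (0, m) = 1 := by simp [hG, B0, C0]
  refine .of_charts (isGenericallyFinite_e7 0) (mem_e7_zero (by simp))
    (fun w => -w.2 / (B w ^ 2 * C w * G w)) (fun w => w.1 * G w)
    (by fun_prop (disch := simp [C0, B0, G0])) (by fun_prop) (mem_e13_one (by simp)) ?_
  refine (((rC _).mul (rB _)).mul (rG _)).eventually_onGraph (by simp [C0, B0, G0]) fun w hw =>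
    ?_
  exact onGraph_invol_e7_zero (n := n w) (t := t w) (C := C w) (B := B w) (K := K w) (G := G w)
    (by rw [hn]) (by rw [ht]) (by rw [hC]) (by rw [hB]) (by rw [hK]) (by rw [hG])
    (left_ne_zero_of_mul (left_ne_zero_of_mul hw)) (right_ne_zero_of_mul (left_ne_zero_of_mul hw))
    (right_ne_zero_of_mul hw)

theorem hasLift_invol_e8_zero (m : ℂ) :
    HasLift (hvInvol a) ((hvSurface a).par (e8 a 0) (0, m)) := by
  obtain ⟨n, hn, rn⟩ := exists_eq_regFun (fun w => a + w.1 ^ 2 * w.2) (by fun_prop)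
  obtain ⟨t, ht, rt⟩ := exists_eq_regFun (fun w => w.1 * w.2) (by fun_prop)
  obtain ⟨C, hC, rC⟩ := exists_eq_regFun (fun w => 1 - a * n w * t w ^ 3) (by fun_prop)
  obtain ⟨B, hB, rB⟩ := exists_eq_regFun (fun w => 1 - n w ^ 2 * t w ^ 3 * C w) (by fun_prop)
  obtain ⟨K, hK, rK⟩ := exists_eq_regFun
    (fun w => n w * C w ^ 3 * (1 + B w + B w ^ 2) + a * (1 + C w)) (by fun_prop)
  obtain ⟨G, hG, rG⟩ := exists_eq_regFun
    (fun w => B w ^ 3 * C w ^ 2 - a * n w * w.1 * w.2 ^ 2 * K w) (by fun_prop)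
  have t0 : t (0, m) = 0 := by simp [ht]
  have C0 : C (0, m) = 1 := by simp [hC, t0]
  have B0 : B (0, m) = 1 := by simp [hB, t0]
  have G0 : G (0, m) = 1 := by simp [hG, B0, C0]
  refine .of_charts (isGenericallyFinite_e8 0) (mem_e8 0 _)
    (fun w => w.2 / (G w * B w ^ 4 * C w ^ 2)) (fun w => -w.1 * G w * B w ^ 2 * C w)
    (by fun_prop (disch := simp [C0, B0, G0])) (by fun_prop) (mem_e14 1 _) ?_
  refine (((rC _).mul (rB _)).mul (rG _)).eventually_onGraph (by simp [C0, B0, G0]) fun w hw =>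
    ?_
  exact onGraph_invol_e8_zero (n := n w) (t := t w) (C := C w) (B := B w) (K := K w) (G := G w)
    (by rw [hn]) (by rw [ht]) (by rw [hC]) (by rw [hB]) (by rw [hK]) (by rw [hG])
    (left_ne_zero_of_mul (left_ne_zero_of_mul hw)) (right_ne_zero_of_mul (left_ne_zero_of_mul hw))
    (right_ne_zero_of_mul hw)

theorem hasLift_invol_e8_one : HasLift (hvInvol a) ((hvSurface a).par (e8 a 1) (0, 0)) := by
  obtain ⟨n, hn, rn⟩ := exists_eq_regFun (fun w => a + w.1 * w.2 ^ 2) (by fun_prop)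
  obtain ⟨C, hC, rC⟩ := exists_eq_regFun (fun w => 1 - a * n w * w.2 ^ 3) (by fun_prop)
  obtain ⟨B, hB, rB⟩ := exists_eq_regFun (fun w => 1 - n w ^ 2 * w.2 ^ 3 * C w) (by fun_prop)
  obtain ⟨K, hK, rK⟩ := exists_eq_regFun
    (fun w => n w * C w ^ 3 * (1 + B w + B w ^ 2) + a * (1 + C w)) (by fun_prop)
  have C0 : C (0, 0) = 1 := by simp [hC]
  have B0 : B (0, 0) = 1 := by simp [hB]
  refine .of_charts (isGenericallyFinite_e8 1) (mem_e8 1 _) (fun w => -w.2 / (B w ^ 2 * C w))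
    (fun w => (w.1 * B w ^ 3 * C w ^ 2 - a * n w * w.2 * K w) * B w ^ 4 * C w ^ 2)
    (by fun_prop (disch := simp [C0, B0])) (by fun_prop) (mem_e14 0 _) ?_
  refine ((rC _).mul (rB _)).eventually_onGraph (by simp [C0, B0]) fun w hw => ?_
  exact onGraph_invol_e8_one (n := n w) (C := C w) (B := B w) (K := K w) (by rw [hn]) (by rw [hC])
    (by rw [hB]) (by rw [hK]) (left_ne_zero_of_mul hw) (right_ne_zero_of_mul hw)

theorem hasLift_invol_e9_zero {m : ℂ} (hm : m ≠ 1) :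
    HasLift (hvInvol a) ((hvSurface a).par (e9 a 0) (0, m)) := by
  obtain ⟨N, hN, rN⟩ := exists_eq_regFun (fun w => 1 - w.2 + a * w.1 ^ 3 * w.2 ^ 3) (by fun_prop)
  obtain ⟨D, hD, rD⟩ := exists_eq_regFun (fun w => a * w.1 ^ 3 * w.2 ^ 2 - 1) (by fun_prop)
  have N0 : N (0, m) = 1 - m := by simp [hN]
  have D0 : D (0, m) = -1 := by simp [hD]
  refine .of_charts (isGenericallyFinite_e9 0) (mem_e9_zero (by simpa using hm))
    (fun w => w.1 / (N w * D w)) (fun w => w.2 * D w)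
    (by fun_prop (disch := simp [N0, D0, sub_eq_zero, hm])) (by fun_prop) (mem_e10_one (by simp)) ?_
  refine ((rN _).mul (rD _)).eventually_onGraph (by simp [N0, D0, sub_eq_zero, hm]) fun w hw => ?_
  exact onGraph_invol_e9_zero (N := N w) (D := D w) (by rw [hN]) (left_ne_zero_of_mul hw)
    (by rw [hD]) (right_ne_zero_of_mul hw)

theorem hasLift_invol_e9_one : HasLift (hvInvol a) ((hvSurface a).par (e9 a 1) (0, 0)) := by
  obtain ⟨N, hN, rN⟩ := exists_eq_regFun (fun w => w.1 - 1 + a * w.1 * w.2 ^ 3) (by fun_prop)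
  have N0 : N (0, 0) = -1 := by simp [hN]
  refine .of_charts (isGenericallyFinite_e9 1) (mem_e9_one (by simp)) (fun w => w.1 / N w)
    (fun w => w.2) (by fun_prop (disch := simp [N0])) (by fun_prop) (mem_e9_one (by simp)) ?_
  refine (rN _).eventually_onGraph (by simp [N0]) fun w hw => ?_
  exact onGraph_invol_e9_one (N := N w) (by rw [hN]) hw

theorem hasLift_invol_e10_zero {m : ℂ} (hm : m ≠ 0) :
    HasLift (hvInvol a) ((hvSurface a).par (e10 a 0) (0, m)) := by
  obtain ⟨A, hA, rA⟩ := exists_eq_regFun (fun w => 1 + w.1 * w.2) (by fun_prop)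
  have A0 : A (0, m) = 1 := by simp [hA]
  refine .of_charts (isGenericallyFinite_e10 0) (mem_e10_zero (by simpa using hm))
    (fun w => -w.2 / A w + a * w.1 ^ 2 * A w ^ 2) (fun w => w.1 * A w)
    (by fun_prop (disch := simp [A0])) (by fun_prop) (mem_base₀₁ (by simpa [A0] using hm)) ?_
  refine (rA _).eventually_onGraph (by simp [A0]) fun w hw => ?_
  exact onGraph_invol_e10_zero (A := A w) (by rw [hA]) hw

theorem hasLift_invol_e10_one : HasLift (hvInvol a) ((hvSurface a).par (e10 a 1) (0, 0)) := by
  obtain ⟨A, hA, rA⟩ := exists_eq_regFun (fun w => 1 + w.2) (by fun_prop)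
  obtain ⟨D, hD, rD⟩ := exists_eq_regFun (fun w => 1 - a * w.1 ^ 3 * w.2 ^ 2 * A w ^ 3)
    (by fun_prop)
  have D0 : D (0, 0) = 1 := by simp [hD]
  refine .of_charts (isGenericallyFinite_e10 1) (mem_e10_one (by simp)) (fun w => -w.1 * A w / D w)
    (fun w => -w.2 * D w) (by fun_prop (disch := simp [D0])) (by fun_prop) (mem_e9_zero (by simp))
    ?_
  refine (rD _).eventually_onGraph (by simp [D0]) fun w hw => ?_
  exact onGraph_invol_e10_one (A := A w) (D := D w) (by rw [hA]) (by rw [hD]) hw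

theorem hasLift_invol_e11_zero (m : ℂ) :
    HasLift (hvInvol a) ((hvSurface a).par (e11 a 0) (0, m)) := by
  obtain ⟨A, hA, rA⟩ := exists_eq_regFun (fun w => 1 + w.1 ^ 2 * w.2) (by fun_prop)
  have A0 : A (0, m) = 1 := by simp [hA]
  refine .of_charts (isGenericallyFinite_e11 0) (mem_e11_zero (by simp))
    (fun w => -w.2 / A w ^ 2 + a * w.1 * A w) (fun w => w.1 * A w)
    (by fun_prop (disch := simp [A0])) (by fun_prop) (mem_e5_one (by simp)) ?_
  refine (rA _).eventually_onGraph (by simp [A0]) fun w hw => ?_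
  exact onGraph_invol_e11_zero (A := A w) (by rw [hA]) hw

theorem hasLift_invol_e12_zero {m : ℂ} (hm : m ≠ a) :
    HasLift (hvInvol a) ((hvSurface a).par (e12 a 0) (0, m)) := by
  obtain ⟨A, hA, rA⟩ := exists_eq_regFun (fun w => 1 + w.1 ^ 3 * w.2 ^ 2) (by fun_prop)
  obtain ⟨D, hD, rD⟩ := exists_eq_regFun (fun w => 1 - a * w.1 ^ 3 * w.2 * A w ^ 3) (by fun_prop)
  have A0 : A (0, m) = 1 := by simp [hA]
  have D0 : D (0, m) = 1 := by simp [hD]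
  refine .of_charts (isGenericallyFinite_e12 0) (mem_e12_zero (by simpa using hm))
    (fun w => w.2 * D w ^ 2 / A w ^ 3) (fun w => -w.1 * A w ^ 2 / D w)
    (by fun_prop (disch := simp [A0])) (by fun_prop (disch := simp [D0]))
    (mem_e6_one (by simpa [A0, D0] using hm)) ?_
  refine ((rA _).mul (rD _)).eventually_onGraph (by simp [A0, D0]) fun w hw => ?_
  exact onGraph_invol_e12_zero (A := A w) (D := D w) (by rw [hA]) (by rw [hD])
    (left_ne_zero_of_mul hw) (right_ne_zero_of_mul hw)

theorem hasLift_invol_e12_one : HasLift (hvInvol a) ((hvSurface a).par (e12 a 1) (0, 0)) := by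
  obtain ⟨A, hA, rA⟩ := exists_eq_regFun (fun w => 1 + w.1 * w.2 ^ 3) (by fun_prop)
  obtain ⟨D, hD, rD⟩ := exists_eq_regFun (fun w => 1 - a * w.1 ^ 2 * w.2 ^ 3 * A w ^ 3)
    (by fun_prop)
  have A0 : A (0, 0) = 1 := by simp [hA]
  have D0 : D (0, 0) = 1 := by simp [hD]
  refine .of_charts (isGenericallyFinite_e12 1) (mem_e12_one (by simp)) (fun w => -w.2 * D w / A w)
    (fun w => w.1 * A w ^ 3 / D w ^ 2) (by fun_prop (disch := simp [A0]))
    (by fun_prop (disch := simp [D0])) (mem_e6_zero (by simp)) ?_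
  refine ((rA _).mul (rD _)).eventually_onGraph (by simp [A0, D0]) fun w hw => ?_
  exact onGraph_invol_e12_one (A := A w) (D := D w) (by rw [hA]) (by rw [hD])
    (left_ne_zero_of_mul hw) (right_ne_zero_of_mul hw)

theorem hasLift_invol_e13_zero {m : ℂ} (hm : m ≠ 0) :
    HasLift (hvInvol a) ((hvSurface a).par (e13 a 0) (0, m)) := by
  obtain ⟨M, hM, rM⟩ := exists_eq_regFun (fun w => a + w.1 * w.2) (by fun_prop)
  obtain ⟨A, hA, rA⟩ := exists_eq_regFun (fun w => 1 + w.1 ^ 3 * M w ^ 2) (by fun_prop)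
  obtain ⟨D, hD, rD⟩ := exists_eq_regFun (fun w => 1 - a * w.1 ^ 3 * M w * A w ^ 3) (by fun_prop)
  obtain ⟨L, hL, rL⟩ := exists_eq_regFun
    (fun w => a * A w ^ 3 * (1 + D w) + M w * (1 + A w + A w ^ 2)) (by fun_prop)
  have A0 : A (0, m) = 1 := by simp [hA]
  have D0 : D (0, m) = 1 := by simp [hD]
  refine .of_charts (isGenericallyFinite_e13 0) (mem_e13_zero (by simpa using hm))
    (fun w => -(w.2 * D w ^ 2 - a * w.1 ^ 2 * M w * L w) * D w / A w ^ 5)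
    (fun w => -w.1 * A w ^ 2 / D w) (by fun_prop (disch := simp [A0]))
    (by fun_prop (disch := simp [D0])) (mem_e7_one (by simpa [A0, D0] using hm)) ?_
  refine ((rA _).mul (rD _)).eventually_onGraph (by simp [A0, D0]) fun w hw => ?_
  exact onGraph_invol_e13_zero (M := M w) (A := A w) (D := D w) (L := L w) (by rw [hM]) (by rw [hA])
    (by rw [hD]) (by rw [hL]) (left_ne_zero_of_mul hw) (right_ne_zero_of_mul hw)

theorem hasLift_invol_e13_one : HasLift (hvInvol a) ((hvSurface a).par (e13 a 1) (0, 0)) := by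
  obtain ⟨s, hs, rs⟩ := exists_eq_regFun (fun w => w.1 * w.2) (by fun_prop)
  obtain ⟨M, hM, rM⟩ := exists_eq_regFun (fun w => a + w.2) (by fun_prop)
  obtain ⟨A, hA, rA⟩ := exists_eq_regFun (fun w => 1 + s w ^ 3 * M w ^ 2) (by fun_prop)
  obtain ⟨D, hD, rD⟩ := exists_eq_regFun (fun w => 1 - a * s w ^ 3 * M w * A w ^ 3) (by fun_prop)
  obtain ⟨L, hL, rL⟩ := exists_eq_regFun
    (fun w => a * A w ^ 3 * (1 + D w) + M w * (1 + A w + A w ^ 2)) (by fun_prop)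
  obtain ⟨G, hG, rG⟩ := exists_eq_regFun (fun w => D w ^ 2 - a * w.1 ^ 3 * w.2 ^ 2 * M w * L w)
    (by fun_prop)
  have s0 : s (0, 0) = 0 := by simp [hs]
  have A0 : A (0, 0) = 1 := by simp [hA, s0]
  have D0 : D (0, 0) = 1 := by simp [hD, s0]
  have G0 : G (0, 0) = 1 := by simp [hG, D0]
  refine .of_charts (isGenericallyFinite_e13 1) (mem_e13_one (by simp))
    (fun w => w.2 * G w / A w ^ 3) (fun w => -w.1 * A w ^ 5 / (D w * G w))
    (by fun_prop (disch := simp [A0])) (by fun_prop (disch := simp [D0, G0]))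
    (mem_e7_zero (by simp)) ?_
  refine (((rA _).mul (rD _)).mul (rG _)).eventually_onGraph (by simp [A0, D0, G0]) fun w hw =>
    ?_
  exact onGraph_invol_e13_one (s := s w) (M := M w) (A := A w) (D := D w) (L := L w) (G := G w)
    (by rw [hs]) (by rw [hM]) (by rw [hA]) (by rw [hD]) (by rw [hL]) (by rw [hG])
    (left_ne_zero_of_mul (left_ne_zero_of_mul hw)) (right_ne_zero_of_mul (left_ne_zero_of_mul hw))
    (right_ne_zero_of_mul hw)

theorem hasLift_invol_e14_zero (m : ℂ) :
    HasLift (hvInvol a) ((hvSurface a).par (e14 a 0) (0, m)) := by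
  obtain ⟨M, hM, rM⟩ := exists_eq_regFun (fun w => a + w.1 ^ 2 * w.2) (by fun_prop)
  obtain ⟨A, hA, rA⟩ := exists_eq_regFun (fun w => 1 + w.1 ^ 3 * M w ^ 2) (by fun_prop)
  obtain ⟨D, hD, rD⟩ := exists_eq_regFun (fun w => 1 - a * w.1 ^ 3 * M w * A w ^ 3) (by fun_prop)
  obtain ⟨L, hL, rL⟩ := exists_eq_regFun
    (fun w => a * A w ^ 3 * (1 + D w) + M w * (1 + A w + A w ^ 2)) (by fun_prop)
  have A0 : A (0, m) = 1 := by simp [hA]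
  have D0 : D (0, m) = 1 := by simp [hD]
  refine .of_charts (isGenericallyFinite_e14 0) (mem_e14 0 _)
    (fun w => (w.2 * D w ^ 2 - a * w.1 * M w * L w) * D w ^ 2 / A w ^ 7)
    (fun w => -w.1 * A w ^ 2 / D w) (by fun_prop (disch := simp [A0]))
    (by fun_prop (disch := simp [D0])) (mem_e8 1 _) ?_
  refine ((rA _).mul (rD _)).eventually_onGraph (by simp [A0, D0]) fun w hw => ?_
  exact onGraph_invol_e14_zero (M := M w) (A := A w) (D := D w) (L := L w) (by rw [hM]) (by rw [hA])
    (by rw [hD]) (by rw [hL]) (left_ne_zero_of_mul hw) (right_ne_zero_of_mul hw)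

theorem hasLift_invol_e14_one : HasLift (hvInvol a) ((hvSurface a).par (e14 a 1) (0, 0)) := by
  obtain ⟨s, hs, rs⟩ := exists_eq_regFun (fun w => w.1 * w.2) (by fun_prop)
  obtain ⟨M, hM, rM⟩ := exists_eq_regFun (fun w => a + w.1 * w.2 ^ 2) (by fun_prop)
  obtain ⟨A, hA, rA⟩ := exists_eq_regFun (fun w => 1 + s w ^ 3 * M w ^ 2) (by fun_prop)
  obtain ⟨D, hD, rD⟩ := exists_eq_regFun (fun w => 1 - a * s w ^ 3 * M w * A w ^ 3) (by fun_prop)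
  obtain ⟨L, hL, rL⟩ := exists_eq_regFun
    (fun w => a * A w ^ 3 * (1 + D w) + M w * (1 + A w + A w ^ 2)) (by fun_prop)
  obtain ⟨G, hG, rG⟩ := exists_eq_regFun (fun w => D w ^ 2 - a * w.1 ^ 2 * w.2 * M w * L w)
    (by fun_prop)
  have s0 : s (0, 0) = 0 := by simp [hs]
  have A0 : A (0, 0) = 1 := by simp [hA, s0]
  have D0 : D (0, 0) = 1 := by simp [hD, s0]
  have G0 : G (0, 0) = 1 := by simp [hG, D0]
  refine .of_charts (isGenericallyFinite_e14 1) (mem_e14 1 _) (fun w => -w.2 * G w * D w / A w ^ 5)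
    (fun w => w.1 * A w ^ 7 / (G w * D w ^ 2)) (by fun_prop (disch := simp [A0]))
    (by fun_prop (disch := simp [D0, G0])) (mem_e8 0 _) ?_
  refine (((rA _).mul (rD _)).mul (rG _)).eventually_onGraph (by simp [A0, D0, G0]) fun w hw =>
    ?_
  exact onGraph_invol_e14_one (s := s w) (M := M w) (A := A w) (D := D w) (L := L w) (G := G w)
    (by rw [hs]) (by rw [hM]) (by rw [hA]) (by rw [hD]) (by rw [hL]) (by rw [hG])
    (left_ne_zero_of_mul (left_ne_zero_of_mul hw)) (right_ne_zero_of_mul (left_ne_zero_of_mul hw))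
    (right_ne_zero_of_mul hw)

theorem hasLift_invol_e1_zero (ha : a ≠ 0) (m : ℂ) :
    HasLift (hvInvol a) ((hvSurface a).par (e1 a 0) (0, m)) := by
  obtain ⟨D, hD, rD⟩ := exists_eq_regFun (fun w => w.1 ^ 2 * w.2 - 1) (by fun_prop)
  obtain ⟨A, hA, rA⟩ := exists_eq_regFun (fun w => a + w.1 * w.2 ^ 2 * D w) (by fun_prop)
  have D0 : D (0, m) = -1 := by simp [hD]
  have A0 : A (0, m) = a := by simp [hA]
  refine .of_charts (isGenericallyFinite_e1 0) (mem_e1_zero (by simp))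
    (fun w => w.1 / (D w * A w ^ 2)) (fun w => w.2 * D w * A w)
    (by fun_prop (disch := simp [D0, A0, ha])) (by fun_prop) (mem_e4 1 _) ?_
  refine ((rA _).mul (rD _)).eventually_onGraph (by simp [D0, A0, ha]) fun w hw => ?_
  exact onGraph_invol_e1_zero (D := D w) (A := A w) (by rw [hD]) (by rw [hA])
    (left_ne_zero_of_mul hw) (right_ne_zero_of_mul hw)

theorem hasLift_invol_e2_zero {m : ℂ} (hm : m ≠ a) :
    HasLift (hvInvol a) ((hvSurface a).par (e2 a 0) (0, m)) := by
  obtain ⟨D, hD, rD⟩ := exists_eq_regFun (fun w => w.1 ^ 3 * w.2 ^ 2 - 1) (by fun_prop)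
  obtain ⟨A, hA, rA⟩ := exists_eq_regFun (fun w => a + w.2 * D w) (by fun_prop)
  have D0 : D (0, m) = -1 := by simp [hD]
  have A0 : A (0, m) = a - m := by simp [hA, D0, sub_eq_add_neg]
  refine .of_charts (isGenericallyFinite_e2 0) (mem_e2_zero (by simpa using hm))
    (fun w => w.1 / (A w * D w)) (fun w => w.2 * D w)
    (by fun_prop (disch := simp [D0, A0, sub_eq_zero, hm])) (by fun_prop) (mem_e3_one (by simp)) ?_
  refine ((rA _).mul (rD _)).eventually_onGraph (by simp [D0, A0, sub_eq_zero, hm]) fun w hw => ?_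
  exact onGraph_invol_e2_zero (D := D w) (A := A w) (by rw [hD]) (by rw [hA])
    (left_ne_zero_of_mul hw) (right_ne_zero_of_mul hw)

theorem hasLift_invol_e2_one : HasLift (hvInvol a) ((hvSurface a).par (e2 a 1) (0, 0)) := by
  obtain ⟨D, hD, rD⟩ := exists_eq_regFun (fun w => a * w.1 - 1 + w.1 * w.2 ^ 3) (by fun_prop)
  have D0 : D (0, 0) = -1 := by simp [hD]
  refine .of_charts (isGenericallyFinite_e2 1) (mem_e2_one (by simp)) (fun w => w.1 / D w)
    (fun w => w.2) (by fun_prop (disch := simp [D0])) (by fun_prop) (mem_e2_one (by simp)) ?_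
  refine (rD _).eventually_onGraph (by simp [D0]) fun w hw => ?_
  exact onGraph_invol_e2_one (D := D w) (by rw [hD]) hw

theorem hasLift_invol_e3_zero (ha : a ≠ 0) {m : ℂ} (hm : m ≠ 0) :
    HasLift (hvInvol a) ((hvSurface a).par (e3 a 0) (0, m)) := by
  obtain ⟨M, hM, rM⟩ := exists_eq_regFun (fun w => a + w.1 * w.2) (by fun_prop)
  obtain ⟨D, hD, rD⟩ := exists_eq_regFun (fun w => w.1 ^ 2 * M w ^ 3 - w.2) (by fun_prop)
  have M0 : M (0, m) = a := by simp [hM]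
  have D0 : D (0, m) = -m := by simp [hD]
  refine .of_charts (isGenericallyFinite_e3 0) (mem_e3_zero (by simpa using hm))
    (fun w => w.1 * M w ^ 2 / D w) (fun w => D w / M w)
    (by fun_prop (disch := simp [D0, hm])) (by fun_prop (disch := simp [M0, ha]))
    (mem_e1_zero (by simp)) ?_
  refine ((rM _).mul (rD _)).eventually_onGraph (by simp [M0, D0, ha, hm]) fun w hw => ?_
  exact onGraph_invol_e3_zero (M := M w) (D := D w) (by rw [hM]) (by rw [hD])
    (left_ne_zero_of_mul hw) (right_ne_zero_of_mul hw)

theorem hasLift_invol_e3_one (ha : a ≠ 0) :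
    HasLift (hvInvol a) ((hvSurface a).par (e3 a 1) (0, 0)) := by
  obtain ⟨M, hM, rM⟩ := exists_eq_regFun (fun w => a + w.2) (by fun_prop)
  obtain ⟨D, hD, rD⟩ := exists_eq_regFun (fun w => 1 - w.1 ^ 3 * w.2 ^ 2 * M w ^ 3) (by fun_prop)
  have D0 : D (0, 0) = 1 := by simp [hD]
  refine .of_charts (isGenericallyFinite_e3 1) (mem_e3_one (by simp)) (fun w => -w.1 * M w / D w)
    (fun w => -w.2 * D w) (by fun_prop (disch := simp [D0])) (by fun_prop)
    (mem_e2_zero (by simpa using ha.symm)) ?_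
  refine (rD _).eventually_onGraph (by simp [D0]) fun w hw => ?_
  exact onGraph_invol_e3_one (M := M w) (D := D w) (by rw [hM]) (by rw [hD]) hw

theorem hasLift_invol_e4_zero (ha : a ≠ 0) (m : ℂ) :
    HasLift (hvInvol a) ((hvSurface a).par (e4 a 0) (0, m)) := by
  obtain ⟨M, hM, rM⟩ := exists_eq_regFun (fun w => a + w.1 ^ 2 * w.2) (by fun_prop)
  have M0 : M (0, m) = a := by simp [hM]
  refine .of_charts (isGenericallyFinite_e4 0) (mem_e4 0 _)
    (fun w => (w.1 * M w ^ 3 - w.2) / M w ^ 2) (fun w => w.1 * M w)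
    (by fun_prop (disch := simp [M0, ha])) (by fun_prop) (mem_base₀₀ _) ?_
  refine (rM _).eventually_onGraph (by simp [M0, ha]) fun w hw => ?_
  exact onGraph_invol_e4_zero (M := M w) (by rw [hM]) hw

theorem hasLift_invol_e4_one (ha : a ≠ 0) :
    HasLift (hvInvol a) ((hvSurface a).par (e4 a 1) (0, 0)) := by
  obtain ⟨M, hM, rM⟩ := exists_eq_regFun (fun w => a + w.1 * w.2 ^ 2) (by fun_prop)
  obtain ⟨D, hD, rD⟩ := exists_eq_regFun (fun w => 1 - w.1 ^ 2 * w.2 * M w ^ 3) (by fun_prop)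
  have M0 : M (0, 0) = a := by simp [hM]
  have D0 : D (0, 0) = 1 := by simp [hD]
  refine .of_charts (isGenericallyFinite_e4 1) (mem_e4 1 _) (fun w => -w.1 * M w ^ 2 / D w)
    (fun w => -w.2 * D w / M w) (by fun_prop (disch := simp [D0]))
    (by fun_prop (disch := simp [M0, ha])) (mem_e1_zero (by simp)) ?_
  refine ((rM _).mul (rD _)).eventually_onGraph (by simp [M0, D0, ha]) fun w hw => ?_
  exact onGraph_invol_e4_one (M := M w) (D := D w) (by rw [hM]) (by rw [hD])
    (left_ne_zero_of_mul hw) (right_ne_zero_of_mul hw)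

theorem hasLift_invol_base₀₀_zero (ha : a ≠ 0) (x : ℂ) :
    HasLift (hvInvol a) ((hvSurface a).par (base a (0, 0)) (x, 0)) := by
  obtain ⟨A, hA, rA⟩ := exists_eq_regFun (fun w => a + w.2 ^ 3 - w.1 * w.2 ^ 2) (by fun_prop)
  have A0 : A (x, 0) = a := by simp [hA]
  refine .of_charts (isGenericallyFinite_base _) (mem_base₀₀ _) (fun w => w.2 / A w)
    (fun w => (w.2 - w.1) * A w ^ 2) (by fun_prop (disch := simp [A0, ha])) (by fun_prop)
    (mem_e4 0 _) ?_
  refine (rA _).eventually_onGraph (by simp [A0, ha]) fun w hw => ?_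
  exact onGraph_invol_base₀₀ (A := A w) (by rw [hA]) hw

/-- Finite points with `y = 0` are mapped to `E₄`, and the others to finite points. -/
theorem hasLift_invol_base₀₀ (ha : a ≠ 0) (x y : ℂ) :
    HasLift (hvInvol a) ((hvSurface a).par (base a (0, 0)) (x, y)) := by
  by_cases hy : y = 0
  · rw [hy]
    exact hasLift_invol_base₀₀_zero ha x
  · refine ⟨_, _, base a (0, 0), hvInvol a, rfl, isGenericallyFinite_base _, mem_base₀₀ _,
      regMapAt_hvInvol hy, mem_base₀₀ _, .of_forall fun w v _ _ hv => ?_⟩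
    rw [hvProj_base₀₀] at hv ⊢
    rw [affPt_injective hv]

theorem hasLift_invol (ha : a ≠ 0) : ∀ q : (hvSurface a).Pt, HasLift (hvInvol a) q :=
  forall_hvSurface (hasLift_invol_base₀₀ ha) (fun _ => hasLift_invol_base₀₁)
    (fun _ => hasLift_invol_base₁₀) (fun _ => hasLift_invol_e5_zero) hasLift_invol_e5_one
    hasLift_invol_e6_zero (fun _ => hasLift_invol_e6_one) hasLift_invol_e7_zero
    hasLift_invol_e8_zero hasLift_invol_e8_one (fun _ => hasLift_invol_e9_zero)
    hasLift_invol_e9_one (fun _ => hasLift_invol_e10_zero) hasLift_invol_e10_one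
    hasLift_invol_e11_zero (fun _ => hasLift_invol_e12_zero) hasLift_invol_e12_one
    (fun _ => hasLift_invol_e13_zero) hasLift_invol_e13_one hasLift_invol_e14_zero
    hasLift_invol_e14_one (hasLift_invol_e1_zero ha) (fun _ => hasLift_invol_e2_zero)
    hasLift_invol_e2_one (fun _ => hasLift_invol_e3_zero ha) (hasLift_invol_e3_one ha)
    (hasLift_invol_e4_zero ha) (hasLift_invol_e4_one ha)

theorem exists_lift_invol (ha : a ≠ 0) : ∃ T : (hvSurface a).Pt ≃ (hvSurface a).Pt,
    IsAutomorphism T ∧ T.symm = T ∧ IsLiftOf a T {w | w.2 ≠ 0} (hvInvol a) := by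
  refine exists_lift_involution (fun _ _ h => h) (fun _ h => h) (fun v hv => ?_)
    (fun v hv => regMapAt_hvInvol hv) (hasLift_invol ha)
  ext
  · simp only [hvInvol]
    ring
  · rfl

end InvolLift

/-- The Hietarinta–Viallet map lifts to a biregular automorphism of the surface. -/
theorem theorem1 (a : ℂ) (ha : a ≠ 0) :
    ∃ F : (hvSurface a).Pt ≃ (hvSurface a).Pt, IsAutomorphism F ∧
      IsLiftOf a F {w | w.2 ≠ 0} (hvMap a) ∧ IsLiftOf a F.symm {w | w.1 ≠ 0} (hvInv a) := by
  obtain ⟨S, hS, hSS, hSl⟩ := exists_lift_swap a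
  obtain ⟨T, hT, hTT, hTl⟩ := exists_lift_invol ha
  refine ⟨T.trans S, ⟨hS.1.comp hT.1, ?_⟩, fun q w hw hq => hSl _ _ trivial (hTl q w hw hq), ?_⟩
  · exact hT.2.comp hS.2
  · intro q w hw hq
    rw [Equiv.symm_trans_apply, hTT, hSS]
    exact hTl _ w.swap hw (hSl q w trivial hq)
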